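/- Let $N\subseteq\mathscr L(H)$ be a semi-finite von Neumann algebra with a normal, faithful, semi-finite trace $\tau\colon N_+\to[0,\infty]$. Let $\mathscr L^1_\tau(N)=\{x\in N:\tau(|x|)<\infty\}$, a two-sided ideal of $N$ and a Banach space for the norm $\|x\|_{1,\infty}=\|x\|+\tau(|x|)$, and write $\tau\colon\mathscr L^1_\tau(N)\to\mathbb C$ also for the linear extension of the trace. Put $GL_n(\mathscr L^1_\tau(N))=\{g\in GL_n(N): g-1_n\in M_n(\mathscr L^1_\tau(N))\}$, let $M_\infty$ and $GL_\infty$ be the direct limits of the $M_n$ and the $GL_n$ under $x\mapsto x\oplus 0$ and $g\mapsto g\oplus 1$, and let $$K_1^{\mathrm{alg}}(\mathscr L^1_\tau(N),N)=GL_\infty(\mathscr L^1_\tau(N))/[GL_\infty(\mathscr L^1_\tau(N)),GL_\infty(N)].$$ A lift of a class $c\in K_1^{\mathrm{alg}}(\mathscr L^1_\tau(N),N)$ is a smooth path $\sigma\colon[0,1]\to GL_n(\mathscr L^1_\tau(N))$, for some $n$ (smooth with respect to $\|\cdot\|_{1,\infty}$), with $\sigma(0)=1_n$ and $[\sigma(1)^{-1}]=c$.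 The semi-finite Fuglede–Kadison determinant is $$\mathrm{det}_\tau(c)=\exp\Big(-\mathrm{Re}\,\tau\Big(\mathrm{tr}\int_0^1\frac{d\sigma}{dt}\,\sigma^{-1}\,dt\Big)\Big)\qquad(\sigma\text{ any lift of }c),$$ where $\mathrm{tr}$ is the sum of the diagonal entries. Then $\mathrm{det}_\tau\colon K_1^{\mathrm{alg}}(\mathscr L^1_\tau(N),N)\to(0,\infty)$ is well defined: every class has a lift, and the right-hand side does not depend on the lift. Moreover: 1. $\mathrm{det}_\tau([gh])=\mathrm{det}_\tau([g])\,\mathrm{det}_\tau([h])$ for all $g,h\in GL_\infty(\mathscr L^1_\tau(N))$. 2. $\mathrm{det}_\tau([hgh^{-1}])=\mathrm{det}_\tau([g])$ for all $g\in GL_\infty(\mathscr L^1_\tau(N))$ and $h\in GL_\infty(N)$. 3. $\mathrm{det}_\tau([e^x])=\exp(\mathrm{Re}\,\tau(\mathrm{tr}\,x))$ for all $x\in M_\infty(\mathscr L^1_\tau(N))$. 4. $\mathrm{det}_\tau([e^x])=e^{\tau(x)}$ for all self-adjoint $x\in\mathscr L^1_\tau(N)$. -/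

import Mathlib

open scoped ENNReal NNReal
set_option linter.unusedSectionVars false

/- A von Neumann algebra `N ⊆ B(H)` as a C⋆-algebra, with the order inherited from `B(H)`. -/

section VN
variable {H : Type*} [NormedAddCommGroup H] [InnerProductSpace ℂ H] [CompleteSpace H]

instance VonNeumannAlgebra.smulMemClass :
    SMulMemClass (VonNeumannAlgebra H) ℂ (H →L[ℂ] H) where
  smul_mem {N} c _ hx := N.toStarSubalgebra.smul_mem hx c

instance VonNeumannAlgebra.isClosed_coe (N : VonNeumannAlgebra H) :
    IsClosed (N : Set (H →L[ℂ] H)) := by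
  rw [← N.centralizer_centralizer]
  exact Set.isClosed_centralizer _

theorem VonNeumannAlgebra.sqrt_mem (N : VonNeumannAlgebra H) {x : H →L[ℂ] H} (hx : x ∈ N) :
    CFC.sqrt x ∈ N := by
  have h := N.commutant_commutant
  rw [← h, VonNeumannAlgebra.mem_commutant_iff]
  intro g hg
  have h1 : Commute x g := (VonNeumannAlgebra.mem_commutant_iff.1 hg) x hx
  exact (h1.cfcₙ_nnreal _).symm.eq

instance VonNeumannAlgebra.starOrderedRing (N : VonNeumannAlgebra H) : StarOrderedRing N :=
  StarOrderedRing.of_nonneg_iff' (fun {x y} h z => add_le_add_right (α := H →L[ℂ] H) h z) fun x => by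
    constructor
    · intro hx
      have hx' : (0 : H →L[ℂ] H) ≤ x := hx
      refine ⟨⟨CFC.sqrt (x : H →L[ℂ] H), N.sqrt_mem x.2⟩, Subtype.ext ?_⟩
      have h2 : star (CFC.sqrt (x : H →L[ℂ] H)) = CFC.sqrt (x : H →L[ℂ] H) :=
        (CFC.sqrt_nonneg _).isSelfAdjoint.star_eq
      change (x : H →L[ℂ] H) = star (CFC.sqrt (x : H →L[ℂ] H)) * CFC.sqrt (x : H →L[ℂ] H)
      rw [h2, CFC.sqrt_mul_sqrt_self _ hx']
    · rintro ⟨s, rfl⟩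
      exact star_mul_self_nonneg (s : H →L[ℂ] H)

end VN

/-- A normal, faithful, semi-finite trace `τ : A₊ → [0, ∞]`; used for a von Neumann algebra `A`.
Normality: `τ` commutes with suprema of bounded increasing nets. Semi-finiteness: `τ(a)` is the
supremum of the finite values `τ(b)` with `0 ≤ b ≤ a`. -/
structure SemifiniteTrace (A : Type*) [CStarAlgebra A] [PartialOrder A] [StarOrderedRing A] where
  toFun : {a : A // 0 ≤ a} → ℝ≥0∞
  map_add' : ∀ a b : {a : A // 0 ≤ a}, toFun (a + b) = toFun a + toFun b
  map_smul' : ∀ (c : ℝ≥0) (a : {a : A // 0 ≤ a}),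
    toFun ⟨(c : ℝ) • (a : A), smul_nonneg c.2 a.2⟩ = c * toFun a
  tracial' : ∀ x : A,
    toFun ⟨star x * x, star_mul_self_nonneg x⟩ = toFun ⟨x * star x, mul_star_self_nonneg x⟩
  normal' : ∀ (S : Set {a : A // 0 ≤ a}) (a : {a : A // 0 ≤ a}),
    S.Nonempty → DirectedOn (· ≤ ·) S → IsLUB S a → IsLUB (toFun '' S) (toFun a)
  faithful' : ∀ a : {a : A // 0 ≤ a}, toFun a = 0 → a = 0
  semifinite' : ∀ a : {a : A // 0 ≤ a}, IsLUB (toFun '' {b | b ≤ a ∧ toFun b < ∞}) (toFun a)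

namespace SemifiniteTrace
variable {A : Type*} [CStarAlgebra A] [PartialOrder A] [StarOrderedRing A] (τ : SemifiniteTrace A)

/-- `τ(|x|)`. -/
noncomputable def absVal (x : A) : ℝ≥0∞ := τ.toFun ⟨CFC.abs x, CFC.abs_nonneg x⟩

/- The next facts lead to: `{x | τ(|x|) < ∞}` is a two-sided ideal, and it is complete for the
norm `‖x‖ + τ(|x|)`. -/

theorem mono {a b : {a : A // 0 ≤ a}} (h : a ≤ b) : τ.toFun a ≤ τ.toFun b := by
  have h0 : (0 : A) ≤ b.1 - a.1 := sub_nonneg.2 h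
  have : b = a + ⟨b.1 - a.1, h0⟩ := Subtype.ext (by simp)
  rw [this, τ.map_add']
  exact le_self_add

/-- Normality along norm-convergent increasing sequences. -/
theorem le_of_monotone_tendsto (F : ℕ → {a : A // 0 ≤ a}) (a : {a : A // 0 ≤ a}) (K : ℝ≥0∞)
    (hF : Monotone F) (hlim : Filter.Tendsto (fun n => (F n : A)) Filter.atTop (nhds (a : A)))
    (hK : ∀ n, τ.toFun (F n) ≤ K) : τ.toFun a ≤ K := by
  have hmono : Monotone fun n => (F n : A) := fun m n h => hF h
  have hlub : IsLUB (Set.range F) a := by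
    constructor
    · rintro _ ⟨n, rfl⟩
      exact hmono.ge_of_tendsto hlim n
    · intro b hb
      exact le_of_tendsto' (b := (b : A)) hlim fun n => hb ⟨n, rfl⟩
  have hdir : DirectedOn (· ≤ ·) (Set.range F) := by
    rintro _ ⟨m, rfl⟩ _ ⟨n, rfl⟩
    exact ⟨F (max m n), ⟨_, rfl⟩, hF (le_max_left _ _), hF (le_max_right _ _)⟩
  refine (τ.normal' _ _ (Set.range_nonempty F) hdir hlub).2 ?_
  rintro _ ⟨_, ⟨n, rfl⟩, rfl⟩
  exact hK n

theorem norm_mul_eq (x a : A) : ‖x * a‖ = ‖CFC.abs x * a‖ := by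
  have h1 := CStarRing.norm_star_mul_self (x := x * a)
  have h2 := CStarRing.norm_star_mul_self (x := CFC.abs x * a)
  have h3 : star (x * a) * (x * a) = star (CFC.abs x * a) * (CFC.abs x * a) := by
    rw [star_mul, star_mul, (CFC.abs_nonneg x).isSelfAdjoint.star_eq]
    calc star a * star x * (x * a) = star a * (star x * x) * a := by noncomm_ring
      _ = star a * (CFC.abs x * CFC.abs x) * a := by rw [CFC.abs_mul_abs]
      _ = _ := by noncomm_ring
  rw [h3, h2] at h1
  exact (mul_self_inj (norm_nonneg _) (norm_nonneg _)).1 h1.symm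

theorem cont_aux {ε : ℝ} (hε : 0 < ε) : Continuous fun t : ℝ => (|t| + ε)⁻¹ :=
  (continuous_abs.add continuous_const).inv₀ fun t => by
    have := abs_nonneg t
    exact (add_pos_of_nonneg_of_pos this hε).ne'

theorem cont_mul {f g : ℝ → ℝ} (hf : Continuous f) (hg : Continuous g) :
    Continuous fun t => f t * g t := hf.mul hg

theorem cfc_mul_aux (p : A) {f g : ℝ → ℝ} (hf : Continuous f) (hg : Continuous g) :
    cfc f p * cfc g p = cfc (fun t => f t * g t) p :=
  (cfc_mul f g p hf.continuousOn hg.continuousOn).symm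

theorem cfc_sub_aux (p : A) {f g : ℝ → ℝ} (hf : Continuous f) (hg : Continuous g) :
    cfc f p - cfc g p = cfc (fun t => f t - g t) p :=
  (cfc_sub f g p hf.continuousOn hg.continuousOn).symm

theorem norm_cfc_le_of {p : A} (hp : 0 ≤ p) {f : ℝ → ℝ} {c : ℝ} (hc : 0 ≤ c)
    (h : ∀ t, 0 ≤ t → |f t| ≤ c) : ‖cfc f p‖ ≤ c := by
  refine norm_cfc_le hc fun t ht => ?_
  exact h t (spectrum_nonneg_of_nonneg hp ht)

theorem cfc_eqOn {p : A} (hp : 0 ≤ p) {f g : ℝ → ℝ} (h : ∀ t, 0 ≤ t → f t = g t) :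
    cfc f p = cfc g p :=
  cfc_congr fun t ht => h t (spectrum_nonneg_of_nonneg hp ht)

theorem sqrt_est {ε t : ℝ} (hε : 0 < ε) (ht : 0 ≤ t) :
    |√t - t * (√t * (|t| + ε)⁻¹)| ≤ √ε := by
  have h1 : √t - t * (√t * (|t| + ε)⁻¹) = √t * ε * (t + ε)⁻¹ := by
    rw [abs_of_nonneg ht]
    have : t + ε ≠ 0 := by positivity
    field_simp
    ring
  rw [h1, abs_of_nonneg (by positivity), ← div_eq_mul_inv, div_le_iff₀ (by positivity)]
  have h2 := Real.sq_sqrt ht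
  have h3 := Real.sq_sqrt hε.le
  have h4 := Real.sqrt_nonneg t
  have h5 := Real.sqrt_nonneg ε
  nlinarith [mul_nonneg h5 (sq_nonneg (√t - √ε)), mul_nonneg h5 (mul_nonneg h4 h5), mul_nonneg h5 (sq_nonneg (√t))]

theorem id_est {ε t : ℝ} (hε : 0 < ε) (ht : 0 ≤ t) :
    |t - t * (t * (|t| + ε)⁻¹)| ≤ ε := by
  have h1 : t - t * (t * (|t| + ε)⁻¹) = t * ε * (t + ε)⁻¹ := by
    rw [abs_of_nonneg ht]
    have : t + ε ≠ 0 := by positivity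
    field_simp
    ring
  rw [h1, abs_of_nonneg (by positivity), ← div_eq_mul_inv, div_le_iff₀ (by positivity)]
  nlinarith

theorem exists_factor (x : A) : ∃ y s : A, IsSelfAdjoint s ∧ x = y * s ∧ s * s = CFC.abs x ∧
    star y * y = CFC.abs x := by
  set p := CFC.abs x with hpdef
  have hp : 0 ≤ p := CFC.abs_nonneg x
  let ε : ℕ → ℝ := fun n => 1 / ((n : ℝ) + 1)
  have hε : ∀ n, 0 < ε n := fun n => by positivity
  have hε0 : Filter.Tendsto ε Filter.atTop (nhds 0) := tendsto_one_div_add_atTop_nhds_zero_nat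
  have hsε0 : Filter.Tendsto (fun n => √(ε n)) Filter.atTop (nhds 0) := by
    have := (Real.continuous_sqrt.tendsto 0).comp hε0
    rwa [Real.sqrt_zero] at this
  let g : ℕ → ℝ → ℝ := fun n t => √t * (|t| + ε n)⁻¹
  have hg : ∀ n, Continuous (g n) := fun n => Real.continuous_sqrt.mul (cont_aux (hε n))
  let s : A := cfc Real.sqrt p
  have hs : IsSelfAdjoint s := cfc_predicate _ _
  have hid : cfc (fun t : ℝ => t) p = p := cfc_id' ℝ p hp.isSelfAdjoint
  have hss : s * s = p := by
    rw [cfc_mul_aux p Real.continuous_sqrt Real.continuous_sqrt]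
    conv_rhs => rw [← hid]
    exact cfc_eqOn hp fun t ht => Real.mul_self_sqrt ht
  -- the approximants
  let q : ℕ → A := fun n => cfc (g n) p
  have hpq : ∀ n, p * q n = cfc (fun t => t * g n t) p := fun n => by
    rw [← cfc_mul_aux p continuous_id' (hg n), hid]
  have hd : ∀ n, ‖s - p * q n‖ ≤ √(ε n) := fun n => by
    rw [hpq, cfc_sub_aux p (f := Real.sqrt) Real.continuous_sqrt (cont_mul continuous_id' (hg n))]
    exact norm_cfc_le_of hp (Real.sqrt_nonneg _) fun t ht => sqrt_est (hε n) ht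
  have hpqs : Filter.Tendsto (fun n => p * q n) Filter.atTop (nhds s) := by
    rw [tendsto_iff_norm_sub_tendsto_zero]
    refine squeeze_zero (fun _ => norm_nonneg _) (fun n => ?_) hsε0
    rw [norm_sub_rev]; exact hd n
  have hc : CauchySeq fun n => x * q n := by
    have h1 := hpqs.cauchySeq
    rw [Metric.cauchySeq_iff] at h1 ⊢
    intro e he
    obtain ⟨M, hM⟩ := h1 e he
    refine ⟨M, fun m hm n hn => ?_⟩
    have := hM m hm n hn
    rw [dist_eq_norm, ← mul_sub] at this ⊢
    rwa [norm_mul_eq]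
  obtain ⟨y, hy⟩ := cauchySeq_tendsto_of_complete hc
  refine ⟨y, s, hs, ?_, hss, ?_⟩
  · have h1 : Filter.Tendsto (fun n => x * q n * s) Filter.atTop (nhds (y * s)) :=
      hy.mul_const s
    have h2 : Filter.Tendsto (fun n => x * q n * s) Filter.atTop (nhds x) := by
      rw [tendsto_iff_norm_sub_tendsto_zero]
      refine squeeze_zero (fun _ => norm_nonneg _) (fun n => ?_) hε0
      have : x * q n * s - x = x * (q n * s - 1) := by noncomm_ring
      rw [this, norm_mul_eq, ← hpdef]
      have h3 : p * (q n * s - 1) = - (cfc (fun t => t - t * (t * (|t| + ε n)⁻¹)) p) := by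
        rw [← cfc_sub_aux p continuous_id'
          (cont_mul continuous_id' (cont_mul continuous_id' (cont_aux (hε n)))), hid, mul_sub,
          ← mul_assoc, hpq, mul_one, neg_sub,
          cfc_mul_aux p (cont_mul continuous_id' (hg n)) Real.continuous_sqrt]
        congr 1
        refine cfc_eqOn hp fun t ht => ?_
        have := Real.mul_self_sqrt ht
        simp only [g]
        linear_combination (t * (|t| + ε n)⁻¹) * this
      rw [h3, norm_neg]
      exact norm_cfc_le_of hp (hε n).le fun t ht => id_est (hε n) ht
    exact tendsto_nhds_unique h2 h1
  · have h1 : Filter.Tendsto (fun n => star (x * q n) * (x * q n)) Filter.atTop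
        (nhds (star y * y)) := hy.star.mul hy
    have h2 : Filter.Tendsto (fun n => star (x * q n) * (x * q n)) Filter.atTop (nhds p) := by
      have h3 : ∀ n, star (x * q n) * (x * q n) = star (p * q n) * (p * q n) := fun n => by
        rw [star_mul, star_mul, hp.isSelfAdjoint.star_eq]
        calc star (q n) * star x * (x * q n) = star (q n) * (star x * x) * q n := by noncomm_ring
          _ = star (q n) * (p * p) * q n := by rw [hpdef, CFC.abs_mul_abs]
          _ = _ := by noncomm_ring
      simp_rw [h3]
      have := hpqs.star.mul hpqs
      rwa [hs.star_eq, hss] at this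
    exact tendsto_nhds_unique h1 h2

/-- Bound on the real part of `c x`, for a contraction `c`. -/
theorem exists_bound (x c : A) (hc : star c * c ≤ 1) :
    (∃ b : {a : A // 0 ≤ a}, c * x + star (c * x) ≤ b ∧ τ.toFun b ≤ 2 * τ.absVal x ∧
      ‖(b : A)‖ ≤ 2 * ‖x‖) ∧
    (∃ b : {a : A // 0 ≤ a}, c * star x + star (c * star x) ≤ b ∧ τ.toFun b ≤ 2 * τ.absVal x) := by
  obtain ⟨y, s, hs, hx, hss, hyy⟩ := exists_factor x
  have hsst : star s * s = CFC.abs x := by rw [hs.star_eq, hss]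
  have e1 : τ.toFun ⟨star s * s, star_mul_self_nonneg s⟩ = τ.absVal x :=
    congrArg τ.toFun (Subtype.ext hsst)
  have e2 : τ.toFun ⟨star y * y, star_mul_self_nonneg y⟩ = τ.absVal x :=
    congrArg τ.toFun (Subtype.ext hyy)
  have key : ∀ v : A, τ.toFun ⟨(c * v) * star (c * v), mul_star_self_nonneg _⟩ ≤
      τ.toFun ⟨star v * v, star_mul_self_nonneg v⟩ := fun v => by
    rw [← τ.tracial']
    refine τ.mono ?_
    change star (c * v) * (c * v) ≤ star v * v
    have := star_left_conjugate_le_conjugate hc v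
    calc star (c * v) * (c * v) = star v * (star c * c) * v := by rw [star_mul]; noncomm_ring
      _ ≤ star v * 1 * v := this
      _ = _ := by simp
  constructor
  · refine ⟨⟨star s * s, star_mul_self_nonneg s⟩ + ⟨(c * y) * star (c * y), mul_star_self_nonneg _⟩,
      ?_, ?_, ?_⟩
    · change _ ≤ star s * s + (c * y) * star (c * y)
      have := star_mul_self_nonneg (s - star (c * y))
      rw [← sub_nonneg]
      convert this using 1
      rw [hx]
      simp only [star_sub, star_star, star_mul, hs.star_eq]
      noncomm_ring
    · rw [τ.map_add', e1, two_mul]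
      gcongr
      exact (key y).trans e2.le
    · change ‖star s * s + (c * y) * star (c * y)‖ ≤ 2 * ‖x‖
      have n1 : ‖star s * s‖ = ‖x‖ := by rw [hsst, CFC.norm_abs]
      have n2 : ‖(c * y) * star (c * y)‖ ≤ ‖x‖ := by
        rw [CStarRing.norm_self_mul_star, ← CStarRing.norm_star_mul_self]
        have n3 : ‖star y * y‖ = ‖x‖ := by rw [hyy, CFC.norm_abs]
        rw [← n3]
        refine CStarAlgebra.norm_le_norm_of_nonneg_of_le (star_mul_self_nonneg _) ?_
        calc star (c * y) * (c * y) = star y * (star c * c) * y := by rw [star_mul]; noncomm_ring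
          _ ≤ star y * 1 * y := star_left_conjugate_le_conjugate hc y
          _ = _ := by simp
      calc _ ≤ ‖star s * s‖ + ‖(c * y) * star (c * y)‖ := norm_add_le _ _
        _ ≤ _ := by rw [n1]; linarith
  · refine ⟨⟨star (star y) * star y, star_mul_self_nonneg _⟩ +
      ⟨(c * s) * star (c * s), mul_star_self_nonneg _⟩, ?_, ?_⟩
    · change _ ≤ star (star y) * star y + (c * s) * star (c * s)
      have := star_mul_self_nonneg (star y - star (c * s))
      rw [← sub_nonneg]
      convert this using 1
      rw [hx]
      simp only [star_sub, star_star, star_mul, hs.star_eq]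
      noncomm_ring
    · rw [τ.map_add', τ.tracial', two_mul]
      gcongr
      · simp only [star_star]; exact e2.le
      · exact (key s).trans e1.le

/-- `τ(|z|)` is determined by the values of `τ` on positive elements `c z`, `c` a contraction. -/
theorem absVal_le_of (z : A) (K : ℝ≥0∞)
    (h : ∀ c : A, star c * c ≤ 1 → ∀ h0 : 0 ≤ c * z,
      2 * τ.toFun ⟨c * z, h0⟩ ≤ 2 * K) : τ.absVal z ≤ K := by
  set p := CFC.abs z with hpdef
  have hp : 0 ≤ p := CFC.abs_nonneg z
  let ε : ℕ → ℝ := fun n => 1 / ((n : ℝ) + 1)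
  have hε : ∀ n, 0 < ε n := fun n => by positivity
  have hε0 : Filter.Tendsto ε Filter.atTop (nhds 0) := tendsto_one_div_add_atTop_nhds_zero_nat
  let g : ℕ → ℝ → ℝ := fun n t => (|t| + ε n)⁻¹
  have hg : ∀ n, Continuous (g n) := fun n => cont_aux (hε n)
  have hid : cfc (fun t : ℝ => t) p = p := cfc_id' ℝ p hp.isSelfAdjoint
  let q : ℕ → A := fun n => cfc (g n) p
  have hq : ∀ n, star (q n) = q n := fun n => (cfc_predicate (g n) p : IsSelfAdjoint _).star_eq
  let f : ℕ → ℝ → ℝ := fun n t => t * (t * (|t| + ε n)⁻¹)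
  have hf : ∀ n, Continuous (f n) := fun n =>
    continuous_id.mul (continuous_id.mul (cont_aux (hε n)))
  let c : ℕ → A := fun n => q n * star z
  have hqpp : ∀ n, q n * (p * p) = cfc (f n) p := fun n => by
    have hpp : p * p = cfc (fun t : ℝ => t * t) p := by
      rw [← cfc_mul_aux p continuous_id' continuous_id', hid]
    rw [hpp, cfc_mul_aux p (hg n) (cont_mul continuous_id' continuous_id')]
    refine cfc_eqOn hp fun t ht => ?_
    simp only [g, f]; ring
  have hcz : ∀ n, c n * z = cfc (f n) p := fun n => by
    rw [← hqpp, hpdef, CFC.abs_mul_abs]; simp only [c]; noncomm_ring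
  have hnorm : ∀ n, ‖c n‖ ≤ 1 := fun n => by
    rw [← norm_star]
    simp only [c, star_mul, star_star, hq]
    rw [norm_mul_eq, ← hpdef]
    have : p * q n = cfc (fun t => t * g n t) p := by
      rw [← cfc_mul_aux p continuous_id' (hg n), hid]
    rw [this]
    refine norm_cfc_le_of hp zero_le_one fun t ht => ?_
    simp only [g]
    rw [abs_of_nonneg ht, abs_of_nonneg (by have := hε n; positivity), ← div_eq_mul_inv,
      div_le_one (by have := hε n; positivity)]
    linarith [hε n]
  have hc1 : ∀ n, star (c n) * c n ≤ 1 := fun n =>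
    (CStarAlgebra.norm_le_one_iff_of_nonneg _ (star_mul_self_nonneg _)).1 <| by
      rw [CStarRing.norm_star_mul_self]
      exact mul_le_one₀ (hnorm n) (norm_nonneg _) (hnorm n)
  have hpos : ∀ n, 0 ≤ c n * z := fun n => by
    rw [hcz]
    refine cfc_nonneg fun t ht => ?_
    have := spectrum_nonneg_of_nonneg hp ht
    have := hε n
    simp only [f]; positivity
  have hmono : ∀ m n, m ≤ n → c m * z ≤ c n * z := fun m n hmn => by
    rw [hcz, hcz]
    refine cfc_mono (fun t ht => ?_) (hf m).continuousOn (hf n).continuousOn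
    have h0 : 0 ≤ t := spectrum_nonneg_of_nonneg hp ht
    have h1 := hε n
    have h2 : ε n ≤ ε m := one_div_le_one_div_of_le (by positivity) (by gcongr)
    simp only [f]
    gcongr
  have hlim : Filter.Tendsto (fun n => c n * z) Filter.atTop (nhds p) := by
    rw [tendsto_iff_norm_sub_tendsto_zero]
    refine squeeze_zero (fun _ => norm_nonneg _) (fun n => ?_) hε0
    rw [norm_sub_rev, hcz]
    conv_lhs => rw [← hid]
    rw [hid]
    have : p - cfc (f n) p = cfc (fun t => t - f n t) p := by
      rw [← cfc_sub_aux p continuous_id' (hf n), hid]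
    rw [this]
    exact norm_cfc_le_of hp (hε n).le fun t ht => id_est (hε n) ht
  refine τ.le_of_monotone_tendsto (fun n => ⟨c n * z, hpos n⟩) ⟨p, hp⟩ K
    (fun m n h => hmono m n h) hlim fun n => ?_
  exact (ENNReal.mul_le_mul_iff_right two_ne_zero ENNReal.ofNat_ne_top).1
    (h (c n) (hc1 n) (hpos n))

theorem absVal_add_le (x y : A) : τ.absVal (x + y) ≤ τ.absVal x + τ.absVal y := by
  refine τ.absVal_le_of _ _ fun c h1 h0 => ?_
  obtain ⟨⟨b, hb, hb', -⟩, -⟩ := τ.exists_bound x c h1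
  obtain ⟨⟨d, hd, hd', -⟩, -⟩ := τ.exists_bound y c h1
  calc 2 * τ.toFun ⟨c * (x + y), h0⟩
      = τ.toFun (⟨c * (x + y), h0⟩ + ⟨c * (x + y), h0⟩) := by rw [τ.map_add', two_mul]
    _ ≤ τ.toFun (b + d) := τ.mono <| by
        change c * (x + y) + c * (x + y) ≤ b.1 + d.1
        calc c * (x + y) + c * (x + y) = c * (x + y) + star (c * (x + y)) := by
              rw [h0.isSelfAdjoint.star_eq]
          _ = (c * x + star (c * x)) + (c * y + star (c * y)) := by
              simp only [mul_add, star_add]; abel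
          _ ≤ _ := add_le_add hb hd
    _ ≤ _ := by rw [τ.map_add', mul_add]; exact add_le_add hb' hd'

theorem absVal_star_le (x : A) : τ.absVal (star x) ≤ τ.absVal x := by
  refine τ.absVal_le_of _ _ fun c h1 h0 => ?_
  obtain ⟨-, ⟨b, hb, hb'⟩⟩ := τ.exists_bound x c h1
  calc 2 * τ.toFun ⟨c * star x, h0⟩
      = τ.toFun (⟨c * star x, h0⟩ + ⟨c * star x, h0⟩) := by rw [τ.map_add', two_mul]
    _ ≤ τ.toFun b := τ.mono <| by
        change c * star x + c * star x ≤ b.1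
        calc c * star x + c * star x = c * star x + star (c * star x) := by
              rw [h0.isSelfAdjoint.star_eq]
          _ ≤ _ := hb
    _ ≤ _ := hb'

theorem absVal_smul (r : ℂ) (x : A) : τ.absVal (r • x) = ‖r‖₊ * τ.absVal x := by
  have := τ.map_smul' ‖r‖₊ ⟨CFC.abs x, CFC.abs_nonneg x⟩
  unfold absVal
  rw [← this]
  exact congrArg τ.toFun (Subtype.ext (CFC.abs_smul r x))

theorem absVal_mul_le_of_norm_le_one (a x : A) (ha : ‖a‖ ≤ 1) :
    τ.absVal (a * x) ≤ τ.absVal x := by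
  refine τ.absVal_le_of _ _ fun c h1 h0 => ?_
  have hc : ‖c‖ ≤ 1 := by
    have := (CStarAlgebra.norm_le_one_iff_of_nonneg _ (star_mul_self_nonneg c)).2 h1
    rw [CStarRing.norm_star_mul_self] at this
    nlinarith [norm_nonneg c]
  have hca : ‖c * a‖ ≤ 1 := (norm_mul_le _ _).trans (mul_le_one₀ hc (norm_nonneg _) ha)
  have h3 : star (c * a) * (c * a) ≤ 1 :=
    (CStarAlgebra.norm_le_one_iff_of_nonneg _ (star_mul_self_nonneg _)).1 <| by
      rw [CStarRing.norm_star_mul_self]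
      exact mul_le_one₀ hca (norm_nonneg _) hca
  obtain ⟨⟨b, hb, hb', -⟩, -⟩ := τ.exists_bound x (c * a) h3
  calc 2 * τ.toFun ⟨c * (a * x), h0⟩
      = τ.toFun (⟨c * (a * x), h0⟩ + ⟨c * (a * x), h0⟩) := by rw [τ.map_add', two_mul]
    _ ≤ τ.toFun b := τ.mono <| by
        change c * (a * x) + c * (a * x) ≤ b.1
        calc c * (a * x) + c * (a * x) = c * (a * x) + star (c * (a * x)) := by
              rw [h0.isSelfAdjoint.star_eq]
          _ = c * a * x + star (c * a * x) := by rw [mul_assoc]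
          _ ≤ _ := hb
    _ ≤ _ := hb'

theorem absVal_zero : τ.absVal (0 : A) = 0 := by
  simpa using τ.absVal_smul 0 0

theorem absVal_mul_le (a x : A) : τ.absVal (a * x) ≤ ‖a‖₊ * τ.absVal x := by
  rcases eq_or_ne a 0 with rfl | ha
  · simp [τ.absVal_zero]
  have hn : ‖a‖ ≠ 0 := norm_ne_zero_iff.2 ha
  have e : a * x = ((‖a‖ : ℝ) : ℂ) • ((((‖a‖⁻¹ : ℝ) : ℂ) • a) * x) := by
    rw [smul_mul_assoc, smul_smul, ← Complex.ofReal_mul, mul_inv_cancel₀ hn]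
    simp
  rw [e, absVal_smul]
  have h1 : ‖((‖a‖ : ℝ) : ℂ)‖₊ = ‖a‖₊ := by ext; simp
  rw [h1]
  gcongr
  refine τ.absVal_mul_le_of_norm_le_one _ _ ?_
  rw [norm_smul, Complex.norm_real, norm_inv, norm_norm, inv_mul_cancel₀ hn]

theorem toFun_sum (b : ℕ → {a : A // 0 ≤ a}) (n : ℕ) :
    τ.toFun (∑ k ∈ Finset.range n, b k) = ∑ k ∈ Finset.range n, τ.toFun (b k) := by
  induction n with
  | zero =>
    have := τ.map_smul' 0 0
    simp only [Finset.range_zero, Finset.sum_empty, ENNReal.coe_zero, zero_mul] at this ⊢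
    rw [← this]
    exact congrArg τ.toFun (Subtype.ext (by simp))
  | succ n ih => rw [Finset.sum_range_succ, Finset.sum_range_succ, τ.map_add', ih]

theorem absVal_le_tsum (d : ℕ → A) (z : A) (hz : HasSum d z) (hd : Summable fun k => ‖d k‖) :
    τ.absVal z ≤ ∑' k, τ.absVal (d k) := by
  refine τ.absVal_le_of _ _ fun c h1 h0 => ?_
  have hb := fun k => (τ.exists_bound (d k) c h1).1
  choose b hb1 hb2 hb3 using hb
  have hbs : Summable fun k => (b k : A) :=
    Summable.of_norm_bounded (hd.mul_left 2) hb3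
  obtain ⟨B, hB⟩ := hbs
  have hB0 : 0 ≤ B := hB.nonneg fun k => (b k).2
  have hcz : HasSum (fun k => c * d k + star (c * d k)) (c * z + star (c * z)) :=
    (hz.mul_left c).add (hz.mul_left c).star
  have hle : c * z + star (c * z) ≤ B := hasSum_le hb1 hcz hB
  have hcoe : ∀ n, ((∑ k ∈ Finset.range n, b k : {a : A // 0 ≤ a}) : A) =
      ∑ k ∈ Finset.range n, (b k : A) := fun n => by
    induction n with
    | zero => simp
    | succ n ih => rw [Finset.sum_range_succ, Finset.sum_range_succ, ← ih]; rfl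
  calc 2 * τ.toFun ⟨c * z, h0⟩
      = τ.toFun (⟨c * z, h0⟩ + ⟨c * z, h0⟩) := by rw [τ.map_add', two_mul]
    _ ≤ τ.toFun ⟨B, hB0⟩ := τ.mono <| by
        change c * z + c * z ≤ B
        rwa [h0.isSelfAdjoint.star_eq] at hle
    _ ≤ 2 * ∑' k, τ.absVal (d k) := by
        refine τ.le_of_monotone_tendsto (fun n => ∑ k ∈ Finset.range n, b k) ⟨B, hB0⟩ _ ?_ ?_ ?_
        · refine monotone_nat_of_le_succ fun n => ?_
          change ((∑ k ∈ Finset.range n, b k : {a : A // 0 ≤ a}) : A) ≤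
            ((∑ k ∈ Finset.range (n + 1), b k : {a : A // 0 ≤ a}) : A)
          rw [hcoe, hcoe, Finset.sum_range_succ]
          exact le_add_of_nonneg_right (b n).2
        · simp_rw [hcoe]
          exact hB.tendsto_sum_nat
        · intro n
          rw [τ.toFun_sum, ← ENNReal.tsum_mul_left]
          exact (Finset.sum_le_sum fun k _ => hb2 k).trans (ENNReal.sum_le_tsum _)

theorem absVal_star (x : A) : τ.absVal (star x) = τ.absVal x :=
  le_antisymm (τ.absVal_star_le x) (by simpa using τ.absVal_star_le (star x))

theorem absVal_mul_le' (x a : A) : τ.absVal (x * a) ≤ ‖a‖₊ * τ.absVal x := by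
  rw [← τ.absVal_star (x * a), star_mul, ← τ.absVal_star x]
  simpa using τ.absVal_mul_le (star a) (star x)

/-- The trace ideal `L¹_τ(A) = {x | τ(|x|) < ∞}`. -/
noncomputable def traceIdeal : Submodule ℂ A where
  carrier := {x | τ.absVal x < ∞}
  add_mem' {x y} hx hy := (τ.absVal_add_le x y).trans_lt (ENNReal.add_lt_top.2 ⟨hx, hy⟩)
  zero_mem' := by simp [τ.absVal_zero]
  smul_mem' c x hx := by
    change τ.absVal (c • x) < ∞
    rw [τ.absVal_smul]
    exact ENNReal.mul_lt_top ENNReal.coe_lt_top hx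

theorem mul_mem_left {x : A} (a : A) (hx : x ∈ τ.traceIdeal) : a * x ∈ τ.traceIdeal :=
  (τ.absVal_mul_le a x).trans_lt (ENNReal.mul_lt_top ENNReal.coe_lt_top hx)

theorem mul_mem_right {x : A} (a : A) (hx : x ∈ τ.traceIdeal) : x * a ∈ τ.traceIdeal :=
  (τ.absVal_mul_le' x a).trans_lt (ENNReal.mul_lt_top ENNReal.coe_lt_top hx)

/-- The trace ideal as a space of its own, to be equipped with the norm
`‖x‖ + τ(|x|)` instead of the norm inherited from `A`. -/
def TraceClass : Type _ := τ.traceIdeal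

namespace TraceClass

noncomputable instance : AddCommGroup τ.TraceClass := inferInstanceAs (AddCommGroup τ.traceIdeal)

noncomputable instance : Module ℂ τ.TraceClass := inferInstanceAs (Module ℂ τ.traceIdeal)

/-- The inclusion `L¹_τ(A) → A`. -/
noncomputable def incl : τ.TraceClass →ₗ[ℂ] A := τ.traceIdeal.subtype

variable {τ} in
/-- An element of the trace ideal, seen in `TraceClass`. -/
noncomputable def mk (x : A) (hx : x ∈ τ.traceIdeal) : τ.TraceClass := (⟨x, hx⟩ : τ.traceIdeal)

theorem incl_injective : Function.Injective (incl τ) := Subtype.val_injective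

theorem absVal_incl_ne_top (x : τ.TraceClass) : τ.absVal (incl τ x) ≠ ∞ :=
  (show (incl τ x) ∈ τ.traceIdeal from Subtype.property (p := (· ∈ τ.traceIdeal)) x).ne

/-- `‖x‖_{1,∞} = ‖x‖ + τ(|x|)`. -/
noncomputable instance : Norm τ.TraceClass := ⟨fun x => ‖incl τ x‖ + (τ.absVal (incl τ x)).toReal⟩

theorem norm_def (x : τ.TraceClass) : ‖x‖ = ‖incl τ x‖ + (τ.absVal (incl τ x)).toReal := rfl

theorem normCore : NormedSpace.Core ℂ τ.TraceClass where
  norm_nonneg x := add_nonneg (norm_nonneg _) ENNReal.toReal_nonneg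
  norm_smul c x := by
    rw [norm_def, norm_def, map_smul, norm_smul, τ.absVal_smul, ENNReal.toReal_mul, mul_add]
    simp
  norm_triangle x y := by
    rw [norm_def, norm_def, norm_def, map_add]
    have h := ENNReal.toReal_mono
      (ENNReal.add_ne_top.2 ⟨absVal_incl_ne_top τ x, absVal_incl_ne_top τ y⟩)
      (τ.absVal_add_le (incl τ x) (incl τ y))
    rw [ENNReal.toReal_add (absVal_incl_ne_top τ x) (absVal_incl_ne_top τ y)] at h
    linarith [norm_add_le (incl τ x) (incl τ y)]
  norm_eq_zero_iff x := by
    constructor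
    · intro h
      rw [norm_def] at h
      have h1 := norm_nonneg (incl τ x)
      have h2 : 0 ≤ (τ.absVal (incl τ x)).toReal := ENNReal.toReal_nonneg
      have h3 : ‖incl τ x‖ = 0 := by linarith
      exact incl_injective τ (by rw [norm_eq_zero.1 h3, map_zero])
    · rintro rfl
      rw [norm_def, map_zero, τ.absVal_zero]
      simp

noncomputable instance : NormedAddCommGroup τ.TraceClass := NormedAddCommGroup.ofCore (normCore τ)

noncomputable instance : NormedSpace ℂ τ.TraceClass := NormedSpace.ofCore (normCore τ)

instance : CompleteSpace τ.TraceClass := by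
  refine NormedAddCommGroup.completeSpace_of_summable_imp_tendsto fun d hd => ?_
  have h1 : ∀ k, ‖incl τ (d k)‖ ≤ ‖d k‖ := fun k =>
    le_add_of_nonneg_right ENNReal.toReal_nonneg
  have h2 : ∀ k, (τ.absVal (incl τ (d k))).toReal ≤ ‖d k‖ := fun k =>
    le_add_of_nonneg_left (norm_nonneg _)
  have hs1 : Summable fun k => ‖incl τ (d k)‖ :=
    Summable.of_nonneg_of_le (fun _ => norm_nonneg _) h1 hd
  have hs2 : Summable fun k => (τ.absVal (incl τ (d k))).toReal :=
    Summable.of_nonneg_of_le (fun _ => ENNReal.toReal_nonneg) h2 hd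
  have hs3 : ∑' k, τ.absVal (incl τ (d k)) ≠ ∞ := by
    have := hs2.tsum_ofReal_ne_top
    simpa only [ENNReal.ofReal_toReal (absVal_incl_ne_top τ _)] using this
  obtain ⟨z, hz⟩ := hs1.of_norm
  have htail : ∀ n, τ.absVal (z - ∑ k ∈ Finset.range n, incl τ (d k)) ≤
      ∑' k, τ.absVal (incl τ (d (k + n))) := fun n =>
    τ.absVal_le_tsum (fun k => incl τ (d (k + n))) _
      ((hasSum_nat_add_iff' n).2 hz) ((summable_nat_add_iff n).2 hs1)
  have hzmem : z ∈ τ.traceIdeal := (τ.absVal_le_tsum _ z hz hs1).trans_lt hs3.lt_top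
  refine ⟨mk z hzmem, ?_⟩
  rw [tendsto_iff_norm_sub_tendsto_zero]
  have e1 : ∀ n, incl τ (∑ k ∈ Finset.range n, d k - mk z hzmem) =
      ∑ k ∈ Finset.range n, incl τ (d k) - z := fun n => by
    rw [map_sub, map_sum]; rfl
  have t1 : Filter.Tendsto (fun n => ‖∑ k ∈ Finset.range n, incl τ (d k) - z‖) Filter.atTop
      (nhds 0) := tendsto_iff_norm_sub_tendsto_zero.1 hz.tendsto_sum_nat
  have t2 : Filter.Tendsto
      (fun n => (τ.absVal (∑ k ∈ Finset.range n, incl τ (d k) - z)).toReal) Filter.atTop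
      (nhds 0) := by
    have t3 := (ENNReal.tendsto_toReal ENNReal.zero_ne_top).comp
      (ENNReal.tendsto_sum_nat_add (fun k => τ.absVal (incl τ (d k))) hs3)
    rw [ENNReal.toReal_zero] at t3
    refine squeeze_zero (fun _ => ENNReal.toReal_nonneg) (fun n => ?_) t3
    have e2 : τ.absVal (∑ k ∈ Finset.range n, incl τ (d k) - z) =
        τ.absVal (z - ∑ k ∈ Finset.range n, incl τ (d k)) := by
      rw [absVal, absVal, ← neg_sub]
      exact congrArg τ.toFun (Subtype.ext (CFC.abs_neg _))
    rw [e2]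
    refine ENNReal.toReal_mono ?_ (htail n)
    refine ne_top_of_le_ne_top hs3 ?_
    exact ENNReal.tsum_comp_le_tsum_of_injective (add_left_injective n)
      (fun k => τ.absVal (incl τ (d k)))
  simpa [norm_def, e1] using t1.add t2

end TraceClass
end SemifiniteTrace

section AlgebraicK

variable {R : Type*} [Ring R]

/-- `GL_n(R)`. -/
abbrev GLn (R : Type*) [Ring R] (n : ℕ) : Type _ := (Matrix (Fin n) (Fin n) R)ˣ

/-- The inclusion `M_n(R) → M_m(R)`, `x ↦ x ⊕ 0`. -/
def blockIncl (n m : ℕ) (x : Matrix (Fin n) (Fin n) R) : Matrix (Fin m) (Fin m) R :=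
  Matrix.of fun i j => if h : i.1 < n ∧ j.1 < n then x ⟨i.1, h.1⟩ ⟨j.1, h.2⟩ else 0

theorem blockIncl_apply (n m : ℕ) (x : Matrix (Fin n) (Fin n) R) (i j : Fin m) :
    blockIncl n m x i j =
      if h : i.1 < n ∧ j.1 < n then x ⟨i.1, h.1⟩ ⟨j.1, h.2⟩ else 0 := rfl

theorem blockIncl_add (n m : ℕ) (x y : Matrix (Fin n) (Fin n) R) :
    blockIncl n m (x + y) = blockIncl n m x + blockIncl n m y := by
  ext i j
  simp only [blockIncl_apply, Matrix.add_apply]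
  split_ifs <;> simp

theorem blockIncl_mul {n m : ℕ} (hnm : n ≤ m) (x y : Matrix (Fin n) (Fin n) R) :
    blockIncl n m (x * y) = blockIncl n m x * blockIncl n m y := by
  ext i j
  rw [Matrix.mul_apply]
  by_cases h : i.1 < n ∧ j.1 < n
  · rw [blockIncl_apply, dif_pos h, Matrix.mul_apply]
    refine Finset.sum_of_injOn (Fin.castLE hnm) (Fin.castLE_injective hnm).injOn
      (fun _ _ => Finset.mem_coe.2 (Finset.mem_univ _)) ?_ ?_
    · intro k _ hk
      have : ¬ k.1 < n := fun hk' => hk ⟨⟨k.1, hk'⟩, by simp, rfl⟩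
      simp [blockIncl_apply, this]
    · intro k _
      simp [blockIncl_apply, h.1, h.2]
  · rw [blockIncl_apply, dif_neg h]
    refine (Finset.sum_eq_zero fun k _ => ?_).symm
    by_cases h1 : i.1 < n
    · have h2 : ¬ j.1 < n := fun h2 => h ⟨h1, h2⟩
      simp [blockIncl_apply, h2]
    · simp [blockIncl_apply, h1]

theorem blockIncl_self (n : ℕ) (x : Matrix (Fin n) (Fin n) R) : blockIncl n n x = x := by
  ext i j
  simp [blockIncl_apply]

theorem blockIncl_blockIncl {n m l : ℕ} (h : n ≤ m) (x : Matrix (Fin n) (Fin n) R) :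
    blockIncl m l (blockIncl n m x) = blockIncl n l x := by
  ext i j
  simp only [blockIncl_apply]
  by_cases hi : i.1 < n <;> by_cases hj : j.1 < n <;> simp [hi, hj]
  rw [dif_pos ⟨hi.trans_le h, hj.trans_le h⟩]

/-- `g ↦ g ⊕ 1`, on all matrices: `(g - 1) ⊕ 0 + 1`. -/
def blockStab {n m : ℕ} (h : n ≤ m) :
    Matrix (Fin n) (Fin n) R →* Matrix (Fin m) (Fin m) R where
  toFun g := blockIncl n m (g - 1) + 1
  map_one' := by
    rw [sub_self]
    ext i j
    simp [blockIncl_apply]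
  map_mul' g k := by
    have e : g * k - 1 = (g - 1) * (k - 1) + (g - 1) + (k - 1) := by noncomm_ring
    rw [e, blockIncl_add, blockIncl_add, blockIncl_mul h]
    noncomm_ring

/-- The inclusion `GL_n(R) → GL_m(R)`, `g ↦ g ⊕ 1`. -/
def stab {n m : ℕ} (h : n ≤ m) : GLn R n →* GLn R m := Units.map (blockStab h)

theorem stab_sub_one {n m : ℕ} (h : n ≤ m) (g : GLn R n) :
    (stab h g : Matrix (Fin m) (Fin m) R) - 1 =
      blockIncl n m ((g : Matrix (Fin n) (Fin n) R) - 1) :=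
  add_sub_cancel_right _ _

instance stab_directedSystem :
    DirectedSystem (fun n => GLn R n) (fun _ _ h => (stab h : _ →* _)) where
  map_self n g := by
    refine Units.ext (sub_left_injective (b := (1 : Matrix _ _ R)) ?_)
    change (stab le_rfl g : Matrix (Fin n) (Fin n) R) - 1 = (g : Matrix (Fin n) (Fin n) R) - 1
    rw [stab_sub_one, blockIncl_self]
  map_map l m n hnm hml g := by
    refine Units.ext (sub_left_injective (b := (1 : Matrix _ _ R)) ?_)
    change ((stab hml (stab hnm g) : GLn R l) : Matrix (Fin l) (Fin l) R) - 1 =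
      ((stab (hnm.trans hml) g : GLn R l) : Matrix (Fin l) (Fin l) R) - 1
    rw [stab_sub_one, stab_sub_one, stab_sub_one, blockIncl_blockIncl hnm]

variable (R) in
/-- `GL_∞(R)`, the direct limit of the groups `GL_n(R)`. -/
abbrev GLInf : Type _ := DirectLimit (fun n => GLn R n) (fun _ _ h => (stab h : GLn R _ →* GLn R _))

/-- The class in `GL_∞(R)` of an element of `GL_n(R)`. -/
def GLInf.of {n : ℕ} (g : GLn R n) : GLInf R := Quotient.mk _ ⟨n, g⟩

theorem GLInf.of_stab {n m : ℕ} (h : n ≤ m) (g : GLn R n) : GLInf.of (stab h g) = GLInf.of g :=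
  (Quotient.sound (s := DirectLimit.setoid _) (a := (⟨n, g⟩ : Σ n, GLn R n))
    (b := (⟨m, stab h g⟩ : Σ n, GLn R n)) ⟨m, h, le_rfl, (DirectedSystem.map_self'
    (f := fun _ _ h => (stab h : GLn R _ →* GLn R _)) _).symm⟩).symm

theorem GLInf.of_mul {n : ℕ} (g h : GLn R n) : GLInf.of (g * h) = GLInf.of g * GLInf.of h :=
  (DirectLimit.mul_def n g h).symm

variable (J : TwoSidedIdeal R)

/-- `GL_n(J) = {g ∈ GL_n(R) | g - 1 ∈ M_n(J)}` for a two-sided ideal `J` of `R`. -/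
def relGLn (n : ℕ) : Subgroup (GLn R n) where
  carrier := {g | ∀ i j, ((g : Matrix (Fin n) (Fin n) R) - 1) i j ∈ J}
  one_mem' i j := by
    rw [Units.val_one, sub_self]
    exact J.zero_mem
  mul_mem' {g h} hg hh i j := by
    have e : ((g * h : GLn R n) : Matrix (Fin n) (Fin n) R) - 1 =
        ((g : Matrix (Fin n) (Fin n) R) - 1) * h + ((h : Matrix (Fin n) (Fin n) R) - 1) := by
      rw [Units.val_mul]; noncomm_ring
    rw [e, Matrix.add_apply, Matrix.mul_apply]
    exact J.add_mem (sum_mem fun k _ => J.mul_mem_right _ _ (hg i k)) (hh i j)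
  inv_mem' {g} hg i j := by
    have e : ((g⁻¹ : GLn R n) : Matrix (Fin n) (Fin n) R) - 1 =
        -(((g : Matrix (Fin n) (Fin n) R) - 1) * ((g⁻¹ : GLn R n) : Matrix (Fin n) (Fin n) R)) := by
      rw [sub_mul, Units.mul_inv]; noncomm_ring
    rw [e, Matrix.neg_apply, Matrix.mul_apply]
    exact J.neg_mem (sum_mem fun k _ => J.mul_mem_right _ _ (hg i k))

theorem mem_relGLn {n : ℕ} {g : GLn R n} :
    g ∈ relGLn J n ↔ ∀ i j, ((g : Matrix (Fin n) (Fin n) R) - 1) i j ∈ J := Iff.rfl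

theorem conj_mem_relGLn {n : ℕ} {g : GLn R n} (hg : g ∈ relGLn J n) (h : GLn R n) :
    h * g * h⁻¹ ∈ relGLn J n := fun i j => by
  have e : ((h * g * h⁻¹ : GLn R n) : Matrix (Fin n) (Fin n) R) - 1 =
      (h : Matrix (Fin n) (Fin n) R) * ((g : Matrix (Fin n) (Fin n) R) - 1) *
        ((h⁻¹ : GLn R n) : Matrix (Fin n) (Fin n) R) := by
    rw [mul_sub, sub_mul, mul_one, Units.mul_inv]
    rfl
  rw [e, Matrix.mul_apply]
  refine sum_mem fun k _ => J.mul_mem_right _ _ ?_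
  rw [Matrix.mul_apply]
  exact sum_mem fun l _ => J.mul_mem_left _ _ (hg l k)

theorem stab_mem_relGLn {n m : ℕ} (h : n ≤ m) {g : GLn R n} (hg : g ∈ relGLn J n) :
    stab h g ∈ relGLn J m := fun i j => by
  rw [stab_sub_one, blockIncl_apply]
  split_ifs
  · exact hg _ _
  · exact J.zero_mem

/-- `GL_∞(J)`, as the subgroup of `GL_∞(R)` formed by the classes of elements of the
groups `GL_n(J)`. -/
noncomputable def relGL : Subgroup (GLInf R) where
  carrier := {c | ∃ n, ∃ g ∈ relGLn J n, GLInf.of g = c}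
  one_mem' := ⟨0, 1, one_mem _, (DirectLimit.one_def 0).symm⟩
  mul_mem' := by
    rintro _ _ ⟨n, g, hg, rfl⟩ ⟨m, h, hh, rfl⟩
    refine ⟨max n m, stab (le_max_left n m) g * stab (le_max_right n m) h,
      mul_mem (stab_mem_relGLn J _ hg) (stab_mem_relGLn J _ hh), ?_⟩
    rw [GLInf.of_mul, GLInf.of_stab, GLInf.of_stab]
  inv_mem' := by
    rintro _ ⟨n, g, hg, rfl⟩
    exact ⟨n, g⁻¹, inv_mem hg, rfl⟩

instance relGL_normal : (relGL J).Normal where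
  conj_mem := by
    rintro _ ⟨n, g, hg, rfl⟩ c
    induction c using DirectLimit.induction with
    | _ m h =>
      refine ⟨max n m, stab (le_max_right n m) h * stab (le_max_left n m) g *
        (stab (le_max_right n m) h)⁻¹, conj_mem_relGLn J (stab_mem_relGLn J _ hg) _, ?_⟩
      rw [GLInf.of_mul, GLInf.of_mul, GLInf.of_stab]
      have e : GLInf.of (stab (le_max_right n m) h)⁻¹ = (GLInf.of h)⁻¹ := by
        rw [← GLInf.of_stab (le_max_right n m) h]; rfl
      rw [e, GLInf.of_stab]
      rfl

/-- The class in `GL_∞(J)` of an element of `GL_n(J)`. -/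
noncomputable def relGL.of {n : ℕ} (g : relGLn J n) : relGL J := ⟨GLInf.of g.1, n, g.1, g.2, rfl⟩

/-- The first algebraic `K`-group `K₁^alg(J, R) = GL_∞(J) / [GL_∞(J), GL_∞(R)]`. -/
abbrev K1alg : Type _ := relGL J ⧸ (⁅relGL J, (⊤ : Subgroup (GLInf R))⁆.subgroupOf (relGL J))

/-- The class `[g]` in `K₁^alg(J, R)` of `g ∈ GL_∞(J)`. -/
noncomputable def K1alg.mk (g : relGL J) : K1alg J := QuotientGroup.mk g

end AlgebraicK

namespace SemifiniteTrace
open scoped ComplexStarModule Interval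

variable {A : Type*} [CStarAlgebra A] [PartialOrder A] [StarOrderedRing A] (τ : SemifiniteTrace A)

/-- The trace ideal as a two-sided ideal. -/
noncomputable def ideal : TwoSidedIdeal A :=
  TwoSidedIdeal.mk' (τ.traceIdeal : Set A) τ.traceIdeal.zero_mem (fun h h' => add_mem h h')
    (fun h => neg_mem h) (fun h => τ.mul_mem_left _ h) (fun h => τ.mul_mem_right _ h)

theorem mem_ideal {x : A} : x ∈ τ.ideal ↔ x ∈ τ.traceIdeal := by
  simp [ideal]

/-- The value `τ(h) = τ(h⁺) - τ(h⁻)` for self-adjoint `h` in the trace ideal. -/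
noncomputable def saValue (h : A) : ℝ :=
  (τ.toFun ⟨h⁺, CFC.posPart_nonneg h⟩).toReal - (τ.toFun ⟨h⁻, CFC.negPart_nonneg h⟩).toReal

/-- The functional `τ : L¹_τ(A) → ℂ`, the linear extension of the trace:
real and imaginary parts are split into positive and negative parts, all in the trace ideal. -/
noncomputable def functional (x : τ.TraceClass) : ℂ :=
  τ.saValue (ℜ (TraceClass.incl τ x) : A) + τ.saValue (ℑ (TraceClass.incl τ x) : A) * Complex.I

variable {τ} in
/-- Product of a matrix over the trace ideal with a matrix over `A`. -/
noncomputable def matMul {n : ℕ} (X : Matrix (Fin n) (Fin n) τ.TraceClass)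
    (Y : Matrix (Fin n) (Fin n) A) : Matrix (Fin n) (Fin n) τ.TraceClass :=
  Matrix.of fun i j => TraceClass.mk ((X.map (TraceClass.incl τ) * Y) i j) <| by
    rw [Matrix.mul_apply]
    exact sum_mem fun k _ => τ.mul_mem_right _ (X i k).2

variable {τ} in
/-- `g - 1 ∈ M_n(L¹_τ(A))` for `g ∈ GL_n(L¹_τ(A))`. -/
noncomputable def subOne {n : ℕ} (g : relGLn τ.ideal n) :
    Matrix (Fin n) (Fin n) τ.TraceClass :=
  Matrix.of fun i j => TraceClass.mk (((g.1 : Matrix (Fin n) (Fin n) A) - 1) i j)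
    (τ.mem_ideal.1 (g.2 i j))

/-- The group `R_n(L¹_τ(A))` of smooth paths `σ : [0,1] → GL_n(L¹_τ(A))` with `σ(0) = 1`.
Values of `toFun` outside of `[0,1]` are irrelevant. Smoothness of `σ - 1 : [0,1] → M_n(L¹_τ(A))`
is with respect to the norm of `L¹_τ(A)` in each entry (one-sided derivatives at `0` and `1`). -/
structure SmoothPath (n : ℕ) where
  toFun : ℝ → relGLn τ.ideal n
  source : toFun 0 = 1
  smooth : ∀ i j, ContDiffOn ℝ ((⊤ : ℕ∞) : WithTop ℕ∞) (fun t => subOne (toFun t) i j) (Set.Icc 0 1)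

namespace SmoothPath
variable {τ} {n : ℕ} (σ : SmoothPath τ n)

/-- The derivative `dσ/dt ∈ M_n(L¹_τ(A))`. -/
noncomputable def deriv (t : ℝ) : Matrix (Fin n) (Fin n) τ.TraceClass :=
  Matrix.of fun i j => derivWithin (fun s => subOne (σ.toFun s) i j) (Set.Icc 0 1) t

/-- `∫₀¹ (dσ/dt) σ⁻¹ dt ∈ M_n(L¹_τ(A))`. -/
noncomputable def log : Matrix (Fin n) (Fin n) τ.TraceClass :=
  Matrix.of fun i j => ∫ t in (0 : ℝ)..1,
    matMul (σ.deriv t) (((σ.toFun t)⁻¹).1 : Matrix (Fin n) (Fin n) A) i j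

/-- `τ̃(σ) = -τ(tr(∫₀¹ (dσ/dt) σ⁻¹ dt))`. -/
noncomputable def tildeTau : ℂ := -τ.functional σ.log.trace

/-- The class `[σ(1)⁻¹]` in `K₁^alg(L¹_τ(A), A)`. -/
noncomputable def theta : K1alg τ.ideal := K1alg.mk _ (relGL.of _ (σ.toFun 1)⁻¹)

end SmoothPath

open scoped Classical in
/-- The semi-finite Fuglede–Kadison determinant: `det_τ(c) = exp(Re τ̃(σ))` for a smooth path `σ`
with `[σ(1)⁻¹] = c`, of any size `n`. -/
noncomputable def det (c : K1alg τ.ideal) : ℝ :=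
  if h : ∃ p : Σ n, SmoothPath τ n, p.2.theta = c then Real.exp (h.choose.2.tildeTau).re else 1

theorem exists_exp_eq {B : Type*} [NormedRing B] [NormedAlgebra ℂ B] [CompleteSpace B] (x : B) :
    ∃ y : B, NormedSpace.exp x - 1 = x * y := by
  have h1 := NormedSpace.exp_series_hasSum_exp' (𝕂 := ℂ) x
  have h2 := (hasSum_nat_add_iff' 1).2 h1
  simp only [Finset.range_one, Finset.sum_singleton, Nat.factorial_zero, Nat.cast_one, inv_one,
    pow_zero, one_smul] at h2
  have h3 : Summable fun k : ℕ => ((Nat.factorial (k + 1) : ℂ)⁻¹) • x ^ k := by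
    refine Summable.of_norm_bounded (NormedSpace.norm_expSeries_summable' (𝕂 := ℂ) x) fun k => ?_
    rw [norm_smul, norm_smul]
    gcongr ?_ * _
    rw [norm_inv, norm_inv]
    simp only [Complex.norm_natCast]
    gcongr
    omega
  refine ⟨∑' k : ℕ, ((Nat.factorial (k + 1) : ℂ)⁻¹) • x ^ k, h2.unique ?_⟩
  have h4 := h3.hasSum.mul_left x
  simp only [mul_smul_comm, ← pow_succ'] at h4
  exact h4

open scoped Matrix.Norms.Operator in
theorem exists_matrix_exp_eq {n : ℕ} (x : Matrix (Fin n) (Fin n) A) :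
    ∃ y : Matrix (Fin n) (Fin n) A, NormedSpace.exp x - 1 = x * y := by
  have hc : @CompleteSpace (Matrix (Fin n) (Fin n) A) (Matrix.instUniformSpace _ _ _) := inferInstance
  exact @exists_exp_eq (Matrix (Fin n) (Fin n) A) _ _ hc x

theorem matrix_isUnit_exp {n : ℕ} (x : Matrix (Fin n) (Fin n) A) : IsUnit (NormedSpace.exp x) := by
  let _ : NormedAlgebra ℚ A := NormedAlgebra.restrictScalars ℚ ℂ A
  exact Matrix.isUnit_exp x

/-- The exponential `e^x ∈ GL_n(A)` of `x ∈ M_n(A)`. -/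
noncomputable def expUnit {n : ℕ} (x : Matrix (Fin n) (Fin n) A) : GLn A n :=
  (matrix_isUnit_exp x).unit

/-- `e^x ∈ GL_n(L¹_τ(A))` for `x ∈ M_n(L¹_τ(A))`. -/
noncomputable def expGL {n : ℕ} (x : Matrix (Fin n) (Fin n) τ.TraceClass) : relGLn τ.ideal n :=
  ⟨expUnit (x.map (TraceClass.incl τ)), fun i j => by
    obtain ⟨y, hy⟩ := exists_matrix_exp_eq (x.map (TraceClass.incl τ))
    change (NormedSpace.exp (x.map (TraceClass.incl τ)) - 1) i j ∈ τ.ideal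
    rw [hy]
    exact τ.mem_ideal.2 (matMul x y i j).2⟩

end SemifiniteTrace

/-! The real part of the integral of τ(tr(σ' σ⁻¹)) has an explicit primitive on GL_n(L¹_τ), so it
depends on the endpoints of σ only and no homotopy of paths is needed. The primitive `logDet` is
half the trace of log(g*g). Instead of a functional calculus for the logarithm in L¹, `traceLog`
uses the integral over s in [0,1] of τ(tr(x (1 + s x)⁻¹)) with x = g*g - 1. This makes sense because
1 + s x is a convex combination of 1 and the positive invertible g*g. Differentiation under the
integral needs only cyclicity of the trace (`integral_logDeriv_eq_traceLog_sub`). Since the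
derivative of g*g has two adjoint contributions, the result is twice the real part of τ(tr(σ' σ⁻¹))
(`IsSmoothPath.re_integral_logDeriv`).

Cyclicity, τ(ax) = τ(xa) for x in the ideal and arbitrary a, follows from unitary invariance of τ,
because unitaries span a C⋆-algebra (`traceVal_mul_comm`).

The algebraic rules for `logDet` are also read off from paths. Right translation, conjugation by
GL_n(N) and stabilization all carry g - 1 to a(g - 1)b plus a constant without changing the trace of
the logarithmic derivative (`logDet_sub_eq_of_sandwich`). A path from 1 to g therefore gives
additivity, invariance under conjugation and invariance under stabilization.

It remains to join every g to 1 by a smooth path in the ideal norm (`isJoinedToOne_of_exists_sign`).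
By polar decomposition it suffices to treat a positive factor, which is joined by a segment, and a
unitary factor u. The segment from 1 to u may meet singular elements when -1 is in the spectrum of
u, and a bend in a fixed direction may create new ones. The bend is therefore taken to the side
given by the sign of Im u (`isUnit_unitary_path`). Such a sign exists in M_n(N) by the bicommutant
theorem applied to a range projection (`VonNeumannAlgebra.exists_sign`).

Finally `logDet` passes to the direct limit, and its kernel contains the mixed commutators, so it
descends to K₁. The path of exponentials e^{tx} has constant τ(tr(σ' σ⁻¹)), which gives the values
on exponentials. -/

namespace SemifiniteTrace
open scoped ComplexStarModule

variable {A : Type*} [CStarAlgebra A] [PartialOrder A] [StarOrderedRing A] (τ : SemifiniteTrace A)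

/-! ### The linear extension of the trace and its cyclicity. -/

theorem absVal_of_nonneg {a : A} (ha : 0 ≤ a) : τ.absVal a = τ.toFun ⟨a, ha⟩ :=
  congrArg τ.toFun (Subtype.ext (CFC.abs_of_nonneg a ha))

theorem star_mem_traceIdeal {x : A} (hx : x ∈ τ.traceIdeal) : star x ∈ τ.traceIdeal :=
  (τ.absVal_star x).trans_lt hx

theorem mem_traceIdeal_of_le {a b : A} (ha : 0 ≤ a) (hab : a ≤ b) (hb : b ∈ τ.traceIdeal) :
    a ∈ τ.traceIdeal := by
  change τ.absVal a < ∞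
  rw [τ.absVal_of_nonneg ha]
  refine (τ.mono (b := ⟨b, ha.trans hab⟩) hab).trans_lt ?_
  rw [← τ.absVal_of_nonneg]
  exact hb

theorem abs_mem_traceIdeal {x : A} (hx : x ∈ τ.traceIdeal) : CFC.abs x ∈ τ.traceIdeal := by
  change τ.absVal _ < ∞
  rw [τ.absVal_of_nonneg (CFC.abs_nonneg x)]
  exact hx

theorem posPart_mem_traceIdeal {h : A} (hs : IsSelfAdjoint h) (hh : h ∈ τ.traceIdeal) :
    h⁺ ∈ τ.traceIdeal := by
  refine τ.mem_traceIdeal_of_le (CFC.posPart_nonneg h) ?_ (τ.abs_mem_traceIdeal hh)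
  rw [← CFC.posPart_add_negPart h hs]
  exact le_add_of_nonneg_right (CFC.negPart_nonneg h)

theorem negPart_mem_traceIdeal {h : A} (hs : IsSelfAdjoint h) (hh : h ∈ τ.traceIdeal) :
    h⁻ ∈ τ.traceIdeal := by
  refine τ.mem_traceIdeal_of_le (CFC.negPart_nonneg h) ?_ (τ.abs_mem_traceIdeal hh)
  rw [← CFC.posPart_add_negPart h hs]
  exact le_add_of_nonneg_left (CFC.posPart_nonneg h)

theorem toFun_ne_top {a : A} (ha : 0 ≤ a) (h : a ∈ τ.traceIdeal) : τ.toFun ⟨a, ha⟩ ≠ ∞ := by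
  rw [← τ.absVal_of_nonneg]
  exact h.ne

/-- Any splitting into positive elements of the ideal can replace the Jordan decomposition.
Additivity, homogeneity and unitary invariance on self-adjoint elements all reduce to this freedom.
-/
theorem saValue_sub {a b : A} (ha : 0 ≤ a) (hb : 0 ≤ b) (ha' : a ∈ τ.traceIdeal)
    (hb' : b ∈ τ.traceIdeal) :
    τ.saValue (a - b) = (τ.toFun ⟨a, ha⟩).toReal - (τ.toFun ⟨b, hb⟩).toReal := by
  have hs : IsSelfAdjoint (a - b) := ha.isSelfAdjoint.sub hb.isSelfAdjoint
  have hm : a - b ∈ τ.traceIdeal := sub_mem ha' hb'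
  have h1 := τ.toFun_ne_top (CFC.posPart_nonneg (a - b)) (τ.posPart_mem_traceIdeal hs hm)
  have h2 := τ.toFun_ne_top (CFC.negPart_nonneg (a - b)) (τ.negPart_mem_traceIdeal hs hm)
  -- The two splittings are compared after moving the subtracted terms across, so that the trace is
  -- applied to positive elements only.
  have e : (⟨(a - b)⁺, CFC.posPart_nonneg _⟩ + ⟨b, hb⟩ : {a : A // 0 ≤ a}) =
      ⟨(a - b)⁻, CFC.negPart_nonneg _⟩ + ⟨a, ha⟩ := by
    refine Subtype.ext ?_
    change (a - b)⁺ + b = (a - b)⁻ + a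
    have := CFC.posPart_sub_negPart (a - b) hs
    rw [sub_eq_sub_iff_add_eq_add] at this
    rw [this, add_comm]
  have e' := congrArg (fun z => (τ.toFun z).toReal) e
  simp only [τ.map_add'] at e'
  rw [ENNReal.toReal_add h1 (τ.toFun_ne_top hb hb'), ENNReal.toReal_add h2
    (τ.toFun_ne_top ha ha')] at e'
  rw [saValue]
  linarith

theorem saValue_add {h k : A} (hs : IsSelfAdjoint h) (ks : IsSelfAdjoint k)
    (hh : h ∈ τ.traceIdeal) (hk : k ∈ τ.traceIdeal) :
    τ.saValue (h + k) = τ.saValue h + τ.saValue k := by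
  have e : h + k = (h⁺ + k⁺) - (h⁻ + k⁻) := by
    conv_lhs => rw [← CFC.posPart_sub_negPart h hs, ← CFC.posPart_sub_negPart k ks]
    abel
  have a1 := τ.posPart_mem_traceIdeal hs hh
  have a2 := τ.posPart_mem_traceIdeal ks hk
  have a3 := τ.negPart_mem_traceIdeal hs hh
  have a4 := τ.negPart_mem_traceIdeal ks hk
  rw [e, τ.saValue_sub (add_nonneg (CFC.posPart_nonneg h) (CFC.posPart_nonneg k))
    (add_nonneg (CFC.negPart_nonneg h) (CFC.negPart_nonneg k)) (add_mem a1 a2) (add_mem a3 a4)]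
  have e1 := τ.map_add' ⟨h⁺, CFC.posPart_nonneg h⟩ ⟨k⁺, CFC.posPart_nonneg k⟩
  have e2 := τ.map_add' ⟨h⁻, CFC.negPart_nonneg h⟩ ⟨k⁻, CFC.negPart_nonneg k⟩
  have f1 := congrArg ENNReal.toReal e1
  have f2 := congrArg ENNReal.toReal e2
  rw [ENNReal.toReal_add (τ.toFun_ne_top _ a1) (τ.toFun_ne_top _ a2)] at f1
  rw [ENNReal.toReal_add (τ.toFun_ne_top _ a3) (τ.toFun_ne_top _ a4)] at f2
  change (τ.toFun (⟨h⁺, CFC.posPart_nonneg h⟩ + ⟨k⁺, CFC.posPart_nonneg k⟩)).toReal -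
    (τ.toFun (⟨h⁻, CFC.negPart_nonneg h⟩ + ⟨k⁻, CFC.negPart_nonneg k⟩)).toReal = _
  rw [f1, f2, saValue, saValue]
  ring

theorem saValue_neg (h : A) : τ.saValue (-h) = -τ.saValue h := by
  simp only [saValue, CFC.posPart_neg, CFC.negPart_neg]
  ring

theorem saValue_smul_nonneg {h : A} (hs : IsSelfAdjoint h) (hh : h ∈ τ.traceIdeal) (r : ℝ≥0) :
    τ.saValue ((r : ℝ) • h) = r * τ.saValue h := by
  have e : (r : ℝ) • h = (r : ℝ) • h⁺ - (r : ℝ) • h⁻ := by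
    rw [← smul_sub, CFC.posPart_sub_negPart h hs]
  have hm : ∀ {x : A}, x ∈ τ.traceIdeal → (r : ℝ) • x ∈ τ.traceIdeal := fun {x} hx => by
    have := τ.traceIdeal.smul_mem (r : ℂ) hx
    exact this
  have hp : (0 : A) ≤ (r : ℝ) • h⁺ := smul_nonneg r.2 (CFC.posPart_nonneg h)
  have hn : (0 : A) ≤ (r : ℝ) • h⁻ := smul_nonneg r.2 (CFC.negPart_nonneg h)
  rw [e, τ.saValue_sub hp hn (hm (τ.posPart_mem_traceIdeal hs hh))
    (hm (τ.negPart_mem_traceIdeal hs hh)),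
    τ.map_smul' r ⟨h⁺, CFC.posPart_nonneg h⟩, τ.map_smul' r ⟨h⁻, CFC.negPart_nonneg h⟩, saValue,
    ENNReal.toReal_mul, ENNReal.toReal_mul, ENNReal.coe_toReal]
  ring

theorem saValue_smul {h : A} (hs : IsSelfAdjoint h) (hh : h ∈ τ.traceIdeal) (r : ℝ) :
    τ.saValue (r • h) = r * τ.saValue h := by
  rcases le_total 0 r with hr | hr
  · exact τ.saValue_smul_nonneg hs hh ⟨r, hr⟩
  · have := τ.saValue_smul_nonneg hs hh ⟨-r, neg_nonneg.2 hr⟩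
    change τ.saValue ((-r) • h) = -r * τ.saValue h at this
    rw [neg_smul, saValue_neg] at this
    linarith

theorem abs_saValue_le {h : A} (hs : IsSelfAdjoint h) (hh : h ∈ τ.traceIdeal) :
    |τ.saValue h| ≤ (τ.absVal h).toReal := by
  have e : τ.absVal h = τ.toFun ⟨h⁺, CFC.posPart_nonneg h⟩ + τ.toFun ⟨h⁻, CFC.negPart_nonneg h⟩ := by
    rw [← τ.map_add']
    exact congrArg τ.toFun (Subtype.ext (CFC.posPart_add_negPart h hs).symm)
  rw [e, ENNReal.toReal_add (τ.toFun_ne_top _ (τ.posPart_mem_traceIdeal hs hh))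
    (τ.toFun_ne_top _ (τ.negPart_mem_traceIdeal hs hh)), saValue]
  refine (abs_sub _ _).trans ?_
  rw [abs_of_nonneg ENNReal.toReal_nonneg, abs_of_nonneg ENNReal.toReal_nonneg]

theorem realPart_mem_traceIdeal {x : A} (hx : x ∈ τ.traceIdeal) : (ℜ x : A) ∈ τ.traceIdeal := by
  rw [realPart_apply_coe, ← Complex.coe_smul]
  exact τ.traceIdeal.smul_mem _ (add_mem hx (τ.star_mem_traceIdeal hx))

theorem imaginaryPart_mem_traceIdeal {x : A} (hx : x ∈ τ.traceIdeal) :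
    (ℑ x : A) ∈ τ.traceIdeal := by
  rw [imaginaryPart_apply_coe, ← Complex.coe_smul]
  exact τ.traceIdeal.smul_mem _ (τ.traceIdeal.smul_mem _
    (sub_mem hx (τ.star_mem_traceIdeal hx)))

theorem absVal_realPart_le (x : A) : τ.absVal (ℜ x : A) ≤ τ.absVal x := by
  have h : ‖(2⁻¹ : ℂ)‖₊ * (2 : ℝ≥0∞) = 1 := by
    rw [show ‖(2⁻¹ : ℂ)‖₊ = (2 : ℝ≥0)⁻¹ by ext; simp]
    rw [ENNReal.coe_inv two_ne_zero]
    exact ENNReal.inv_mul_cancel two_ne_zero ENNReal.ofNat_ne_top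
  have e : (ℜ x : A) = (2⁻¹ : ℂ) • (x + star x) := by
    rw [realPart_apply_coe, ← Complex.coe_smul]; simp
  rw [e, τ.absVal_smul]
  calc _ ≤ ‖(2⁻¹ : ℂ)‖₊ * (τ.absVal x + τ.absVal x) := by
        gcongr
        exact (τ.absVal_add_le _ _).trans_eq (by rw [τ.absVal_star])
    _ = _ := by rw [← two_mul, ← mul_assoc, h, one_mul]

theorem absVal_imaginaryPart_le (x : A) : τ.absVal (ℑ x : A) ≤ τ.absVal x := by
  have h := τ.absVal_realPart_le (-(Complex.I • x))
  rw [map_neg, realPart_I_smul, neg_neg] at h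
  refine h.trans_eq ?_
  rw [← neg_smul, τ.absVal_smul]
  simp

/-- The formula for the trace functional, as a function on all of `A`. -/
noncomputable def traceVal (x : A) : ℂ :=
  τ.saValue (ℜ x : A) + τ.saValue (ℑ x : A) * Complex.I

theorem functional_eq (x : τ.TraceClass) : τ.functional x = τ.traceVal (TraceClass.incl τ x) := rfl

theorem traceVal_add {x y : A} (hx : x ∈ τ.traceIdeal) (hy : y ∈ τ.traceIdeal) :
    τ.traceVal (x + y) = τ.traceVal x + τ.traceVal y := by
  simp only [traceVal, map_add, AddSubgroup.coe_add]
  rw [τ.saValue_add (ℜ x).2 (ℜ y).2 (τ.realPart_mem_traceIdeal hx) (τ.realPart_mem_traceIdeal hy),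
    τ.saValue_add (ℑ x).2 (ℑ y).2 (τ.imaginaryPart_mem_traceIdeal hx)
      (τ.imaginaryPart_mem_traceIdeal hy)]
  push_cast
  ring

theorem traceVal_smul_real {x : A} (hx : x ∈ τ.traceIdeal) (r : ℝ) :
    τ.traceVal (r • x) = r * τ.traceVal x := by
  simp only [traceVal, map_smul, selfAdjoint.val_smul]
  rw [τ.saValue_smul (ℜ x).2 (τ.realPart_mem_traceIdeal hx),
    τ.saValue_smul (ℑ x).2 (τ.imaginaryPart_mem_traceIdeal hx)]
  push_cast
  ring

theorem traceVal_smul_I (x : A) : τ.traceVal (Complex.I • x) = Complex.I * τ.traceVal x := by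
  simp only [traceVal, realPart_I_smul, imaginaryPart_I_smul, AddSubgroup.coe_neg, saValue_neg]
  push_cast
  ring_nf
  rw [Complex.I_sq]
  ring

theorem traceVal_smul {x : A} (hx : x ∈ τ.traceIdeal) (c : ℂ) :
    τ.traceVal (c • x) = c * τ.traceVal x := by
  have e : c • x = (c.re • x) + Complex.I • (c.im • x) := by
    rw [← Complex.coe_smul, ← Complex.coe_smul, smul_smul, ← add_smul]
    congr 1
    rw [mul_comm]
    exact (Complex.re_add_im c).symm
  have hr : ∀ r : ℝ, r • x ∈ τ.traceIdeal := fun r => by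
    rw [← Complex.coe_smul]
    exact τ.traceIdeal.smul_mem _ hx
  rw [e, τ.traceVal_add (hr _) (τ.traceIdeal.smul_mem _ (hr _)), traceVal_smul_I,
    τ.traceVal_smul_real hx, τ.traceVal_smul_real hx]
  conv_rhs => rw [← Complex.re_add_im c]
  ring

theorem traceVal_star (x : A) : τ.traceVal (star x) = star (τ.traceVal x) := by
  have h1 : (ℜ (star x) : A) = ℜ x := by
    rw [realPart_apply_coe, realPart_apply_coe, star_star, add_comm]
  have h2 : (ℑ (star x) : A) = -(ℑ x : A) := by
    rw [imaginaryPart_apply_coe, imaginaryPart_apply_coe, star_star, ← smul_neg, ← smul_neg,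
      neg_sub]
  simp only [traceVal, h1, h2, saValue_neg]
  simp [Complex.conj_ofReal]

/-- The factor 2 comes from bounding real and imaginary parts separately. It is not sharp, but only
boundedness is needed. -/
theorem norm_traceVal_le {x : A} (hx : x ∈ τ.traceIdeal) :
    ‖τ.traceVal x‖ ≤ 2 * (τ.absVal x).toReal := by
  have h1 := (τ.abs_saValue_le (ℜ x).2 (τ.realPart_mem_traceIdeal hx)).trans
    (ENNReal.toReal_mono hx.ne (τ.absVal_realPart_le x))
  have h2 := (τ.abs_saValue_le (ℑ x).2 (τ.imaginaryPart_mem_traceIdeal hx)).trans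
    (ENNReal.toReal_mono hx.ne (τ.absVal_imaginaryPart_le x))
  refine (norm_add_le _ _).trans ?_
  rw [norm_mul, Complex.norm_I, mul_one, Complex.norm_real, Complex.norm_real, Real.norm_eq_abs,
    Real.norm_eq_abs]
  linarith

/-- This is the trace property applied to u√a. Only the isometry relation enters. -/
theorem toFun_unitary_conj {a : A} (ha : 0 ≤ a) {u : A} (hu : star u * u = 1) :
    τ.toFun ⟨u * a * star u, star_right_conjugate_nonneg ha u⟩ = τ.toFun ⟨a, ha⟩ := by
  have hs : star (CFC.sqrt a) = CFC.sqrt a := (CFC.sqrt_nonneg a).isSelfAdjoint.star_eq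
  have hq := CFC.sqrt_mul_sqrt_self a ha
  have h := τ.tracial' (u * CFC.sqrt a)
  convert h.symm using 2
  · refine Subtype.ext ?_
    change u * a * star u = u * CFC.sqrt a * star (u * CFC.sqrt a)
    rw [star_mul, hs]
    conv_lhs => rw [← hq]
    noncomm_ring
  · refine Subtype.ext ?_
    change a = star (u * CFC.sqrt a) * (u * CFC.sqrt a)
    rw [star_mul, hs, mul_assoc, ← mul_assoc (star u), hu, one_mul, hq]

theorem saValue_unitary_conj {h : A} (hs : IsSelfAdjoint h) (hh : h ∈ τ.traceIdeal) {u : A}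
    (hu : star u * u = 1) : τ.saValue (u * h * star u) = τ.saValue h := by
  have e : u * h * star u = u * h⁺ * star u - u * h⁻ * star u := by
    rw [← sub_mul, ← mul_sub, CFC.posPart_sub_negPart h hs]
  rw [e, τ.saValue_sub (star_right_conjugate_nonneg (CFC.posPart_nonneg h) u)
    (star_right_conjugate_nonneg (CFC.negPart_nonneg h) u)
    (τ.mul_mem_right _ (τ.mul_mem_left _ (τ.posPart_mem_traceIdeal hs hh)))
    (τ.mul_mem_right _ (τ.mul_mem_left _ (τ.negPart_mem_traceIdeal hs hh))),
    τ.toFun_unitary_conj _ hu, τ.toFun_unitary_conj _ hu, saValue]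

theorem traceVal_unitary_conj {x : A} (hx : x ∈ τ.traceIdeal) {u : A} (hu : star u * u = 1) :
    τ.traceVal (u * x * star u) = τ.traceVal x := by
  have h1 : (ℜ (u * x * star u) : A) = u * ℜ x * star u := by
    simp only [realPart_apply_coe, star_mul, star_star, mul_smul_comm, smul_mul_assoc, mul_add,
      add_mul, mul_assoc]
  have h2 : (ℑ (u * x * star u) : A) = u * ℑ x * star u := by
    simp only [imaginaryPart_apply_coe, star_mul, star_star, mul_smul_comm, smul_mul_assoc, mul_sub,
      sub_mul, mul_assoc]
  rw [traceVal, h1, h2, τ.saValue_unitary_conj (ℜ x).2 (τ.realPart_mem_traceIdeal hx) hu,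
    τ.saValue_unitary_conj (ℑ x).2 (τ.imaginaryPart_mem_traceIdeal hx) hu, traceVal]

/-- For unitary a, the element ax is the conjugate of xa by a. Unitaries span A, and both sides are
linear in a. -/
theorem traceVal_mul_comm {x : A} (hx : x ∈ τ.traceIdeal) (a : A) :
    τ.traceVal (a * x) = τ.traceVal (x * a) := by
  have ha : a ∈ Submodule.span ℂ (unitary A : Set A) := by
    rw [CStarAlgebra.span_unitary]; trivial
  induction ha using Submodule.span_induction with
  | mem u hu =>
    have := τ.traceVal_unitary_conj (τ.mul_mem_right u hx) (Unitary.star_mul_self_of_mem hu)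
    rw [← this, ← mul_assoc, mul_assoc _ u, Unitary.mul_star_self_of_mem hu, mul_one]
  | zero => simp
  | add a b _ _ ha hb =>
    rw [add_mul, mul_add, τ.traceVal_add (τ.mul_mem_left _ hx) (τ.mul_mem_left _ hx),
      τ.traceVal_add (τ.mul_mem_right _ hx) (τ.mul_mem_right _ hx), ha, hb]
  | smul c a _ ha =>
    rw [smul_mul_assoc, mul_smul_comm, τ.traceVal_smul (τ.mul_mem_left _ hx),
      τ.traceVal_smul (τ.mul_mem_right _ hx), ha]

theorem traceVal_zero : τ.traceVal 0 = 0 := by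
  simpa using τ.traceVal_smul τ.traceIdeal.zero_mem 0

theorem traceVal_sum {ι : Type*} (s : Finset ι) {x : ι → A} (hx : ∀ i, x i ∈ τ.traceIdeal) :
    τ.traceVal (∑ i ∈ s, x i) = ∑ i ∈ s, τ.traceVal (x i) := by
  classical
  induction s using Finset.induction_on with
  | empty => simp [traceVal_zero]
  | insert i s hi ih =>
    rw [Finset.sum_insert hi, Finset.sum_insert hi, τ.traceVal_add (hx i)
      (sum_mem fun j _ => hx j), ih]

/-! ### Bounded module operations, involution and trace on L¹_τ. -/

namespace TraceClass

theorem incl_mem (x : τ.TraceClass) : incl τ x ∈ τ.traceIdeal :=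
  Subtype.property (p := (· ∈ τ.traceIdeal)) x

@[simp] theorem incl_mk (x : A) (hx : x ∈ τ.traceIdeal) : incl τ (mk x hx) = x := rfl

theorem norm_incl_le (x : τ.TraceClass) : ‖incl τ x‖ ≤ ‖x‖ :=
  le_add_of_nonneg_right ENNReal.toReal_nonneg

theorem toReal_absVal_incl_le (x : τ.TraceClass) : (τ.absVal (incl τ x)).toReal ≤ ‖x‖ :=
  le_add_of_nonneg_left (norm_nonneg _)

/-- The inclusion `L¹_τ(A) → A` as a bounded map. -/
noncomputable def inclL : τ.TraceClass →L[ℂ] A :=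
  (incl τ).mkContinuous 1 fun x => by simpa using norm_incl_le τ x

@[simp] theorem inclL_apply (x : τ.TraceClass) : inclL τ x = incl τ x := rfl

/-- Right multiplication `L¹_τ(A) × A → L¹_τ(A)`. -/
noncomputable def mulR : τ.TraceClass →L[ℂ] A →L[ℂ] τ.TraceClass :=
  LinearMap.mkContinuous₂
    (LinearMap.mk₂ ℂ (fun x a => mk (incl τ x * a) (τ.mul_mem_right a (incl_mem τ x)))
      (fun x y a => incl_injective τ (by simp [add_mul]))
      (fun c x a => incl_injective τ (by simp))
      (fun x a b => incl_injective τ (by simp [mul_add]))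
      (fun c x a => incl_injective τ (by simp)))
    1 fun x a => by
      rw [one_mul, LinearMap.mk₂_apply, norm_def, incl_mk, norm_def, add_mul]
      refine add_le_add (norm_mul_le _ _) ?_
      refine (ENNReal.toReal_mono (ENNReal.mul_ne_top ENNReal.coe_ne_top (absVal_incl_ne_top τ x))
        (τ.absVal_mul_le' _ _)).trans_eq ?_
      rw [ENNReal.toReal_mul, mul_comm]
      simp

@[simp] theorem incl_mulR (x : τ.TraceClass) (a : A) : incl τ (mulR τ x a) = incl τ x * a := rfl

/-- Left multiplication `A × L¹_τ(A) → L¹_τ(A)`. -/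
noncomputable def mulL : A →L[ℂ] τ.TraceClass →L[ℂ] τ.TraceClass :=
  LinearMap.mkContinuous₂
    (LinearMap.mk₂ ℂ (fun a x => mk (a * incl τ x) (τ.mul_mem_left a (incl_mem τ x)))
      (fun x y a => incl_injective τ (by simp [add_mul]))
      (fun c x a => incl_injective τ (by simp))
      (fun x a b => incl_injective τ (by simp [mul_add]))
      (fun c x a => incl_injective τ (by simp)))
    1 fun a x => by
      rw [one_mul, LinearMap.mk₂_apply, norm_def, incl_mk, norm_def, mul_add]
      refine add_le_add (norm_mul_le _ _) ?_
      refine (ENNReal.toReal_mono (ENNReal.mul_ne_top ENNReal.coe_ne_top (absVal_incl_ne_top τ x))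
        (τ.absVal_mul_le _ _)).trans_eq ?_
      rw [ENNReal.toReal_mul]
      simp

@[simp] theorem incl_mulL (a : A) (x : τ.TraceClass) : incl τ (mulL τ a x) = a * incl τ x := rfl

/-- The involution of `L¹_τ(A)`. -/
noncomputable def starL : τ.TraceClass →L[ℝ] τ.TraceClass :=
  LinearMap.mkContinuous
    { toFun := fun x => mk (star (incl τ x)) (τ.star_mem_traceIdeal (incl_mem τ x))
      map_add' := fun x y => incl_injective τ (by simp)
      map_smul' := fun c x => incl_injective τ (by
        simp only [incl_mk, ← Complex.coe_smul, map_smul, star_smul, RingHom.id_apply]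
        simp) }
    1 fun x => by
      rw [one_mul, LinearMap.coe_mk, AddHom.coe_mk, norm_def, incl_mk, norm_def, norm_star,
        τ.absVal_star]

@[simp] theorem incl_starL (x : τ.TraceClass) : incl τ (starL τ x) = star (incl τ x) := rfl

/-- The trace functional as a bounded linear functional. -/
noncomputable def traceL : τ.TraceClass →L[ℂ] ℂ :=
  LinearMap.mkContinuous
    { toFun := τ.functional
      map_add' := fun x y => by
        simp only [functional_eq, map_add, τ.traceVal_add (incl_mem τ x) (incl_mem τ y)]
      map_smul' := fun c x => by
        simp only [functional_eq, map_smul, τ.traceVal_smul (incl_mem τ x)]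
        rfl }
    2 fun x => by
      refine (τ.norm_traceVal_le (incl_mem τ x)).trans ?_
      gcongr
      exact toReal_absVal_incl_le τ x

@[simp] theorem traceL_apply (x : τ.TraceClass) : traceL τ x = τ.functional x := rfl

end TraceClass
end SemifiniteTrace

/-! ### A primitive for the trace of the logarithmic derivative. -/

section LogarithmicDerivative
open Set MeasureTheory

variable {L B : Type*} [NormedAddCommGroup L] [NormedSpace ℝ L] [NormedRing B] [NormedAlgebra ℝ B]
  [CompleteSpace B]

theorem HasDerivWithinAt.ringInverse {f : ℝ → B} {f' : B} {s : Set ℝ} {t : ℝ}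
    (hf : HasDerivWithinAt f f' s t) (hu : IsUnit (f t)) :
    HasDerivWithinAt (fun r => Ring.inverse (f r))
      (-(Ring.inverse (f t) * f' * Ring.inverse (f t))) s t := by
  obtain ⟨u, hu⟩ := hu
  have h := hasFDerivAt_ringInverse (𝕜 := ℝ) u
  rw [hu] at h
  have h2 := h.comp_hasDerivWithinAt t hf
  refine h2.congr_deriv ?_
  rw [← hu, Ring.inverse_unit]
  simp

theorem ContinuousOn.ringInverse {X : Type*} [TopologicalSpace X] {f : X → B} {s : Set X}
    (hf : ContinuousOn f s) (hu : ∀ t ∈ s, IsUnit (f t)) :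
    ContinuousOn (fun r => Ring.inverse (f r)) s := fun t ht => by
  obtain ⟨u, hu⟩ := hu t ht
  have h := NormedRing.inverse_continuousAt u
  rw [hu] at h
  exact h.comp_continuousWithinAt (hf t ht)

variable (ι : L →L[ℝ] B) (β : L →L[ℝ] B →L[ℝ] ℂ)

/-- `∫₀¹ β(x, (1 + s x)⁻¹) ds`, a substitute for the trace of `log (1 + x)`. -/
noncomputable def traceLog (x : L) : ℂ :=
  ∫ s in (0 : ℝ)..1, β x (Ring.inverse (1 + s • ι x))

theorem traceLog_zero : traceLog ι β 0 = 0 := by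
  simp [traceLog]

/-- With q = (1 + s x)⁻¹, the function β(x', q²) is both the s-derivative of β(x', s q) and the
t-derivative of β(x, q). Integrating it over the unit square in the two orders gives the two sides.
The hypothesis on β is cyclicity of the trace, and it is what allows x' and x to be exchanged in the
t-derivative. -/
theorem integral_logDeriv_eq_traceLog_sub
    (hβ : ∀ x y b c, β x (b * ι y * c) = β y (c * ι x * b)) {x x' : ℝ → L}
    (hx : ∀ t ∈ Icc (0 : ℝ) 1, HasDerivWithinAt x (x' t) (Icc 0 1) t)
    (hx' : ContinuousOn x' (Icc 0 1))
    (hu : ∀ s ∈ Icc (0 : ℝ) 1, ∀ t ∈ Icc (0 : ℝ) 1, IsUnit (1 + s • ι (x t))) :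
    ∫ t in (0 : ℝ)..1, β (x' t) (Ring.inverse (1 + ι (x t))) =
      traceLog ι β (x 1) - traceLog ι β (x 0) := by
  have hxc : ContinuousOn x (Icc 0 1) := fun t ht => (hx t ht).continuousWithinAt
  set q : ℝ → ℝ → B := fun s t => Ring.inverse (1 + s • ι (x t)) with hq
  have hqc : ContinuousOn (fun p : ℝ × ℝ => q p.1 p.2) (Icc 0 1 ×ˢ Icc 0 1) := by
    refine ContinuousOn.ringInverse ?_ fun p hp => hu _ hp.1 _ hp.2
    refine continuousOn_const.add (continuousOn_fst.smul (ι.continuous.comp_continuousOn ?_))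
    exact hxc.comp continuousOn_snd fun p hp => hp.2
  have hGc : ContinuousOn (fun p : ℝ × ℝ => β (x' p.2) (q p.1 p.2 * q p.1 p.2))
      (Icc 0 1 ×ˢ Icc 0 1) :=
    (β.continuous.comp_continuousOn (hx'.comp continuousOn_snd fun p hp => hp.2)).clm_apply
      (hqc.mul hqc)
  have hsec1 : ∀ t ∈ Icc (0 : ℝ) 1, ContinuousOn (fun s => (s, t)) (Icc (0 : ℝ) 1) := fun t _ =>
    (Continuous.prodMk_left t).continuousOn
  have hsec2 : ∀ s ∈ Icc (0 : ℝ) 1, ContinuousOn (fun t => (s, t)) (Icc (0 : ℝ) 1) := fun s _ =>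
    (Continuous.prodMk_right s).continuousOn
  -- The resolvent identity q - s q x q = q² turns both derivatives into the same integrand.
  have hqq : ∀ s ∈ Icc (0 : ℝ) 1, ∀ t ∈ Icc (0 : ℝ) 1,
      q s t - s • (q s t * ι (x t) * q s t) = q s t * q s t := fun s hs t ht => by
    have h1 := Ring.inverse_mul_cancel _ (hu s hs t ht)
    have h2 : q s t * (1 + s • ι (x t)) * q s t = q s t := by rw [hq]; simp only [h1, one_mul]
    nth_rewrite 1 [← h2]
    simp only [mul_add, add_mul, mul_one, mul_smul_comm, smul_mul_assoc]
    abel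
  -- The antiderivative in s is s q, which vanishes at s = 0 and equals (1 + x)⁻¹ at s = 1.
  have step1 : ∀ t ∈ Icc (0 : ℝ) 1,
      ∫ s in (0 : ℝ)..1, β (x' t) (q s t * q s t) = β (x' t) (q 1 t) := fun t ht => by
    have hder : ∀ s ∈ Icc (0 : ℝ) 1, HasDerivWithinAt (fun s => β (x' t) (s • q s t))
        (β (x' t) (q s t * q s t)) (Icc 0 1) s := fun s hs => by
      have h1 : HasDerivWithinAt (fun s : ℝ => 1 + s • ι (x t)) (ι (x t)) (Icc 0 1) s := by
        simpa using ((hasDerivWithinAt_id s (Icc 0 1)).smul_const (ι (x t))).const_add 1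
      have h2 := (hasDerivWithinAt_id s (Icc 0 1)).smul (h1.ringInverse (hu s hs t ht))
      have h3 := (β (x' t)).hasFDerivAt.comp_hasDerivWithinAt s h2
      refine h3.congr_deriv (congrArg (β (x' t)) ?_)
      rw [← hqq s hs t ht, id, smul_neg, one_smul]
      abel
    rw [intervalIntegral.integral_eq_sub_of_hasDerivAt_of_le zero_le_one
      (fun s hs => (hder s hs).continuousWithinAt)
      (fun s hs => (hder s (Ioo_subset_Icc_self hs)).hasDerivAt (Icc_mem_nhds hs.1 hs.2))
      ((hGc.comp (hsec1 t ht) fun s hs => ⟨hs, ht⟩).intervalIntegrable_of_Icc zero_le_one)]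
    simp
  -- The t-derivative of q contributes -s β(x, q x' q), which cyclicity rewrites as -s β(x', q x q).
  have step2 : ∀ s ∈ Icc (0 : ℝ) 1, ∫ t in (0 : ℝ)..1, β (x' t) (q s t * q s t) =
      β (x 1) (q s 1) - β (x 0) (q s 0) := fun s hs => by
    have hder : ∀ t ∈ Icc (0 : ℝ) 1, HasDerivWithinAt (fun t => β (x t) (q s t))
        (β (x' t) (q s t * q s t)) (Icc 0 1) t := fun t ht => by
      have h1 : HasDerivWithinAt (fun t : ℝ => 1 + s • ι (x t)) (s • ι (x' t)) (Icc 0 1) t :=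
        ((ι.hasFDerivAt.comp_hasDerivWithinAt t (hx t ht)).const_smul s).const_add 1
      have h2 := h1.ringInverse (hu s hs t ht)
      have h3 := (β.hasFDerivAt.comp_hasDerivWithinAt t (hx t ht)).clm_apply h2
      refine h3.congr_deriv ?_
      change β (x' t) (q s t) + β (x t) (-(q s t * (s • ι (x' t)) * q s t)) = _
      rw [← hqq s hs t ht, map_sub, map_neg, mul_smul_comm, smul_mul_assoc, map_smul, map_smul,
        hβ (x t)]
      abel
    rw [intervalIntegral.integral_eq_sub_of_hasDerivAt_of_le zero_le_one
      (fun t ht => (hder t ht).continuousWithinAt)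
      (fun t ht => (hder t (Ioo_subset_Icc_self ht)).hasDerivAt (Icc_mem_nhds ht.1 ht.2))
      ((hGc.comp (hsec2 s hs) fun t ht => ⟨hs, ht⟩).intervalIntegrable_of_Icc zero_le_one)]
  have hint : ∀ t ∈ Icc (0 : ℝ) 1,
      IntervalIntegrable (fun s => β (x t) (q s t)) volume 0 1 := fun t ht => by
    refine ContinuousOn.intervalIntegrable_of_Icc zero_le_one ?_
    exact (β (x t)).continuous.comp_continuousOn (hqc.comp (hsec1 t ht) fun s hs => ⟨hs, ht⟩)
  have h0 : (0 : ℝ) ∈ Icc (0 : ℝ) 1 := ⟨le_rfl, zero_le_one⟩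
  have h1 : (1 : ℝ) ∈ Icc (0 : ℝ) 1 := ⟨zero_le_one, le_rfl⟩
  have hI : uIcc (0 : ℝ) 1 = Icc 0 1 := uIcc_of_le zero_le_one
  calc ∫ t in (0 : ℝ)..1, β (x' t) (Ring.inverse (1 + ι (x t)))
      = ∫ t in (0 : ℝ)..1, ∫ s in (0 : ℝ)..1, β (x' t) (q s t * q s t) :=
        intervalIntegral.integral_congr fun t ht =>
          (by simp only [hq, one_smul] : _ = β (x' t) (q 1 t)).trans (step1 t (hI ▸ ht)).symm
    _ = ∫ s in (0 : ℝ)..1, ∫ t in (0 : ℝ)..1, β (x' t) (q s t * q s t) := by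
        refine (intervalIntegral_intervalIntegral_swap ?_).symm
        refine (hGc.integrableOn_compact (isCompact_Icc.prod isCompact_Icc)).mono_set ?_
        rw [uIoc_of_le zero_le_one]
        exact prod_mono Ioc_subset_Icc_self Ioc_subset_Icc_self
    _ = ∫ s in (0 : ℝ)..1, (β (x 1) (q s 1) - β (x 0) (q s 0)) :=
        intervalIntegral.integral_congr fun s hs => step2 s (hI ▸ hs)
    _ = _ := intervalIntegral.integral_sub (hint 1 h1) (hint 0 h0)

end LogarithmicDerivative

/-- The element is the convex combination (1 - s)·1 + s b. For s < 1 it dominates a positive scalar,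
and at s = 1 it is b itself. -/
theorem isUnit_one_add_smul_sub_one {M : Type*} [CStarAlgebra M] [PartialOrder M]
    [StarOrderedRing M] {b : M} (hb : 0 ≤ b) (hu : IsUnit b) {s : ℝ} (h0 : 0 ≤ s) (h1 : s ≤ 1) :
    IsUnit (1 + s • (b - 1)) := by
  have e : 1 + s • (b - 1) = (1 - s) • (1 : M) + s • b := by
    rw [smul_sub, sub_smul, one_smul]; abel
  rw [e]
  rcases h1.eq_or_lt with rfl | h1
  · simpa using hu
  · have h2 : IsUnit ((1 - s) • (1 : M)) := by
      rw [← Algebra.algebraMap_eq_smul_one]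
      exact (IsUnit.mk0 (1 - s) (by linarith)).map (algebraMap ℝ M)
    have h3 : (0 : M) ≤ (1 - s) • (1 : M) := smul_nonneg (by linarith) zero_le_one
    exact (IsStrictlyPositive.add_nonneg ⟨h3, h2⟩ (smul_nonneg h0 hb)).isUnit

/-! ### The matrix trace, and the logarithmic determinant as a primitive along smooth paths. -/

namespace SemifiniteTrace
open Set

variable {A : Type*} [CStarAlgebra A] [PartialOrder A] [StarOrderedRing A] (τ : SemifiniteTrace A)

/-- The trace of a matrix with entries in the trace ideal. -/
noncomputable def matTrace {n : ℕ} (M : Matrix (Fin n) (Fin n) A) : ℂ := ∑ i, τ.traceVal (M i i)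

section MatTrace
variable {n : ℕ} {M K : Matrix (Fin n) (Fin n) A}

theorem mul_mem_ideal_left (hM : ∀ i j, M i j ∈ τ.traceIdeal) (i j : Fin n) :
    (M * K) i j ∈ τ.traceIdeal := by
  rw [Matrix.mul_apply]
  exact sum_mem fun k _ => τ.mul_mem_right _ (hM i k)

theorem mul_mem_ideal_right (hM : ∀ i j, M i j ∈ τ.traceIdeal) (i j : Fin n) :
    (K * M) i j ∈ τ.traceIdeal := by
  rw [Matrix.mul_apply]
  exact sum_mem fun k _ => τ.mul_mem_left _ (hM k j)

theorem star_mem_ideal (hM : ∀ i j, M i j ∈ τ.traceIdeal) (i j : Fin n) :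
    (star M) i j ∈ τ.traceIdeal :=
  τ.star_mem_traceIdeal (hM j i)

theorem matTrace_add (hM : ∀ i j, M i j ∈ τ.traceIdeal) (hK : ∀ i j, K i j ∈ τ.traceIdeal) :
    τ.matTrace (M + K) = τ.matTrace M + τ.matTrace K := by
  simp only [matTrace, Matrix.add_apply, τ.traceVal_add (hM _ _) (hK _ _), Finset.sum_add_distrib]

theorem matTrace_star : τ.matTrace (star M) = star (τ.matTrace M) := by
  simp only [matTrace, Matrix.star_apply, traceVal_star, star_sum]

theorem matTrace_mul_comm (hM : ∀ i j, M i j ∈ τ.traceIdeal) :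
    τ.matTrace (M * K) = τ.matTrace (K * M) := by
  simp only [matTrace, Matrix.mul_apply]
  simp_rw [τ.traceVal_sum _ fun k => τ.mul_mem_right _ (hM _ k),
    τ.traceVal_sum _ fun k => τ.mul_mem_left _ (hM k _)]
  rw [Finset.sum_comm]
  exact Finset.sum_congr rfl fun i _ => Finset.sum_congr rfl fun k _ =>
    (τ.traceVal_mul_comm (hM _ _) _).symm

end MatTrace

/-- The underlying matrix over `A` of a matrix over the trace ideal. -/
noncomputable def inclM {n : ℕ} (X : Fin n → Fin n → τ.TraceClass) : Matrix (Fin n) (Fin n) A :=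
  Matrix.of fun i j => TraceClass.incl τ (X i j)

theorem inclM_mem {n : ℕ} (X : Fin n → Fin n → τ.TraceClass) (i j : Fin n) :
    τ.inclM X i j ∈ τ.traceIdeal :=
  TraceClass.incl_mem τ _

theorem inclM_injective {n : ℕ} : Function.Injective (τ.inclM (n := n)) := fun _ _ h =>
  funext fun i => funext fun j => TraceClass.incl_injective τ (congrFun (congrFun h i) j)

theorem inclM_subOne {n : ℕ} (g : relGLn τ.ideal n) :
    τ.inclM (subOne g) = (g.1 : Matrix (Fin n) (Fin n) A) - 1 := rfl

theorem inclM_matMul {n : ℕ} (X : Matrix (Fin n) (Fin n) τ.TraceClass)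
    (Y : Matrix (Fin n) (Fin n) A) : τ.inclM (matMul X Y) = τ.inclM X * Y := rfl

theorem functional_trace {n : ℕ} (X : Matrix (Fin n) (Fin n) τ.TraceClass) :
    τ.functional X.trace = τ.matTrace (τ.inclM X) := by
  rw [← TraceClass.traceL_apply, Matrix.trace, map_sum]
  rfl

theorem matMul_apply {n : ℕ} (X : Matrix (Fin n) (Fin n) τ.TraceClass)
    (Y : Matrix (Fin n) (Fin n) A) (i j : Fin n) :
    matMul X Y i j = ∑ k, TraceClass.mulR τ (X i k) (Y k j) := by
  refine TraceClass.incl_injective τ ?_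
  rw [map_sum]
  exact Matrix.mul_apply (M := τ.inclM X) (N := Y)

/-- `inclM` as a bounded map into the C⋆-algebra of matrices. -/
noncomputable def inclML (n : ℕ) :
    (Fin n → Fin n → τ.TraceClass) →L[ℝ] CStarMatrix (Fin n) (Fin n) A where
  toFun X := CStarMatrix.ofMatrix (τ.inclM X)
  map_add' X Y := CStarMatrix.ext fun i j => map_add (TraceClass.incl τ) (X i j) (Y i j)
  map_smul' c X := CStarMatrix.ext fun i j =>
    map_smul ((TraceClass.inclL τ).restrictScalars ℝ) c (X i j)
  cont := continuous_pi fun i => continuous_pi fun j =>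
    (TraceClass.inclL τ).continuous.comp ((continuous_apply j).comp (continuous_apply i))

/-- The pairing `(X, b) ↦ τ(tr(X b))`. -/
noncomputable def pairing (n : ℕ) :
    (Fin n → Fin n → τ.TraceClass) →L[ℝ] CStarMatrix (Fin n) (Fin n) A →L[ℝ] ℂ :=
  LinearMap.mkContinuous₂
    (LinearMap.mk₂ ℝ
      (fun X b => ∑ i, ∑ k, TraceClass.traceL τ (TraceClass.mulR τ (X i k) (b k i)))
      (fun X Y b => by
        simp only [Pi.add_apply, map_add, _root_.add_apply, Finset.sum_add_distrib])
      (fun c X b => by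
        simp only [Pi.smul_apply, ← Complex.coe_smul, map_smul, _root_.smul_apply,
          Finset.smul_sum])
      (fun X b d => by
        simp only [CStarMatrix.add_apply, map_add, Finset.sum_add_distrib])
      (fun c X b => by
        simp only [CStarMatrix.smul_apply, ← Complex.coe_smul, map_smul, Finset.smul_sum]))
    (n * (n * (‖TraceClass.traceL τ‖ * ‖TraceClass.mulR τ‖))) fun X b => by
      rw [LinearMap.mk₂_apply]
      have h : ∀ i k, ‖TraceClass.traceL τ (TraceClass.mulR τ (X i k) (b k i))‖ ≤
          ‖TraceClass.traceL τ‖ * ‖TraceClass.mulR τ‖ * ‖X‖ * ‖b‖ := fun i k => by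
        have h1 : ‖X i k‖ ≤ ‖X‖ := (norm_le_pi_norm (X i) k).trans (norm_le_pi_norm X i)
        have h2 : ‖b k i‖ ≤ ‖b‖ := CStarMatrix.norm_entry_le_norm
        calc _ ≤ ‖TraceClass.traceL τ‖ * (‖TraceClass.mulR τ‖ * ‖X i k‖ * ‖b k i‖) :=
              (ContinuousLinearMap.le_opNorm _ _).trans (by
                gcongr
                exact ContinuousLinearMap.le_opNorm₂ _ _ _)
          _ ≤ ‖TraceClass.traceL τ‖ * (‖TraceClass.mulR τ‖ * ‖X‖ * ‖b‖) := by gcongr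
          _ = _ := by ring
      calc _ ≤ ∑ _i : Fin n, ∑ _k : Fin n,
            ‖TraceClass.traceL τ‖ * ‖TraceClass.mulR τ‖ * ‖X‖ * ‖b‖ :=
            norm_sum_le_of_le _ fun i _ => norm_sum_le_of_le _ fun k _ => h i k
        _ = _ := by simp; ring

theorem pairing_apply {n : ℕ} (X : Fin n → Fin n → τ.TraceClass)
    (Y : Matrix (Fin n) (Fin n) A) :
    τ.pairing n X (CStarMatrix.ofMatrix Y) = τ.matTrace (τ.inclM X * Y) := by
  change ∑ i, ∑ k, TraceClass.traceL τ (TraceClass.mulR τ (X i k) (Y k i)) = _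
  rw [matTrace]
  refine Finset.sum_congr rfl fun i _ => ?_
  rw [Matrix.mul_apply, τ.traceVal_sum _ fun k => τ.mul_mem_right _ (τ.inclM_mem X i k)]
  rfl

/-- This is the cyclicity hypothesis required by `integral_logDeriv_eq_traceLog_sub`. -/
theorem pairing_comm {n : ℕ} (X Y : Fin n → Fin n → τ.TraceClass)
    (b c : CStarMatrix (Fin n) (Fin n) A) :
    τ.pairing n X (b * τ.inclML n Y * c) = τ.pairing n Y (c * τ.inclML n X * b) := by
  have key : ∀ b' c' : Matrix (Fin n) (Fin n) A,
      τ.pairing n X (CStarMatrix.ofMatrix (b' * τ.inclM Y * c')) =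
        τ.pairing n Y (CStarMatrix.ofMatrix (c' * τ.inclM X * b')) := fun b' c' => by
    rw [pairing_apply, pairing_apply]
    calc τ.matTrace (τ.inclM X * (b' * τ.inclM Y * c'))
        = τ.matTrace ((τ.inclM X * b') * (τ.inclM Y * c')) := by noncomm_ring
      _ = τ.matTrace ((τ.inclM Y * c') * (τ.inclM X * b')) :=
          τ.matTrace_mul_comm (τ.mul_mem_ideal_left (τ.inclM_mem X))
      _ = _ := by noncomm_ring
  exact key b c

/-- The involution on `GL_n(L¹_τ(A))`. -/
noncomputable def starGL {n : ℕ} (g : relGLn τ.ideal n) : relGLn τ.ideal n :=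
  ⟨star g.1, fun i j => by
    have e : ((star g.1 : GLn A n) : Matrix (Fin n) (Fin n) A) - 1 = star (g.1.1 - 1) := by
      rw [star_sub, star_one, Units.coe_star]
    rw [e]
    exact τ.mem_ideal.2 (τ.star_mem_traceIdeal (τ.mem_ideal.1 (g.2 j i)))⟩

theorem ringInverse_ofMatrix {n : ℕ} (g : GLn A n) :
    Ring.inverse (CStarMatrix.ofMatrix (g : Matrix (Fin n) (Fin n) A)) =
      CStarMatrix.ofMatrix ((g⁻¹ : GLn A n) : Matrix (Fin n) (Fin n) A) :=
  Ring.inverse_unit (Units.map (CStarMatrix.ofMatrixRingEquiv : Matrix (Fin n) (Fin n) A ≃+*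
    CStarMatrix (Fin n) (Fin n) A).toMonoidHom g)

/-- The logarithm of the Fuglede-Kadison determinant on `GL_n(L¹_τ(A))`. -/
noncomputable def logDet {n : ℕ} (g : relGLn τ.ideal n) : ℝ :=
  (traceLog (τ.inclML n) (τ.pairing n) (subOne (τ.starGL g * g))).re / 2

theorem logDet_one (n : ℕ) : τ.logDet (1 : relGLn τ.ideal n) = 0 := by
  have : (subOne (τ.starGL (1 : relGLn τ.ideal n) * 1)) = 0 := by
    refine τ.inclM_injective ?_
    rw [inclM_subOne]
    ext i j
    simp [starGL, inclM]
  rw [logDet, this]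
  have h0 := traceLog_zero (τ.inclML n) (τ.pairing n)
  exact (congrArg (fun z : ℂ => z.re / 2) h0).trans (by simp)

/-- Smoothness of a path in `GL_n(L¹_τ(A))`, parametrised by `[0, 1]`. -/
def IsSmoothPath {n : ℕ} (γ : ℝ → relGLn τ.ideal n) : Prop :=
  ∀ i j, ContDiffOn ℝ ((⊤ : ℕ∞) : WithTop ℕ∞) (fun t => subOne (γ t) i j) (Icc 0 1)

/-- The derivative of a path in `GL_n(L¹_τ(A))`. -/
noncomputable def pathDeriv {n : ℕ} (γ : ℝ → relGLn τ.ideal n) (t : ℝ) :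
    Matrix (Fin n) (Fin n) τ.TraceClass :=
  Matrix.of fun i j => derivWithin (fun s => subOne (γ s) i j) (Icc 0 1) t

/-- `τ(tr((dγ/dt) γ⁻¹))`. -/
noncomputable def logDeriv {n : ℕ} (γ : ℝ → relGLn τ.ideal n) (t : ℝ) : ℂ :=
  τ.matTrace (τ.inclM (τ.pathDeriv γ t) * (((γ t).1⁻¹ : GLn A n) : Matrix (Fin n) (Fin n) A))

namespace IsSmoothPath
variable {τ} {n : ℕ} {γ : ℝ → relGLn τ.ideal n} (hγ : τ.IsSmoothPath γ)
include hγ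

theorem hasDerivWithinAt (i j : Fin n) {t : ℝ} (ht : t ∈ Icc (0 : ℝ) 1) :
    HasDerivWithinAt (fun s => subOne (γ s) i j) (τ.pathDeriv γ t i j) (Icc 0 1) t :=
  (((hγ i j).differentiableOn (by simp)) t ht).hasDerivWithinAt

theorem continuousOn_deriv (i j : Fin n) :
    ContinuousOn (fun t => τ.pathDeriv γ t i j) (Icc 0 1) :=
  (hγ i j).continuousOn_derivWithin (uniqueDiffOn_Icc zero_lt_one) (by simp)

theorem contDiffOn_entry (i j : Fin n) : ContDiffOn ℝ ((⊤ : ℕ∞) : WithTop ℕ∞)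
    (fun t => ((γ t).1 : Matrix (Fin n) (Fin n) A) i j) (Icc 0 1) := by
  have h := ((TraceClass.inclL τ).restrictScalars ℝ).contDiff.comp_contDiffOn (hγ i j)
  have h2 := h.add (contDiffOn_const (c := (1 : Matrix (Fin n) (Fin n) A) i j))
  refine h2.congr fun t _ => ?_
  change _ = (((γ t).1 : Matrix (Fin n) (Fin n) A) i j - (1 : Matrix (Fin n) (Fin n) A) i j) + _
  rw [sub_add_cancel]

/-- Inversion is continuous in a Banach algebra, so the argument is carried out for the C⋆-norm on
matrices; the ideal norm is not needed for the inverse. -/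
theorem continuousOn_inv : ContinuousOn
    (fun t => CStarMatrix.ofMatrix (((γ t).1⁻¹ : GLn A n) : Matrix (Fin n) (Fin n) A))
    (Icc 0 1) := by
  have h : ContinuousOn (fun t => CStarMatrix.ofMatrix ((γ t).1 : Matrix (Fin n) (Fin n) A))
      (Icc 0 1) :=
    continuousOn_pi.2 fun i => continuousOn_pi.2 fun j => (hγ.contDiffOn_entry i j).continuousOn
  simp_rw [← ringInverse_ofMatrix]
  exact h.ringInverse fun t _ =>
    ((γ t).1.isUnit.map (CStarMatrix.ofMatrixRingEquiv : Matrix (Fin n) (Fin n) A ≃+*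
      CStarMatrix (Fin n) (Fin n) A))

theorem continuousOn_inv_entry (i j : Fin n) : ContinuousOn
    (fun t => (((γ t).1⁻¹ : GLn A n) : Matrix (Fin n) (Fin n) A) i j) (Icc 0 1) :=
  continuousOn_pi.1 (continuousOn_pi.1 hγ.continuousOn_inv i) j

theorem continuousOn_matMul (i j : Fin n) : ContinuousOn
    (fun t => matMul (τ.pathDeriv γ t) (((γ t).1⁻¹ : GLn A n) : Matrix (Fin n) (Fin n) A) i j)
    (Icc 0 1) := by
  simp_rw [matMul_apply]
  exact continuousOn_finsetSum _ fun k _ =>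
    ((TraceClass.mulR τ).continuous.comp_continuousOn (hγ.continuousOn_deriv i k)).clm_apply
      (hγ.continuousOn_inv_entry k j)

theorem continuousOn_logDeriv : ContinuousOn (τ.logDeriv γ) (Icc 0 1) := by
  have : τ.logDeriv γ = fun t => TraceClass.traceL τ (matMul (τ.pathDeriv γ t)
      (((γ t).1⁻¹ : GLn A n) : Matrix (Fin n) (Fin n) A)).trace := funext fun t => by
    rw [TraceClass.traceL_apply, functional_trace, inclM_matMul, logDeriv]
  rw [this]
  exact (TraceClass.traceL τ).continuous.comp_continuousOn
    (continuousOn_finsetSum _ fun i _ => hγ.continuousOn_matMul i i)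

/-- Apply the primitive formula to x = γ*γ - 1. Passing from γ to γ*γ makes 1 + s x invertible for
all s in [0,1], at the price of seeing only the real part of the logarithmic derivative, doubled.
This is the path independence behind the determinant. -/
theorem re_integral_logDeriv :
    (∫ t in (0 : ℝ)..1, τ.logDeriv γ t).re = τ.logDet (γ 1) - τ.logDet (γ 0) := by
  set x : ℝ → Fin n → Fin n → τ.TraceClass := fun t => subOne (τ.starGL (γ t) * γ t) with hx
  set X : ℝ → Fin n → Fin n → τ.TraceClass := fun t => subOne (γ t) with hX
  set X' : ℝ → Fin n → Fin n → τ.TraceClass := τ.pathDeriv γ with hX'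
  set x' : ℝ → Fin n → Fin n → τ.TraceClass := fun t i j =>
    TraceClass.starL τ (X' t j i) + X' t i j + ∑ k,
      (TraceClass.mulR τ (TraceClass.starL τ (X' t k i)) (TraceClass.incl τ (X t k j)) +
        TraceClass.mulR τ (TraceClass.starL τ (X t k i)) (TraceClass.incl τ (X' t k j))) with hx'
  -- With X = γ - 1 one has γ*γ - 1 = X* + X + X*X, an expression in bounded operations on L¹_τ. It
  -- can therefore be differentiated in the ideal norm.
  have hxe : ∀ t i j, x t i j = TraceClass.starL τ (X t j i) + X t i j + ∑ k,
      TraceClass.mulR τ (TraceClass.starL τ (X t k i)) (TraceClass.inclL τ (X t k j)) :=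
    fun t i j => by
      refine TraceClass.incl_injective τ ?_
      simp only [map_add, map_sum, TraceClass.incl_mulR, TraceClass.incl_starL,
        TraceClass.inclL_apply]
      have : ((τ.starGL (γ t) * γ t).1 : Matrix (Fin n) (Fin n) A) - 1 =
          star (τ.inclM (X t)) + τ.inclM (X t) + star (τ.inclM (X t)) * τ.inclM (X t) := by
        simp only [hX, inclM_subOne, star_sub, star_one]
        change star ((γ t).1 : Matrix (Fin n) (Fin n) A) * ((γ t).1 : Matrix (Fin n) (Fin n) A) - 1
          = _
        noncomm_ring
      refine (congrFun (congrFun this i) j).trans ?_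
      rw [Matrix.add_apply, Matrix.add_apply, Matrix.mul_apply]
      rfl
  have hd : ∀ t ∈ Icc (0 : ℝ) 1, HasDerivWithinAt x (x' t) (Icc 0 1) t := fun t ht => by
    refine hasDerivWithinAt_pi.2 fun i => hasDerivWithinAt_pi.2 fun j => ?_
    simp_rw [hxe]
    have hs : ∀ k l, HasDerivWithinAt (fun s => TraceClass.starL τ (X s k l))
        (TraceClass.starL τ (X' t k l)) (Icc 0 1) t := fun k l =>
      (TraceClass.starL τ).hasFDerivAt.comp_hasDerivWithinAt t (hγ.hasDerivWithinAt k l ht)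
    refine ((hs j i).add (hγ.hasDerivWithinAt i j ht)).add (HasDerivWithinAt.fun_sum fun k _ => ?_)
    have h1 := ((TraceClass.mulR τ).restrictScalars ℝ).hasFDerivAt.comp_hasDerivWithinAt t (hs k i)
    have h2 := ((TraceClass.inclL τ).restrictScalars ℝ).hasFDerivAt.comp_hasDerivWithinAt t
      (hγ.hasDerivWithinAt k j ht)
    exact ((ContinuousLinearMap.restrictScalarsL ℂ A τ.TraceClass ℝ
      ℝ).hasFDerivAt.comp_hasDerivWithinAt t h1).clm_apply h2
  have hxc' : ContinuousOn x' (Icc 0 1) := by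
    refine continuousOn_pi.2 fun i => continuousOn_pi.2 fun j => ?_
    have hs : ∀ k l, ContinuousOn (fun t => TraceClass.starL τ (X t k l)) (Icc 0 1) := fun k l =>
      (TraceClass.starL τ).continuous.comp_continuousOn (hγ k l).continuousOn
    have hs' : ∀ k l, ContinuousOn (fun t => TraceClass.starL τ (X' t k l)) (Icc 0 1) :=
      fun k l => (TraceClass.starL τ).continuous.comp_continuousOn (hγ.continuousOn_deriv k l)
    refine ((hs' j i).add (hγ.continuousOn_deriv i j)).add (continuousOn_finsetSum _ fun k _ => ?_)
    refine ContinuousOn.add ?_ ?_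
    · exact ((TraceClass.mulR τ).continuous.comp_continuousOn (hs' k i)).clm_apply
        ((TraceClass.inclL τ).continuous.comp_continuousOn (hγ k j).continuousOn)
    · exact ((TraceClass.mulR τ).continuous.comp_continuousOn (hs k i)).clm_apply
        ((TraceClass.inclL τ).continuous.comp_continuousOn (hγ.continuousOn_deriv k j))
  have hincl : ∀ t, τ.inclML n (x t) = CStarMatrix.ofMatrix
      ((τ.starGL (γ t) * γ t).1 : Matrix (Fin n) (Fin n) A) - 1 := fun t => rfl
  have hu : ∀ s ∈ Icc (0 : ℝ) 1, ∀ t ∈ Icc (0 : ℝ) 1, IsUnit (1 + s • τ.inclML n (x t)) :=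
    fun s hs t _ => by
      rw [hincl]
      refine isUnit_one_add_smul_sub_one ?_ ?_ hs.1 hs.2
      · exact star_mul_self_nonneg
          (CStarMatrix.ofMatrix ((γ t).1 : Matrix (Fin n) (Fin n) A))
      · exact (τ.starGL (γ t) * γ t).1.isUnit.map (CStarMatrix.ofMatrixRingEquiv :
          Matrix (Fin n) (Fin n) A ≃+* CStarMatrix (Fin n) (Fin n) A)
  have main := integral_logDeriv_eq_traceLog_sub (τ.inclML n) (τ.pairing n) τ.pairing_comm hd hxc' hu
  -- Multiply (γ*γ)' = γ'*γ + γ*γ' by (γ*γ)⁻¹ = γ⁻¹(γ⁻¹)*. By cyclicity the second term has the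
  -- trace of γ'γ⁻¹, and the first term has its complex conjugate.
  have hint : ∀ t, τ.pairing n (x' t) (Ring.inverse (1 + τ.inclML n (x t))) =
      2 * ((τ.logDeriv γ t).re : ℂ) := fun t => by
    rw [hincl, add_sub_cancel, ringInverse_ofMatrix, pairing_apply]
    set g := ((γ t).1 : Matrix (Fin n) (Fin n) A) with hg
    set k := (((γ t).1⁻¹ : GLn A n) : Matrix (Fin n) (Fin n) A) with hk
    have hgk : g * k = 1 := Units.mul_inv _
    have hkg : k * g = 1 := Units.inv_mul _
    have hkg' : star g * star k = 1 := by rw [← star_mul, hkg, star_one]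
    have e1 : τ.inclM (x' t) = star (τ.inclM (X' t)) * g + star g * τ.inclM (X' t) := by
      have : g = τ.inclM (X t) + 1 := by rw [hX, inclM_subOne, sub_add_cancel]
      rw [this, star_add, star_one]
      ext i j
      simp only [mul_add, add_mul, mul_one, one_mul, Matrix.add_apply, Matrix.mul_apply]
      simp only [inclM, hx', Matrix.of_apply, map_add, map_sum, TraceClass.incl_mulR,
        TraceClass.incl_starL, Finset.sum_add_distrib, Matrix.star_apply]
      abel
    have e2 : (((τ.starGL (γ t) * γ t).1⁻¹ : GLn A n) : Matrix (Fin n) (Fin n) A) = k * star k := by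
      change (((star (γ t).1 * (γ t).1)⁻¹ : GLn A n) : Matrix (Fin n) (Fin n) A) = _
      rw [mul_inv_rev, Units.val_mul, hk, ← star_inv]
      rfl
    have hm := τ.inclM_mem (X' t)
    have e3 : τ.inclM (x' t) * (k * star k) =
        star (k * τ.inclM (X' t)) + star g * τ.inclM (X' t) * (k * star k) := by
      rw [e1, add_mul, star_mul, mul_assoc (star _) g, ← mul_assoc g, hgk, one_mul]
    rw [e2, e3, τ.matTrace_add (τ.star_mem_ideal (τ.mul_mem_ideal_right hm))
      (τ.mul_mem_ideal_left (τ.mul_mem_ideal_right hm)), matTrace_star,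
      ← τ.matTrace_mul_comm hm, τ.matTrace_mul_comm (τ.mul_mem_ideal_right hm)]
    have e4 : k * star k * (star g * τ.inclM (X' t)) = k * τ.inclM (X' t) := by
      rw [mul_assoc, ← mul_assoc (star k), ← star_mul, hgk, star_one, one_mul]
    rw [e4, ← τ.matTrace_mul_comm hm]
    change star (τ.logDeriv γ t) + τ.logDeriv γ t = _
    rw [add_comm]
    refine (Complex.add_conj _).trans ?_
    push_cast
    rfl
  replace main := (intervalIntegral.integral_congr fun t _ => (hint t).symm).trans main
  have hre : (∫ t in (0 : ℝ)..1, τ.logDeriv γ t).re = ∫ t in (0 : ℝ)..1, (τ.logDeriv γ t).re :=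
    (Complex.reCLM.intervalIntegral_comp_comm
      (hγ.continuousOn_logDeriv.intervalIntegrable_of_Icc zero_le_one)).symm
  rw [intervalIntegral.integral_const_mul, intervalIntegral.integral_ofReal, ← hre] at main
  have := congrArg Complex.re main
  rw [Complex.sub_re, ← Complex.ofReal_ofNat, ← Complex.ofReal_mul, Complex.ofReal_re] at this
  rw [logDet, logDet]
  linarith

end IsSmoothPath
end SemifiniteTrace

/-! ### Behaviour of the logarithmic determinant under products, conjugation and stabilization. -/

namespace SemifiniteTrace
open Set

variable {A : Type*} [CStarAlgebra A] [PartialOrder A] [StarOrderedRing A] (τ : SemifiniteTrace A)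

/-- The map `X ↦ a X b` on matrices over the trace ideal. -/
noncomputable def sandwich {m n : ℕ} (a : Matrix (Fin m) (Fin n) A) (b : Matrix (Fin n) (Fin m) A) :
    (Fin n → Fin n → τ.TraceClass) →L[ℝ] (Fin m → Fin m → τ.TraceClass) where
  toFun X i j := ∑ l, ∑ k, TraceClass.mulR τ (TraceClass.mulL τ (a i k) (X k l)) (b l j)
  map_add' X Y := by
    ext i j
    simp only [Pi.add_apply, map_add, _root_.add_apply, Finset.sum_add_distrib]
  map_smul' c X := by
    ext i j
    simp only [Pi.smul_apply, ← Complex.coe_smul, map_smul, _root_.smul_apply, Finset.smul_sum,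
      RingHom.id_apply]
  cont := continuous_pi fun i => continuous_pi fun j => continuous_finsetSum _ fun l _ =>
    continuous_finsetSum _ fun k _ => (((TraceClass.mulR τ).continuous.comp
      ((TraceClass.mulL τ (a i k)).continuous.comp
        ((continuous_apply l).comp (continuous_apply k)))).clm_apply continuous_const)

theorem inclM_sandwich {m n : ℕ} (a : Matrix (Fin m) (Fin n) A) (b : Matrix (Fin n) (Fin m) A)
    (X : Fin n → Fin n → τ.TraceClass) : τ.inclM (τ.sandwich a b X) = a * τ.inclM X * b := by
  ext i j
  change TraceClass.incl τ (∑ l, ∑ k, _) = _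
  simp only [map_sum, TraceClass.incl_mulR, TraceClass.incl_mulL, Matrix.mul_apply, Finset.sum_mul]
  rfl

/-- Cyclicity for rectangular factors, as needed when stabilization changes the matrix size. -/
theorem matTrace_sandwich {m n : ℕ} (a : Matrix (Fin m) (Fin n) A) {M : Matrix (Fin n) (Fin n) A}
    (b : Matrix (Fin n) (Fin m) A) (hM : ∀ i j, M i j ∈ τ.traceIdeal) :
    τ.matTrace (a * M * b) = τ.matTrace (M * (b * a)) := by
  have h1 : ∀ k l i, a i k * M k l * b l i ∈ τ.traceIdeal := fun k l i =>
    τ.mul_mem_right _ (τ.mul_mem_left _ (hM k l))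
  have h2 : ∀ k l i, M k l * (b l i * a i k) ∈ τ.traceIdeal := fun k l i =>
    τ.mul_mem_right _ (hM k l)
  simp only [matTrace, Matrix.mul_apply, Finset.sum_mul, Finset.mul_sum]
  simp_rw [τ.traceVal_sum _ fun l => sum_mem fun k _ => h1 k l _, τ.traceVal_sum _ fun k => h1 k _ _,
    τ.traceVal_sum _ fun l => sum_mem fun i _ => h2 _ l i, τ.traceVal_sum _ fun i => h2 _ _ i]
  rw [Finset.sum_comm, Finset.sum_congr rfl fun l _ => Finset.sum_comm, Finset.sum_comm]
  refine Finset.sum_congr rfl fun k _ => Finset.sum_congr rfl fun l _ =>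
    Finset.sum_congr rfl fun i _ => ?_
  rw [mul_assoc, τ.traceVal_mul_comm (τ.mul_mem_right _ (hM k l)), mul_assoc]

/-- `g - 1`, as a function of two indices. -/
noncomputable def subOneFn {n : ℕ} (g : relGLn τ.ideal n) : Fin n → Fin n → τ.TraceClass := subOne g

theorem inclM_subOneFn {n : ℕ} (g : relGLn τ.ideal n) :
    τ.inclM (τ.subOneFn g) = (g.1 : Matrix (Fin n) (Fin n) A) - 1 := rfl

/-- If `γ'` is obtained from `γ` by `γ' - c = a (γ - 1) b`, where `b γ'⁻¹ a = γ⁻¹`, then the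
logarithmic determinant changes by the same amount along both paths. -/
theorem logDet_sub_eq_of_sandwich {m n : ℕ} {γ : ℝ → relGLn τ.ideal n} {γ' : ℝ → relGLn τ.ideal m}
    (hγ : τ.IsSmoothPath γ) (a : Matrix (Fin m) (Fin n) A) (b : Matrix (Fin n) (Fin m) A)
    (c : Matrix (Fin m) (Fin m) A)
    (h1 : ∀ t, ((γ' t).1 : Matrix (Fin m) (Fin m) A) =
      a * (((γ t).1 : Matrix (Fin n) (Fin n) A) - 1) * b + c)
    (h2 : ∀ t, b * (((γ' t).1⁻¹ : GLn A m) : Matrix (Fin m) (Fin m) A) * a =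
      (((γ t).1⁻¹ : GLn A n) : Matrix (Fin n) (Fin n) A)) :
    τ.logDet (γ' 1) - τ.logDet (γ' 0) = τ.logDet (γ 1) - τ.logDet (γ 0) := by
  -- The matrix c need not have entries in the ideal, but γ' - 1 and a(γ - 1)b do. Their difference
  -- c - 1 is therefore in the ideal, and it is recorded in L¹_τ through its value at t = 0.
  set C : Fin m → Fin m → τ.TraceClass := τ.subOneFn (γ' 0) - τ.sandwich a b (τ.subOneFn (γ 0)) with hC
  have hsub : ∀ t, τ.subOneFn (γ' t) = τ.sandwich a b (τ.subOneFn (γ t)) + C := fun t => by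
    refine τ.inclM_injective ?_
    have e : ∀ X Y : Fin m → Fin m → τ.TraceClass, τ.inclM (X + Y) = τ.inclM X + τ.inclM Y :=
      fun X Y => map_add (τ.inclML m) X Y
    have e' : ∀ X Y : Fin m → Fin m → τ.TraceClass, τ.inclM (X - Y) = τ.inclM X - τ.inclM Y :=
      fun X Y => map_sub (τ.inclML m) X Y
    rw [e, hC, e', inclM_sandwich, inclM_sandwich, inclM_subOneFn, inclM_subOneFn, inclM_subOneFn,
      inclM_subOneFn, h1, h1]
    abel
  have hX : ContDiffOn ℝ ((⊤ : ℕ∞) : WithTop ℕ∞)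
      (fun t => τ.subOneFn (γ t)) (Icc 0 1) :=
    contDiffOn_pi.2 fun i => contDiffOn_pi.2 fun j => hγ i j
  have hγ' : τ.IsSmoothPath γ' := fun i j => by
    have h := ((τ.sandwich a b).contDiff.comp_contDiffOn hX).add (contDiffOn_const (c := C))
    refine (contDiffOn_pi.1 (contDiffOn_pi.1 h i) j).congr fun t _ => ?_
    exact congrFun (congrFun (hsub t) i) j
  have hder : ∀ t ∈ Icc (0 : ℝ) 1,
      (τ.pathDeriv γ' t : Fin m → Fin m → τ.TraceClass) =
        τ.sandwich a b (τ.pathDeriv γ t) := fun t ht => by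
    have hd : HasDerivWithinAt (fun t => τ.subOneFn (γ t))
        (τ.pathDeriv γ t) (Icc 0 1) t :=
      hasDerivWithinAt_pi.2 fun i => hasDerivWithinAt_pi.2 fun j => hγ.hasDerivWithinAt i j ht
    have h := ((τ.sandwich a b).hasFDerivAt.comp_hasDerivWithinAt t hd).add_const C
    ext i j
    have h' := hasDerivWithinAt_pi.1 (hasDerivWithinAt_pi.1 h i) j
    refine HasDerivWithinAt.derivWithin ?_ (uniqueDiffOn_Icc zero_lt_one t ht)
    refine h'.congr_of_mem (fun t _ => ?_) ht
    exact congrFun (congrFun (hsub t) i) j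
  rw [← hγ.re_integral_logDeriv, ← hγ'.re_integral_logDeriv]
  congr 1
  refine intervalIntegral.integral_congr fun t ht => ?_
  rw [uIcc_of_le zero_le_one] at ht
  simp only [logDeriv]
  have e : τ.inclM (τ.pathDeriv γ' t) = a * τ.inclM (τ.pathDeriv γ t) * b :=
    (congrArg τ.inclM (hder t ht)).trans (τ.inclM_sandwich a b _)
  -- Since the derivative of γ' is aγ'b (with γ' on the right denoting the derivative of γ),
  -- cyclicity moves a to the end, where the second hypothesis produces γ⁻¹.
  rw [e, ← h2 t, Matrix.mul_assoc (a * _)]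
  exact τ.matTrace_sandwich a _ (τ.inclM_mem _)

/-- `g` is the end point of a smooth path in `GL_n(L¹_τ(A))` that starts at `1`. -/
def IsJoinedToOne {n : ℕ} (g : relGLn τ.ideal n) : Prop :=
  ∃ γ : ℝ → relGLn τ.ideal n, τ.IsSmoothPath γ ∧ γ 0 = 1 ∧ γ 1 = g

variable {τ}

/-- Right translation by h does not change the logarithmic derivative, and it moves a path from 1 to
g to a path from h to gh. -/
theorem IsJoinedToOne.logDet_mul {n : ℕ} {g : relGLn τ.ideal n} (hg : τ.IsJoinedToOne g)
    (h : relGLn τ.ideal n) : τ.logDet (g * h) = τ.logDet g + τ.logDet h := by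
  obtain ⟨γ, hγ, h0, h1⟩ := hg
  have := τ.logDet_sub_eq_of_sandwich (γ' := fun t => γ t * h) hγ 1 h.1.1 h.1.1
    (fun t => by
      change ((γ t).1 : Matrix (Fin n) (Fin n) A) * h.1.1 = _
      noncomm_ring)
    (fun t => by
      change _ * ((((γ t).1 * h.1)⁻¹ : GLn A n) : Matrix (Fin n) (Fin n) A) * _ = _
      rw [mul_inv_rev, Units.val_mul, ← mul_assoc, Units.mul_inv, one_mul, mul_one])
  rw [h0, h1, one_mul, logDet_one] at this
  linarith

/-- This does not follow from additivity, because k ranges over all of GL_n(A). Instead the whole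
path is conjugated. -/
theorem IsJoinedToOne.logDet_conj {n : ℕ} {g : relGLn τ.ideal n} (hg : τ.IsJoinedToOne g)
    (k : GLn A n) : τ.logDet ⟨k * g.1 * k⁻¹, conj_mem_relGLn τ.ideal g.2 k⟩ = τ.logDet g := by
  obtain ⟨γ, hγ, h0, h1⟩ := hg
  have := τ.logDet_sub_eq_of_sandwich
    (γ' := fun t => ⟨k * (γ t).1 * k⁻¹, conj_mem_relGLn τ.ideal (γ t).2 k⟩) hγ k.1
    ((k⁻¹ : GLn A n) : Matrix (Fin n) (Fin n) A) 1
    (fun t => by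
      change (k : Matrix (Fin n) (Fin n) A) * ((γ t).1 : Matrix (Fin n) (Fin n) A) *
        ((k⁻¹ : GLn A n) : Matrix (Fin n) (Fin n) A) = _
      rw [mul_sub, sub_mul, mul_one, Units.mul_inv, sub_add_cancel])
    (fun t => by
      change _ * ((((k * (γ t).1 * k⁻¹))⁻¹ : GLn A n) : Matrix (Fin n) (Fin n) A) * _ = _
      rw [← Units.val_mul, ← Units.val_mul]
      congr 1
      group)
  have e : (⟨k * (γ 0).1 * k⁻¹, conj_mem_relGLn τ.ideal (γ 0).2 k⟩ : relGLn τ.ideal n) = 1 :=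
    Subtype.ext (by rw [h0]; simp)
  have e1 : τ.logDet (γ 0) = 0 := by rw [h0, logDet_one]
  simp only [e, e1, logDet_one, sub_zero] at this
  rw [← h1]
  exact this

/-- The inclusion of coordinates, with `blockIncl n m x = E x Eᵀ`. -/
def coordIncl (R : Type*) [Ring R] (m n : ℕ) : Matrix (Fin m) (Fin n) R :=
  Matrix.of fun i k => if i.1 = k.1 then 1 else 0

theorem blockIncl_eq {R : Type*} [Ring R] {n m : ℕ} (x : Matrix (Fin n) (Fin n) R) :
    blockIncl n m x = coordIncl R m n * x * coordIncl R n m := by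
  ext i j
  simp only [blockIncl_apply, Matrix.mul_apply, coordIncl, Matrix.of_apply, ite_mul, one_mul,
    zero_mul, mul_ite, mul_one, mul_zero]
  by_cases hj : j.1 < n
  · rw [Finset.sum_eq_single (⟨j.1, hj⟩ : Fin n) (fun l _ hl => if_neg fun h => hl (Fin.ext h))
      (fun h => absurd (Finset.mem_univ _) h), if_pos rfl]
    by_cases hi : i.1 < n
    · rw [dif_pos ⟨hi, hj⟩, Finset.sum_eq_single (⟨i.1, hi⟩ : Fin n)
        (fun l _ hl => if_neg fun h => hl (Fin.ext h.symm))
        (fun h => absurd (Finset.mem_univ _) h), if_pos rfl]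
    · rw [dif_neg fun h => hi h.1]
      exact (Finset.sum_eq_zero fun l _ => if_neg (by have := l.2; omega)).symm
  · rw [dif_neg fun h => hj h.2]
    exact (Finset.sum_eq_zero fun l _ => if_neg (by have := l.2; omega)).symm

theorem coordIncl_mul {R : Type*} [Ring R] {n m : ℕ} (h : n ≤ m) :
    coordIncl R n m * coordIncl R m n = 1 := by
  ext i j
  simp only [Matrix.mul_apply, coordIncl, Matrix.of_apply, ite_mul, one_mul, zero_mul]
  rw [Finset.sum_eq_single (Fin.castLE h i) (fun l _ hl => if_neg fun e => hl (Fin.ext e.symm))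
    (fun h => absurd (Finset.mem_univ _) h)]
  simp [Matrix.one_apply, Fin.ext_iff]

/-- Stabilization is g ↦ E(g - 1)Eᵀ + 1 with the coordinate inclusion E. As EᵀE = 1, compressing the
stabilized inverse by E returns the original inverse. -/
theorem IsJoinedToOne.logDet_stab {n m : ℕ} (h : n ≤ m) {g : relGLn τ.ideal n}
    (hg : τ.IsJoinedToOne g) : τ.logDet ⟨stab h g.1, stab_mem_relGLn τ.ideal h g.2⟩ = τ.logDet g := by
  obtain ⟨γ, hγ, h0, h1⟩ := hg
  have hE := coordIncl_mul (R := A) h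
  have hs : ∀ k : GLn A n, (stab h k : Matrix (Fin m) (Fin m) A) =
      coordIncl A m n * ((k : Matrix (Fin n) (Fin n) A) - 1) * coordIncl A n m + 1 := fun k => by
    rw [← blockIncl_eq]
    rfl
  have := τ.logDet_sub_eq_of_sandwich
    (γ' := fun t => ⟨stab h (γ t).1, stab_mem_relGLn τ.ideal h (γ t).2⟩) hγ (coordIncl A m n)
    (coordIncl A n m) 1 (fun t => hs _)
    (fun t => by
      rw [← map_inv, hs]
      set y := (((γ t).1⁻¹ : GLn A n) : Matrix (Fin n) (Fin n) A)
      rw [Matrix.mul_add, Matrix.add_mul, Matrix.mul_one, hE]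
      calc _ = (coordIncl A n m * coordIncl A m n) * (y - 1) *
            (coordIncl A n m * coordIncl A m n) + 1 := by simp only [Matrix.mul_assoc]
        _ = y := by rw [hE, Matrix.one_mul, Matrix.mul_one, sub_add_cancel])
  have e : (⟨stab h (γ 0).1, stab_mem_relGLn τ.ideal h (γ 0).2⟩ : relGLn τ.ideal m) = 1 :=
    Subtype.ext (by rw [h0]; exact map_one _)
  have e1 : τ.logDet (γ 0) = 0 := by rw [h0, logDet_one]
  simp only [e, e1, logDet_one, sub_zero] at this
  rw [← h1]
  exact this

/-- The product of smooth paths is smooth. -/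
theorem IsSmoothPath.mul {n : ℕ} {γ δ : ℝ → relGLn τ.ideal n} (hγ : τ.IsSmoothPath γ)
    (hδ : τ.IsSmoothPath δ) : τ.IsSmoothPath fun t => γ t * δ t := fun i j => by
  have h : ∀ t, subOne (γ t * δ t) i j = ∑ k, TraceClass.mulR τ (subOne (γ t) i k)
      (((δ t).1 : Matrix (Fin n) (Fin n) A) k j) + subOne (δ t) i j := fun t => by
    rw [← matMul_apply]
    refine TraceClass.incl_injective τ ?_
    have : (((γ t).1 * (δ t).1 : GLn A n) : Matrix (Fin n) (Fin n) A) - 1 =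
        (((γ t).1 : Matrix (Fin n) (Fin n) A) - 1) * (δ t).1 +
          (((δ t).1 : Matrix (Fin n) (Fin n) A) - 1) := by
      rw [Units.val_mul]; noncomm_ring
    exact congrFun (congrFun this i) j
  simp_rw [h]
  refine (ContDiffOn.sum fun k _ => ?_).add (hδ i j)
  have hm := ((ContinuousLinearMap.restrictScalarsL ℂ A τ.TraceClass ℝ ℝ).comp
    ((TraceClass.mulR τ).restrictScalars ℝ)).contDiff.comp_contDiffOn (hγ i k)
  exact hm.clm_apply (hδ.contDiffOn_entry k j)

theorem IsJoinedToOne.mul {n : ℕ} {g h : relGLn τ.ideal n} (hg : τ.IsJoinedToOne g)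
    (hh : τ.IsJoinedToOne h) : τ.IsJoinedToOne (g * h) := by
  obtain ⟨γ, hγ, h0, h1⟩ := hg
  obtain ⟨δ, hδ, k0, k1⟩ := hh
  exact ⟨_, hγ.mul hδ, by rw [h0, k0, one_mul], by rw [h1, k1]⟩

end SemifiniteTrace

/-! ### Paths of invertible elements and polar decomposition. -/

section UnitaryPath
variable {M : Type*} [CStarAlgebra M] [PartialOrder M] [StarOrderedRing M]

/-- A curved path from `1` to a unitary `u` through invertible elements. Here `w` plays the role
of the sign of the imaginary part of `u`. -/
theorem isUnit_unitary_path {u w : M} (hu : star u * u = 1) (hu' : u * star u = 1)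
    (hw : star w = w) (hww : w * w = 1) (hwu : w * u = u * w)
    (hpos : 0 ≤ (-Complex.I) • (w * (u - star u))) {t : ℝ} (h0 : 0 ≤ t) (h1 : t ≤ 1) :
    IsUnit (1 + (t : ℂ) • (u - 1) + ((t * (1 - t) : ℝ) : ℂ) • ((-Complex.I) • (w * (u - 1)))) := by
  -- The size of the bend. It vanishes at both ends, and k ≤ 1/4 keeps (1 - 2k)² away from zero.
  set k : ℝ := t * (1 - t) with hk
  have hk0 : 0 ≤ k := mul_nonneg h0 (by linarith)
  have hk1 : k ≤ 1 / 4 := by nlinarith [sq_nonneg (t - 1 / 2)]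
  set v := star u with hv
  have hwv : w * v = v * w := by
    have := congrArg star hwu
    rw [star_mul, star_mul, hw] at this
    exact this.symm
  set σ := 1 + (t : ℂ) • (u - 1) + (k : ℂ) • ((-Complex.I) • (w * (u - 1))) with hσ
  have hσs : star σ = 1 + (t : ℂ) • (v - 1) + (k : ℂ) • (Complex.I • (w * (v - 1))) := by
    rw [hσ]
    simp only [star_add, star_smul, star_mul, star_sub, star_one, hw, ← hv, star_neg]
    rw [sub_mul, one_mul, ← hwv, mul_sub, mul_one]
    simp
  have hP : (v - 1) * (u - 1) = 2 - u - v := by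
    rw [sub_mul, mul_sub, hu, mul_one, one_mul, ← one_add_one_eq_two]; abel
  have hP' : (u - 1) * (v - 1) = 2 - u - v := by
    rw [sub_mul, mul_sub, hu', mul_one, one_mul, ← one_add_one_eq_two]; abel
  have cu : (u - 1) * w = w * (u - 1) := by rw [sub_mul, mul_sub, hwu, one_mul, mul_one]
  have cv : (v - 1) * w = w * (v - 1) := by rw [sub_mul, mul_sub, hwv, one_mul, mul_one]
  have q1 : (v - 1) * (w * (u - 1)) = w * (2 - u - v) := by rw [← mul_assoc, cv, mul_assoc, hP]
  have q2 : w * (v - 1) * (u - 1) = w * (2 - u - v) := by rw [mul_assoc, hP]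
  have q3 : w * (v - 1) * (w * (u - 1)) = 2 - u - v := by
    rw [mul_assoc, q1, ← mul_assoc, hww, one_mul]
  have q1' : (u - 1) * (w * (v - 1)) = w * (2 - u - v) := by rw [← mul_assoc, cu, mul_assoc, hP']
  have q2' : w * (u - 1) * (v - 1) = w * (2 - u - v) := by rw [mul_assoc, hP']
  have q3' : w * (u - 1) * (w * (v - 1)) = 2 - u - v := by
    rw [mul_assoc, q1', ← mul_assoc, hww, one_mul]
  -- S is the value of σ*σ and of σσ*, arranged as a sum of evidently positive terms. The scalar is
  -- (1 - 2k)² > 0, and the last term is k times -i w(u - u*), which is positive because w is the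
  -- sign of Im u.
  set S := (1 - 4 * (k - k ^ 2)) • (1 : M) + ((k - k ^ 2) • (star (u + 1) * (u + 1)) +
    k • ((-Complex.I) • (w * (u - v)))) with hS
  have hS' : S = 1 + (t : ℂ) • (u + v - 2) + (k : ℂ) • ((-Complex.I) • (w * (u - v))) +
      ((t : ℂ) ^ 2 + (k : ℂ) ^ 2) • (2 - u - v) := by
    have e : star (u + 1) * (u + 1) = 2 + u + v := by
      rw [star_add, star_one, add_mul, mul_add, ← hv, hu, mul_one, one_mul, ← one_add_one_eq_two]
      abel
    have ek : (k : ℂ) = t * (1 - t) := by rw [hk]; push_cast; ring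
    have et : (2 : M) = (2 : ℂ) • (1 : M) := by rw [two_smul, one_add_one_eq_two]
    rw [hS, e]
    simp only [← Complex.coe_smul]
    push_cast
    rw [et]
    match_scalars <;> rw [ek] <;> ring
  have e1 : star σ * σ = S := by
    rw [hσs, hσ, hS']
    simp only [mul_add, add_mul, one_mul, mul_one, smul_mul_assoc, mul_smul_comm, hP, q1, q2, q3]
    have et : (2 : M) = (2 : ℂ) • (1 : M) := by rw [two_smul, one_add_one_eq_two]
    rw [et]
    simp only [mul_sub, mul_smul_comm, mul_one]
    match_scalars <;> ring_nf <;> simp only [Complex.I_sq] <;> ring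
  have e2 : σ * star σ = S := by
    rw [hσs, hσ, hS']
    simp only [mul_add, add_mul, one_mul, mul_one, smul_mul_assoc, mul_smul_comm, hP', q1', q2',
      q3']
    have et : (2 : M) = (2 : ℂ) • (1 : M) := by rw [two_smul, one_add_one_eq_two]
    rw [et]
    simp only [mul_sub, mul_smul_comm, mul_one]
    match_scalars <;> ring_nf <;> simp only [Complex.I_sq] <;> ring
  have hSu : IsUnit S := by
    have hc : 0 < 1 - 4 * (k - k ^ 2) := by nlinarith [sq_nonneg (2 * k - 1)]
    have hc1 : IsUnit ((1 - 4 * (k - k ^ 2)) • (1 : M)) := by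
      rw [← Algebra.algebraMap_eq_smul_one]
      exact (IsUnit.mk0 _ hc.ne').map (algebraMap ℝ M)
    exact (IsStrictlyPositive.add_nonneg ⟨smul_nonneg hc.le zero_le_one, hc1⟩
      (add_nonneg (smul_nonneg (by nlinarith) (star_mul_self_nonneg _))
        (smul_nonneg hk0 hpos))).isUnit
  -- σ is normal, so invertibility of σ*σ implies that of σ.
  have hcomm : Commute (star σ) σ := e1.trans e2.symm
  exact (hcomm.isUnit_mul_iff.1 (e1 ▸ hSu)).2

/-- Polar decomposition of an invertible element. -/
theorem exists_polar {g : M} (hg : IsUnit g) : ∃ r u d : M, 0 ≤ r ∧ IsUnit r ∧ g = u * r ∧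
    star u * u = 1 ∧ u * star u = 1 ∧ r - 1 = (star g * g - 1) * d := by
  set r := CFC.abs g with hr
  have h0 : 0 ≤ r := CFC.abs_nonneg g
  have hrr : r * r = star g * g := CFC.abs_mul_abs g
  have hu : IsUnit r := by
    have : IsUnit (r * r) := hrr ▸ hg.star.mul hg
    exact (Commute.isUnit_mul_iff (Commute.refl r)).1 this |>.1
  have h1 : IsUnit (r + 1) :=
    (IsStrictlyPositive.nonneg_add h0 ⟨zero_le_one, isUnit_one⟩).isUnit
  obtain ⟨ρ, hρ⟩ := hu
  obtain ⟨e, he⟩ := h1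
  have hs : star r = r := h0.isSelfAdjoint.star_eq
  have hρs : star ((ρ⁻¹ : Mˣ) : M) = ((ρ⁻¹ : Mˣ) : M) := by
    have : star ρ = ρ := Units.ext (by rw [Units.coe_star, hρ, hs])
    rw [← Units.coe_star, star_inv, this]
  have huu : star (g * ((ρ⁻¹ : Mˣ) : M)) * (g * ((ρ⁻¹ : Mˣ) : M)) = 1 := by
    rw [star_mul, hρs]
    calc _ = ((ρ⁻¹ : Mˣ) : M) * (star g * g) * ((ρ⁻¹ : Mˣ) : M) := by noncomm_ring
      _ = 1 := by rw [← hrr, ← hρ, ← mul_assoc, Units.inv_mul, one_mul, Units.mul_inv]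
  -- Here r = |g| and u = g r⁻¹. The element d = (r + 1)⁻¹ gives r - 1 = (r² - 1)d = (g*g - 1)d,
  -- which later shows that r - 1 has entries in the ideal.
  refine ⟨r, g * ((ρ⁻¹ : Mˣ) : M), ((e⁻¹ : Mˣ) : M), h0, ⟨ρ, hρ⟩, ?_, huu, ?_, ?_⟩
  · rw [mul_assoc, ← hρ, Units.inv_mul, mul_one]
  · obtain ⟨γ, hγ⟩ := hg.mul (ρ⁻¹).isUnit
    rw [← hγ] at huu ⊢
    have : star (γ : M) = ((γ⁻¹ : Mˣ) : M) := (Units.inv_eq_of_mul_eq_one_left huu).symm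
    rw [this, Units.mul_inv]
  · rw [← hrr]
    have : r * r - 1 = (r - 1) * e := by rw [he]; noncomm_ring
    rw [this, mul_assoc, Units.mul_inv, mul_one]

end UnitaryPath

/-! ### Smooth connectedness of GL_n(L¹_τ). -/

namespace SemifiniteTrace
open Set

variable {A : Type*} [CStarAlgebra A] [PartialOrder A] [StarOrderedRing A] (τ : SemifiniteTrace A)

/-- A quadratic polynomial in t with coefficients in the ideal is smooth for the ideal norm, so only
invertibility has to be checked. Z = 0 gives a segment, and a nonzero Z bends it without moving the
endpoints. -/
theorem isJoinedToOne_of_isUnit {n : ℕ} (g : relGLn τ.ideal n) {Y Z : Matrix (Fin n) (Fin n) A}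
    (hY : ∀ i j, Y i j ∈ τ.traceIdeal) (hZ : ∀ i j, Z i j ∈ τ.traceIdeal)
    (hg : (g.1 : Matrix (Fin n) (Fin n) A) = 1 + Y)
    (hu : ∀ t ∈ Icc (0 : ℝ) 1, IsUnit (1 + (t : ℂ) • Y + ((t * (1 - t) : ℝ) : ℂ) • Z)) :
    τ.IsJoinedToOne g := by
  classical
  have hmem : ∀ t : ℝ, ∀ i j, ((t : ℂ) • Y + ((t * (1 - t) : ℝ) : ℂ) • Z) i j ∈ τ.traceIdeal :=
    fun t i j => add_mem (τ.traceIdeal.smul_mem _ (hY i j)) (τ.traceIdeal.smul_mem _ (hZ i j))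
  -- Invertibility is known on [0,1] only; the value 1 elsewhere is arbitrary.
  let γ : ℝ → relGLn τ.ideal n := fun t =>
    if h : t ∈ Icc (0 : ℝ) 1 then
      ⟨(hu t h).unit, fun i j => τ.mem_ideal.2 (by
        have e : (((hu t h).unit : GLn A n) : Matrix (Fin n) (Fin n) A) - 1 =
            (t : ℂ) • Y + ((t * (1 - t) : ℝ) : ℂ) • Z := by
          rw [IsUnit.unit_spec, add_assoc, add_sub_cancel_left]
        rw [e]
        exact hmem t i j)⟩
    else 1
  have hγ : ∀ t ∈ Icc (0 : ℝ) 1, ((γ t).1 : Matrix (Fin n) (Fin n) A) =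
      1 + (t : ℂ) • Y + ((t * (1 - t) : ℝ) : ℂ) • Z := fun t ht => by
    simp only [γ, dif_pos ht]
    exact IsUnit.unit_spec _
  refine ⟨γ, fun i j => ?_, ?_, ?_⟩
  · have h : ∀ t ∈ Icc (0 : ℝ) 1, subOne (γ t) i j =
        t • TraceClass.mk (Y i j) (hY i j) + (t * (1 - t)) • TraceClass.mk (Z i j) (hZ i j) :=
      fun t ht => by
        refine TraceClass.incl_injective τ ?_
        have e : ((γ t).1 : Matrix (Fin n) (Fin n) A) - 1 =
            (t : ℂ) • Y + ((t * (1 - t) : ℝ) : ℂ) • Z := by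
          rw [hγ t ht, add_assoc, add_sub_cancel_left]
        rw [← Complex.coe_smul, ← Complex.coe_smul, map_add, map_smul, map_smul]
        exact congrFun (congrFun e i) j
    refine ContDiffOn.congr (ContDiff.contDiffOn ?_) h
    fun_prop
  · refine Subtype.ext (Units.ext ?_)
    rw [hγ 0 ⟨le_rfl, zero_le_one⟩]
    simp
  · refine Subtype.ext (Units.ext ?_)
    rw [hγ 1 ⟨zero_le_one, le_rfl⟩, hg]
    simp

/-- If signs of self-adjoint matrices exist, then `GL_n(L¹_τ(A))` is connected by smooth paths. -/
theorem isJoinedToOne_of_exists_sign {n : ℕ}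
    (hsign : ∀ s : CStarMatrix (Fin n) (Fin n) A, IsSelfAdjoint s →
      ∃ w : CStarMatrix (Fin n) (Fin n) A, star w = w ∧ w * w = 1 ∧ 0 ≤ w * s ∧
        ∀ u, Commute u s → Commute u w) (g : relGLn τ.ideal n) : τ.IsJoinedToOne g := by
  have hunit : IsUnit (CStarMatrix.ofMatrix (g.1 : Matrix (Fin n) (Fin n) A)) :=
    g.1.isUnit.map (CStarMatrix.ofMatrixRingEquiv : Matrix (Fin n) (Fin n) A ≃+*
      CStarMatrix (Fin n) (Fin n) A)
  obtain ⟨r, u, d, hr, hru, hgur, huu, huu', hrd⟩ := exists_polar hunit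
  obtain ⟨ρ, hρ⟩ : IsUnit (CStarMatrix.ofMatrix.symm r : Matrix (Fin n) (Fin n) A) :=
    hru.map (CStarMatrix.ofMatrixRingEquiv : Matrix (Fin n) (Fin n) A ≃+*
      CStarMatrix (Fin n) (Fin n) A).symm
  -- The positive factor lies in GL_n(L¹_τ) by the factorization of r - 1 through g*g - 1. The
  -- unitary factor then lies there as a quotient.
  have hρmem : ρ ∈ relGLn τ.ideal n := fun i j => τ.mem_ideal.2 <| by
    have e : (ρ : Matrix (Fin n) (Fin n) A) - 1 =
        (((τ.starGL g * g).1 : Matrix (Fin n) (Fin n) A) - 1) * CStarMatrix.ofMatrix.symm d := by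
      rw [hρ]
      exact hrd
    rw [e]
    exact τ.mul_mem_ideal_left (fun i j => τ.mem_ideal.1 ((τ.starGL g * g).2 i j)) i j
  set R : relGLn τ.ideal n := ⟨ρ, hρmem⟩ with hR
  set U : relGLn τ.ideal n := g * R⁻¹ with hU
  have hUR : U * R = g := by rw [hU, inv_mul_cancel_right]
  have hUu : (U.1 : Matrix (Fin n) (Fin n) A) = CStarMatrix.ofMatrix.symm u := by
    have h1 : (g.1 : Matrix (Fin n) (Fin n) A) = CStarMatrix.ofMatrix.symm u * ρ := by
      rw [hρ]
      exact hgur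
    change (g.1 : Matrix (Fin n) (Fin n) A) * ((ρ⁻¹ : GLn A n) : Matrix (Fin n) (Fin n) A) = _
    rw [h1, mul_assoc, Units.mul_inv, mul_one]
  rw [← hUR]
  refine IsJoinedToOne.mul ?_ ?_
  -- This is 2 Im u. Its sign w commutes with u because u is normal.
  · have hs : IsSelfAdjoint ((-Complex.I) • (u - star u)) := by
      rw [IsSelfAdjoint, star_smul, star_sub, star_star, ← neg_sub u, smul_neg, ← neg_smul]
      simp
    obtain ⟨w, hw, hww, hpos, hcomm⟩ := hsign _ hs
    have huw : Commute u w := hcomm u <| by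
      refine Commute.smul_right ?_ _
      exact (Commute.refl u).sub_right (huu'.trans huu.symm)
    rw [mul_smul_comm] at hpos
    have hm := fun i j => τ.mem_ideal.1 (U.2 i j)
    refine τ.isJoinedToOne_of_isUnit U (Y := (U.1 : Matrix (Fin n) (Fin n) A) - 1)
      (Z := (-Complex.I) • (CStarMatrix.ofMatrix.symm w * ((U.1 : Matrix (Fin n) (Fin n) A) - 1)))
      hm (fun i j => τ.traceIdeal.smul_mem _ (τ.mul_mem_ideal_right hm i j))
      (by rw [add_sub_cancel]) fun t ht => ?_
    have key := isUnit_unitary_path huu huu' hw hww huw.symm hpos ht.1 ht.2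
    rw [hUu]
    exact key.map (CStarMatrix.ofMatrixRingEquiv : Matrix (Fin n) (Fin n) A ≃+*
      CStarMatrix (Fin n) (Fin n) A).symm
  · refine τ.isJoinedToOne_of_isUnit R (Y := (ρ : Matrix (Fin n) (Fin n) A) - 1) (Z := 0)
      (fun i j => τ.mem_ideal.1 (hρmem i j)) (fun _ _ => τ.traceIdeal.zero_mem)
      (by rw [add_sub_cancel]) fun t ht => ?_
    have key := isUnit_one_add_smul_sub_one hr hru ht.1 ht.2
    rw [hρ, smul_zero, add_zero, Complex.coe_smul]
    exact key.map (CStarMatrix.ofMatrixRingEquiv : Matrix (Fin n) (Fin n) A ≃+*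
      CStarMatrix (Fin n) (Fin n) A).symm

end SemifiniteTrace

/-! ### Positive parts and range projections. -/

theorem exists_nonneg_sub_nonneg {M : Type*} [CStarAlgebra M] [PartialOrder M] [StarOrderedRing M]
    {s : M} (hs : IsSelfAdjoint s) : ∃ a b : M, 0 ≤ a ∧ 0 ≤ b ∧ s = a - b ∧ b * a = 0 ∧
      ∀ v, Commute v s → Commute v a :=
  ⟨s⁺, s⁻, CFC.posPart_nonneg s, CFC.negPart_nonneg s, (CFC.posPart_sub_negPart s hs).symm,
    CFC.negPart_mul_posPart s, fun _ hv => (hv.symm.cfcₙ_real _).symm⟩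

section RangeProjection
variable {K : Type*} [NormedAddCommGroup K] [InnerProductSpace ℂ K] [CompleteSpace K]

/-- The projection onto the closure of the range of `Q`. -/
theorem exists_range_projection (Q : K →L[ℂ] K) : ∃ P : K →L[ℂ] K, star P = P ∧ P * P = P ∧
    P * Q = Q ∧ (∀ T : K →L[ℂ] K, T * Q = 0 → T * P = 0) ∧
    ∀ T : K →L[ℂ] K, Commute T Q → Commute (star T) Q → Commute T P := by
  set U : Submodule ℂ K := (LinearMap.range (Q : K →ₗ[ℂ] K)).topologicalClosure with hU
  have : CompleteSpace U := (Submodule.isClosed_topologicalClosure _).completeSpace_coe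
  set P := U.starProjection with hP
  have hPs : star P = P := isSelfAdjoint_starProjection U
  have hPP : P * P = P := U.isIdempotentElem_starProjection
  have hfix : ∀ x ∈ U, P x = x := fun x hx => Submodule.starProjection_eq_self_iff.2 hx
  have hmem : ∀ x, P x ∈ U := fun x => U.starProjection_apply_mem x
  have hQ : ∀ x, Q x ∈ U := fun x => Submodule.le_topologicalClosure _ ⟨x, rfl⟩
  -- An operator commuting with Q preserves the range of Q, hence also its closure.
  have hinv : ∀ T : K →L[ℂ] K, Commute T Q → P * T * P = T * P := fun T hT => by
    ext x
    refine hfix _ ?_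
    have h1 : P x ∈ closure (LinearMap.range (Q : K →ₗ[ℂ] K) : Set K) := hmem x
    refine map_mem_closure T.continuous h1 ?_
    rintro _ ⟨y, rfl⟩
    exact ⟨T y, (congrArg (fun S : K →L[ℂ] K => S y) hT.eq).symm⟩
  refine ⟨P, hPs, hPP, ?_, fun T hT => ?_, fun T hT hT' => ?_⟩
  · ext x
    exact hfix _ (hQ x)
  · ext x
    have h1 : (LinearMap.range (Q : K →ₗ[ℂ] K) : Set K) ⊆ {y | T y = 0} := by
      rintro _ ⟨y, rfl⟩
      exact congrArg (fun S : K →L[ℂ] K => S y) hT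
    exact closure_minimal h1 (isClosed_eq T.continuous continuous_const) (hmem x)
  -- Invariance under T* gives PTP = PT after taking adjoints. Together with PTP = TP this is
  -- commutation.
  · have h1 := congrArg star (hinv _ hT')
    simp only [star_mul, star_star, hPs] at h1
    exact ((mul_assoc P T P).symm.trans (hinv T hT)).symm.trans h1

end RangeProjection

/-! ### Matrices of operators acting on Hⁿ. -/

section MatrixRepresentation
variable {H : Type*} [NormedAddCommGroup H] [InnerProductSpace ℂ H] [CompleteSpace H] {n : ℕ}

/-- The inclusion of the `i`-th summand of `Hⁿ`. -/
noncomputable def summandIncl (H : Type*) [NormedAddCommGroup H] [InnerProductSpace ℂ H] {n : ℕ}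
    (i : Fin n) : H →L[ℂ] PiLp 2 fun _ : Fin n => H :=
  (PiLp.continuousLinearEquiv 2 ℂ fun _ : Fin n => H).symm.toContinuousLinearMap ∘L
    ContinuousLinearMap.single ℂ (fun _ : Fin n => H) i

/-- The projection onto the `i`-th summand of `Hⁿ`. -/
noncomputable def summandProj (H : Type*) [NormedAddCommGroup H] [InnerProductSpace ℂ H] {n : ℕ}
    (i : Fin n) : (PiLp 2 fun _ : Fin n => H) →L[ℂ] H :=
  PiLp.proj 2 (fun _ : Fin n => H) i

theorem summandProj_comp_incl (i j : Fin n) :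
    summandProj H i ∘L summandIncl H j = if i = j then 1 else 0 := by
  ext x
  change (Pi.single j x : Fin n → H) i = _
  split_ifs with h
  · subst h; simp
  · simp [h]

theorem sum_summandIncl_comp_proj :
    ∑ i, summandIncl H (n := n) i ∘L summandProj H i = 1 := by
  ext x j
  rw [_root_.sum_apply]
  change (∑ i, WithLp.toLp 2 (Pi.single i (x i) : Fin n → H) : PiLp 2 fun _ : Fin n => H) j = x j
  rw [WithLp.ofLp_sum, Finset.sum_apply]
  change ∑ i, (Pi.single i (x i) : Fin n → H) j = x j
  rw [Finset.sum_pi_single]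
  simp

theorem adjoint_summandIncl (i : Fin n) :
    ContinuousLinearMap.adjoint (summandIncl H i) = summandProj H i := by
  symm
  rw [ContinuousLinearMap.eq_adjoint_iff]
  intro x y
  rw [PiLp.inner_apply]
  change inner ℂ (x i) y = ∑ j, inner ℂ (x j) ((Pi.single i y : Fin n → H) j)
  rw [Finset.sum_eq_single i (fun j _ hj => by simp [hj]) (fun h => absurd (Finset.mem_univ _) h)]
  simp

theorem adjoint_summandProj (i : Fin n) :
    ContinuousLinearMap.adjoint (summandProj H i) = summandIncl H i := by
  rw [← adjoint_summandIncl, ContinuousLinearMap.adjoint_adjoint]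

/-- The action of a matrix of operators on `Hⁿ`. -/
noncomputable def matrixOp (X : Matrix (Fin n) (Fin n) (H →L[ℂ] H)) :
    (PiLp 2 fun _ : Fin n => H) →L[ℂ] (PiLp 2 fun _ : Fin n => H) :=
  ∑ i, ∑ j, summandIncl H i ∘L (X i j) ∘L summandProj H j

theorem proj_matrixOp_incl (X : Matrix (Fin n) (Fin n) (H →L[ℂ] H)) (i j : Fin n) :
    summandProj H i ∘L matrixOp X ∘L summandIncl H j = X i j := by
  have h1 : ∀ k l, summandProj H i ∘L (summandIncl H k ∘L X k l ∘L summandProj H l) ∘L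
      summandIncl H j = if i = k then if l = j then X k l else 0 else 0 := fun k l => by
    have : summandProj H i ∘L (summandIncl H k ∘L X k l ∘L summandProj H l) ∘L
      summandIncl H j = (summandProj H i ∘L summandIncl H k) ∘L X k l ∘L
        (summandProj H l ∘L summandIncl H j) := rfl
    rw [this, summandProj_comp_incl, summandProj_comp_incl]
    split_ifs <;> ext <;> simp
  simp only [matrixOp, ContinuousLinearMap.finsetSum_comp, ContinuousLinearMap.comp_finsetSum, h1]
  simp

theorem matrixOp_injective : Function.Injective (matrixOp (H := H) (n := n)) := fun X Y h => by
  ext i j : 1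
  rw [← proj_matrixOp_incl X, h, proj_matrixOp_incl]

/-- Insert the resolution of the identity by the coordinate projections on both sides of T. This
makes every operator on Hⁿ a matrix, and it also yields multiplicativity. -/
theorem matrixOp_entries (T : (PiLp 2 fun _ : Fin n => H) →L[ℂ] (PiLp 2 fun _ : Fin n => H)) :
    matrixOp (Matrix.of fun i j => summandProj H i ∘L T ∘L summandIncl H j) = T := by
  have : (1 : (PiLp 2 fun _ : Fin n => H) →L[ℂ] _) ∘L T ∘L
      (1 : (PiLp 2 fun _ : Fin n => H) →L[ℂ] _) = T := rfl
  conv_rhs => rw [← this, ← sum_summandIncl_comp_proj]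
  simp only [matrixOp, ContinuousLinearMap.finsetSum_comp, ContinuousLinearMap.comp_finsetSum]
  rw [Finset.sum_comm]
  rfl

theorem matrixOp_mul (X Y : Matrix (Fin n) (Fin n) (H →L[ℂ] H)) :
    matrixOp (X * Y) = matrixOp X * matrixOp Y := by
  rw [← matrixOp_entries (matrixOp X * matrixOp Y)]
  congr 1
  ext i j : 1
  change ∑ k, X i k * Y k j = _
  have : (matrixOp X : (PiLp 2 fun _ : Fin n => H) →L[ℂ] _) * matrixOp Y =
      matrixOp X ∘L (1 : (PiLp 2 fun _ : Fin n => H) →L[ℂ] _) ∘L matrixOp Y := rfl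
  rw [Matrix.of_apply, this, ← sum_summandIncl_comp_proj]
  simp only [ContinuousLinearMap.finsetSum_comp, ContinuousLinearMap.comp_finsetSum]
  refine Finset.sum_congr rfl fun k _ => ?_
  rw [← proj_matrixOp_incl X, ← proj_matrixOp_incl Y]
  rfl

theorem matrixOp_star (X : Matrix (Fin n) (Fin n) (H →L[ℂ] H)) :
    matrixOp (star X) = star (matrixOp X) := by
  rw [ContinuousLinearMap.star_eq_adjoint]
  simp only [matrixOp, map_sum, ContinuousLinearMap.adjoint_comp, adjoint_summandIncl,
    adjoint_summandProj]
  rw [Finset.sum_comm]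
  rfl

theorem matrixOp_zero : matrixOp (0 : Matrix (Fin n) (Fin n) (H →L[ℂ] H)) = 0 := by
  simp [matrixOp]

end MatrixRepresentation

/-! ### Signs of self-adjoint matrices over a von Neumann algebra. -/

section Sign
variable {H : Type*} [NormedAddCommGroup H] [InnerProductSpace ℂ H] [CompleteSpace H]
  (N : VonNeumannAlgebra H) {n : ℕ}

/-- The underlying matrix of operators of a matrix over `N`. -/
def coeMatrix (X : CStarMatrix (Fin n) (Fin n) N) : Matrix (Fin n) (Fin n) (H →L[ℂ] H) :=
  Matrix.of fun i j => (X i j : H →L[ℂ] H)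

/-- The representation of `M_n(N)` on `Hⁿ`. -/
noncomputable def matrixRep (X : CStarMatrix (Fin n) (Fin n) N) :
    (PiLp 2 fun _ : Fin n => H) →L[ℂ] (PiLp 2 fun _ : Fin n => H) :=
  matrixOp (coeMatrix N X)

theorem matrixRep_injective : Function.Injective (matrixRep N (n := n)) := fun _ _ h =>
  CStarMatrix.ext fun i j => Subtype.ext (congrFun (congrFun (matrixOp_injective h) i) j)

theorem matrixRep_mul (X Y : CStarMatrix (Fin n) (Fin n) N) :
    matrixRep N (X * Y) = matrixRep N X * matrixRep N Y := by
  rw [matrixRep, matrixRep, matrixRep, ← matrixOp_mul]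
  congr 1
  ext i j : 1
  rw [Matrix.mul_apply]
  change ((∑ k, X i k * Y k j : N) : H →L[ℂ] H) = _
  rw [AddSubmonoidClass.coe_finsetSum]
  rfl

theorem matrixRep_star (X : CStarMatrix (Fin n) (Fin n) N) :
    matrixRep N (star X) = star (matrixRep N X) := by
  rw [matrixRep, matrixRep, ← matrixOp_star]
  rfl

theorem matrixRep_zero : matrixRep N (0 : CStarMatrix (Fin n) (Fin n) N) = 0 :=
  matrixOp_zero

theorem matrixOp_diagonal_commute {b : H →L[ℂ] H} (hb : b ∈ N.commutant)
    (X : CStarMatrix (Fin n) (Fin n) N) :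
    Commute (matrixOp (Matrix.diagonal fun _ : Fin n => b)) (matrixRep N X) := by
  rw [Commute, SemiconjBy, matrixRep, ← matrixOp_mul, ← matrixOp_mul]
  congr 1
  ext i j : 1
  rw [Matrix.diagonal_mul, Matrix.mul_diagonal]
  exact (VonNeumannAlgebra.mem_commutant_iff.1 hb _ (X i j).2).symm

/-- An operator on `Hⁿ` that commutes with the diagonal operators of the commutant of `N` is given
by a matrix over `N`. -/
theorem exists_matrixRep_eq
    (T : (PiLp 2 fun _ : Fin n => H) →L[ℂ] (PiLp 2 fun _ : Fin n => H))
    (hT : ∀ b ∈ N.commutant, Commute (matrixOp (Matrix.diagonal fun _ : Fin n => b)) T) :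
    ∃ X : CStarMatrix (Fin n) (Fin n) N, matrixRep N X = T := by
  set Y : Matrix (Fin n) (Fin n) (H →L[ℂ] H) :=
    Matrix.of fun i j => summandProj H i ∘L T ∘L summandIncl H j with hY
  have hYT : matrixOp Y = T := matrixOp_entries T
  have hmem : ∀ i j, Y i j ∈ N := fun i j => by
    rw [← N.commutant_commutant, VonNeumannAlgebra.mem_commutant_iff]
    intro b hb
    have h := hT b hb
    rw [← hYT, Commute, SemiconjBy, ← matrixOp_mul, ← matrixOp_mul] at h
    have h2 := congrFun (congrFun (matrixOp_injective h) i) j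
    rwa [Matrix.diagonal_mul, Matrix.mul_diagonal] at h2
  exact ⟨CStarMatrix.ofMatrix (Matrix.of fun i j => (⟨Y i j, hmem i j⟩ : N)), hYT⟩

/-- The sign of a self-adjoint matrix over a von Neumann algebra. -/
theorem VonNeumannAlgebra.exists_sign (s : CStarMatrix (Fin n) (Fin n) N) (hs : IsSelfAdjoint s) :
    ∃ w : CStarMatrix (Fin n) (Fin n) N, star w = w ∧ w * w = 1 ∧ 0 ≤ w * s ∧
      ∀ u, Commute u s → Commute u w := by
  obtain ⟨a, b, ha, hb, hab, hba, h1⟩ := exists_nonneg_sub_nonneg hs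
  obtain ⟨P, hPs, hPP, hPQ, hPker, hPcomm⟩ := exists_range_projection (matrixRep N a)
  -- The commutant of N is closed under adjoints, so diagonal copies of c and c* both commute with
  -- a, and hence with its range projection. This puts P in M_n(N).
  obtain ⟨p, rfl⟩ := exists_matrixRep_eq N P fun c hc => by
    refine hPcomm _ (matrixOp_diagonal_commute N hc _) ?_
    have e : star (matrixOp (Matrix.diagonal fun _ : Fin n => c)) =
        matrixOp (Matrix.diagonal fun _ : Fin n => star c) := by
      rw [← matrixOp_star, Matrix.star_eq_conjTranspose, Matrix.diagonal_conjTranspose]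
      rfl
    rw [e]
    exact matrixOp_diagonal_commute N (star_mem hc) _
  have hinj := matrixRep_injective N (n := n)
  have hps : star p = p := hinj (by rw [matrixRep_star, hPs])
  have hpp : p * p = p := hinj (by rw [matrixRep_mul, hPP])
  have hpq : p * a = a := hinj (by rw [matrixRep_mul, hPQ])
  have hnp : b * p = 0 := hinj (by
    rw [matrixRep_mul, matrixRep_zero]
    refine hPker _ ?_
    rw [← matrixRep_mul, hba, matrixRep_zero])
  have hpn : p * b = 0 := by
    have := congrArg star hnp
    rwa [star_mul, hps, hb.isSelfAdjoint.star_eq, star_zero] at this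
  -- The sign is w = 2p - 1, with p the range projection of the positive part. It equals -1 on the
  -- kernel of s too, so w² = 1 holds exactly. Since pa = a and pb = 0, one gets ws = a + b.
  refine ⟨p + p - 1, by rw [star_sub, star_add, star_one, hps], ?_, ?_, fun u hu => ?_⟩
  · have : (p + p - 1) * (p + p - 1) = 4 • (p * p) - 4 • p + 1 := by noncomm_ring
    rw [this, hpp, sub_self, zero_add]
  · have e : (p + p - 1) * s = a + b := by
      rw [hab, sub_mul, add_mul, mul_sub, hpq, hpn, one_mul]
      abel
    rw [e]
    exact add_nonneg ha hb
  · have h2 : Commute (star u) s := by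
      have := congrArg star hu.eq
      rw [star_mul, star_mul, hs.star_eq] at this
      exact this.symm
    have h3 : Commute u p := by
      refine hinj ?_
      rw [matrixRep_mul, matrixRep_mul]
      refine hPcomm _ ?_ ?_
      · rw [Commute, SemiconjBy, ← matrixRep_mul, ← matrixRep_mul, (h1 u hu).eq]
      · rw [Commute, SemiconjBy, ← matrixRep_star, ← matrixRep_mul, ← matrixRep_mul,
          (h1 _ h2).eq]
    exact (h3.add_right h3).sub_right (Commute.one_right u)

end Sign

/-! ### Exponentials. -/

theorem contDiff_exp_smul {B : Type*} [NormedRing B] [NormedAlgebra ℝ B] [CompleteSpace B] (a : B) :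
    ContDiff ℝ ((⊤ : ℕ∞) : WithTop ℕ∞) fun t : ℝ => NormedSpace.exp (t • a) :=
  contDiff_iff_contDiffAt.2 fun t => (NormedSpace.exp_analytic (𝕂 := ℝ) (t • a)).contDiffAt.comp t
    (contDiff_id.smul contDiff_const).contDiffAt

namespace SemifiniteTrace
open Set

variable {A : Type*} [CStarAlgebra A] [PartialOrder A] [StarOrderedRing A] (τ : SemifiniteTrace A)

theorem coe_expGL {n : ℕ} (x : Matrix (Fin n) (Fin n) τ.TraceClass) :
    ((τ.expGL x).1 : Matrix (Fin n) (Fin n) A) = NormedSpace.exp (τ.inclM x) := rfl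

/-- The logarithmic determinant of an exponential. -/
theorem logDet_expGL {n : ℕ} (x : Matrix (Fin n) (Fin n) τ.TraceClass) :
    τ.logDet (τ.expGL x) = (τ.functional x.trace).re := by
  set a : CStarMatrix (Fin n) (Fin n) A := CStarMatrix.ofMatrix (τ.inclM x) with ha
  set e : ℝ → CStarMatrix (Fin n) (Fin n) A := fun t => NormedSpace.exp (t • a) with he
  have hesm : ContDiff ℝ ((⊤ : ℕ∞) : WithTop ℕ∞) e := contDiff_exp_smul a
  have hentry : ∀ i j, ContDiff ℝ ((⊤ : ℕ∞) : WithTop ℕ∞) fun t => e t i j := fun i j => by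
    let l : CStarMatrix (Fin n) (Fin n) A →L[ℝ] A :=
      { toFun := fun X => X i j
        map_add' := fun _ _ => rfl
        map_smul' := fun _ _ => rfl
        cont := (continuous_apply j).comp (continuous_apply i) }
    exact l.contDiff.comp hesm
  have hder : ∀ i j t, HasDerivAt (fun t => e t i j) ((a * e t) i j) t := fun i j t =>
    hasDerivAt_pi.1 (hasDerivAt_pi.1 ((hasDerivAt_exp_smul_const' (𝕂 := ℝ) a t)) i) j
  -- The candidate derivative x e^{tx}, as a function into L¹_τ. It is smooth there because one
  -- factor is a fixed matrix over the ideal and multiplication is bounded.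
  set ψ : Fin n → Fin n → ℝ → τ.TraceClass := fun i j t =>
    ∑ k, TraceClass.mulR τ (x i k) (e t k j) with hψ
  have hψsm : ∀ i j, ContDiff ℝ ((⊤ : ℕ∞) : WithTop ℕ∞) (ψ i j) := fun i j =>
    ContDiff.sum fun k _ => ((TraceClass.mulR τ (x i k)).restrictScalars ℝ).contDiff.comp
      (hentry k j)
  have hψincl : ∀ i j t, TraceClass.incl τ (ψ i j t) = (a * e t) i j := fun i j t => by
    rw [hψ, map_sum]
    exact (Matrix.mul_apply (M := τ.inclM x) (N := CStarMatrix.ofMatrix.symm (e t))).symm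
  set γ : ℝ → relGLn τ.ideal n := fun t => τ.expGL ((t : ℂ) • x) with hγ
  have hγe : ∀ t, ((γ t).1 : Matrix (Fin n) (Fin n) A) = CStarMatrix.ofMatrix.symm (e t) :=
    fun t => by
      have h1 : τ.inclM ((t : ℂ) • x) = (t : ℂ) • τ.inclM x := by
        ext i j
        exact map_smul (TraceClass.incl τ) (t : ℂ) (x i j)
      rw [hγ, coe_expGL, h1]
      rfl
  -- Smoothness of e^{tx} in A does not by itself give smoothness in the finer norm. The identity
  -- e^{tx} - 1 = ∫ x e^{sx} ds is verified in A, and injectivity of the inclusion transfers it to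
  -- L¹_τ.
  have hsub : ∀ i j, (fun t => subOne (γ t) i j) = fun t => ∫ s in (0 : ℝ)..t, ψ i j s :=
    fun i j => funext fun t => by
      refine TraceClass.incl_injective τ ?_
      have hint := fun i j => ((hψsm i j).continuous.intervalIntegrable 0 t :
        IntervalIntegrable (ψ i j) MeasureTheory.volume 0 t)
      have hc : Continuous fun t => (a * e t) i j := by
        simp_rw [← hψincl]
        exact (TraceClass.inclL τ).continuous.comp (hψsm i j).continuous
      have h1 := (TraceClass.inclL τ).intervalIntegral_comp_comm (hint i j)
      simp only [TraceClass.inclL_apply, hψincl] at h1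
      rw [← h1, intervalIntegral.integral_eq_sub_of_hasDerivAt (fun s _ => hder i j s)
        (hc.intervalIntegrable 0 t)]
      change ((γ t).1 : Matrix (Fin n) (Fin n) A) i j - (1 : Matrix (Fin n) (Fin n) A) i j = _
      have h0 : e 0 = 1 := by simp [he]
      rw [hγe, h0]
      rfl
  have hderiv : ∀ i j t, HasDerivAt (fun t => subOne (γ t) i j) (ψ i j t) t := fun i j t => by
    rw [hsub]
    exact ((hψsm i j).continuous.integral_hasStrictDerivAt 0 t).hasDerivAt
  have hsmooth : τ.IsSmoothPath γ := fun i j => by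
    refine ContDiff.contDiffOn (contDiff_infty_iff_deriv.2 ⟨fun t =>
      (hderiv i j t).differentiableAt, ?_⟩)
    rw [show deriv (fun t => subOne (γ t) i j) = ψ i j from funext fun t => (hderiv i j t).deriv]
    exact hψsm i j
  -- Along this path γ'γ⁻¹ = x is constant.
  have hlog : ∀ t ∈ uIcc (0 : ℝ) 1, τ.logDeriv γ t = τ.matTrace (τ.inclM x) := fun t ht => by
    rw [uIcc_of_le zero_le_one] at ht
    have h1 : τ.inclM (τ.pathDeriv γ t) =
        τ.inclM x * ((γ t).1 : Matrix (Fin n) (Fin n) A) := by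
      rw [hγe]
      ext i j
      have : τ.pathDeriv γ t i j = ψ i j t :=
        (hderiv i j t).hasDerivWithinAt.derivWithin (uniqueDiffOn_Icc zero_lt_one t ht)
      exact (congrArg (TraceClass.incl τ) this).trans (hψincl i j t)
    rw [logDeriv, h1, mul_assoc, Units.mul_inv, mul_one]
  have h := hsmooth.re_integral_logDeriv
  rw [intervalIntegral.integral_congr hlog] at h
  have h0 : γ 0 = 1 := Subtype.ext (Units.ext (by
    rw [hγe]
    simp only [he, zero_smul, NormedSpace.exp_zero]
    rfl))
  have h1 : γ 1 = τ.expGL x := by simp only [hγ, Complex.ofReal_one, one_smul]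
  rw [h0, h1, logDet_one, sub_zero] at h
  rw [← h, functional_trace]
  simp

-- The trace is a bounded functional, so it passes under the integral defining the logarithm of the
-- path; the primitive formula then leaves only the endpoint.
variable {τ} in
theorem SmoothPath.tildeTau_re {n : ℕ} (σ : SmoothPath τ n) :
    σ.tildeTau.re = -τ.logDet (σ.toFun 1) := by
  have hs : τ.IsSmoothPath σ.toFun := σ.smooth
  have h := hs.re_integral_logDeriv
  rw [σ.source, logDet_one, sub_zero] at h
  rw [← h, tildeTau, Complex.neg_re]
  congr 2
  have hint : ∀ i j, IntervalIntegrable (fun t => matMul (τ.pathDeriv σ.toFun t)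
      (((σ.toFun t).1⁻¹ : GLn A n) : Matrix (Fin n) (Fin n) A) i j) MeasureTheory.volume 0 1 :=
    fun i j => (hs.continuousOn_matMul i j).intervalIntegrable_of_Icc zero_le_one
  rw [← TraceClass.traceL_apply, Matrix.trace, map_sum]
  calc ∑ i, TraceClass.traceL τ (σ.log.diag i)
      = ∑ i, ∫ t in (0 : ℝ)..1, TraceClass.traceL τ (matMul (τ.pathDeriv σ.toFun t)
          (((σ.toFun t).1⁻¹ : GLn A n) : Matrix (Fin n) (Fin n) A) i i) :=
        Finset.sum_congr rfl fun i _ =>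
          ((TraceClass.traceL τ).intervalIntegral_comp_comm (hint i i)).symm
    _ = ∫ t in (0 : ℝ)..1, ∑ i, TraceClass.traceL τ (matMul (τ.pathDeriv σ.toFun t)
          (((σ.toFun t).1⁻¹ : GLn A n) : Matrix (Fin n) (Fin n) A) i i) := by
        refine (intervalIntegral.integral_finsetSum fun i _ => ?_).symm
        exact ((TraceClass.traceL τ).continuous.comp_continuousOn
          (hs.continuousOn_matMul i i)).intervalIntegrable_of_Icc zero_le_one
    _ = _ := intervalIntegral.integral_congr fun t _ => rfl

/-! ### Descent to GL_∞ and to K₁, assuming smooth connectedness. -/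

section Connected
variable {τ} (hJ : ∀ (n : ℕ) (g : relGLn τ.ideal n), τ.IsJoinedToOne g)
include hJ

/-- Representatives of one class become equal after stabilization, which preserves the logarithmic
determinant. Hence the choice made in `logDetInf` does not matter. -/
theorem logDet_eq_of_of_eq {n m : ℕ} {g : relGLn τ.ideal n} {h : relGLn τ.ideal m}
    (e : GLInf.of g.1 = GLInf.of h.1) : τ.logDet g = τ.logDet h := by
  obtain ⟨l, hn, hm, e⟩ := Quotient.exact e
  have e' : stab hn g.1 = stab hm h.1 := e
  rw [← (hJ n g).logDet_stab hn, ← (hJ m h).logDet_stab hm]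
  congr 1
  exact Subtype.ext e'

omit hJ in
variable (τ) in
/-- The logarithmic determinant on `GL_∞(L¹_τ(A))`. -/
noncomputable def logDetInf (c : relGL τ.ideal) : ℝ :=
  τ.logDet (⟨c.2.choose_spec.choose, c.2.choose_spec.choose_spec.1⟩ : relGLn τ.ideal c.2.choose)

theorem logDetInf_of {n : ℕ} (g : relGLn τ.ideal n) :
    τ.logDetInf (relGL.of τ.ideal g) = τ.logDet g :=
  logDet_eq_of_of_eq hJ (relGL.of τ.ideal g).2.choose_spec.choose_spec.2

omit hJ in
theorem exists_of_eq (c : relGL τ.ideal) :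
    ∃ (n : ℕ) (g : relGLn τ.ideal n), relGL.of τ.ideal g = c := by
  obtain ⟨c, n, g, hg, rfl⟩ := c
  exact ⟨n, ⟨g, hg⟩, rfl⟩

omit hJ in
theorem of_stab {n m : ℕ} (h : n ≤ m) (g : relGLn τ.ideal n) :
    relGL.of τ.ideal ⟨stab h g.1, stab_mem_relGLn τ.ideal h g.2⟩ = relGL.of τ.ideal g :=
  Subtype.ext (GLInf.of_stab h g.1)

theorem logDetInf_mul (c d : relGL τ.ideal) :
    τ.logDetInf (c * d) = τ.logDetInf c + τ.logDetInf d := by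
  obtain ⟨n, g, rfl⟩ := exists_of_eq c
  obtain ⟨m, h, rfl⟩ := exists_of_eq d
  rw [← of_stab (le_max_left n m) g, ← of_stab (le_max_right n m) h]
  set g' : relGLn τ.ideal (max n m) := ⟨stab (le_max_left n m) g.1, _⟩
  set h' : relGLn τ.ideal (max n m) := ⟨stab (le_max_right n m) h.1, _⟩
  have e : relGL.of τ.ideal g' * relGL.of τ.ideal h' = relGL.of τ.ideal (g' * h') :=
    Subtype.ext (GLInf.of_mul g'.1 h'.1).symm
  rw [e, logDetInf_of hJ, logDetInf_of hJ, logDetInf_of hJ, (hJ _ g').logDet_mul]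

theorem logDetInf_conj (c : relGL τ.ideal) (k : GLInf A) :
    τ.logDetInf ⟨k * (c : GLInf A) * k⁻¹, (relGL_normal τ.ideal).conj_mem c c.2 k⟩ =
      τ.logDetInf c := by
  obtain ⟨n, g, rfl⟩ := exists_of_eq c
  induction k using DirectLimit.induction with
  | _ m h =>
    set g' : relGLn τ.ideal (max n m) :=
      ⟨stab (le_max_left n m) g.1, stab_mem_relGLn τ.ideal _ g.2⟩ with hg'
    set h' : GLn A (max n m) := stab (le_max_right n m) h with hh'
    have e1 : relGL.of τ.ideal g = relGL.of τ.ideal g' := (of_stab (le_max_left n m) g).symm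
    have e2 : GLInf.of h = GLInf.of h' := (GLInf.of_stab _ h).symm
    have e3 : GLInf.of (h' * g'.1 * h'⁻¹) = GLInf.of h' * GLInf.of g'.1 * (GLInf.of h')⁻¹ := by
      rw [GLInf.of_mul, GLInf.of_mul]
      rfl
    rw [e1, logDetInf_of hJ, ← (hJ _ g').logDet_conj h', ← logDetInf_of hJ]
    congr 1
    refine Subtype.ext ?_
    change GLInf.of h * GLInf.of g'.1 * (GLInf.of h)⁻¹ = GLInf.of (h' * g'.1 * h'⁻¹)
    rw [e3, e2]

theorem logDetInf_one : τ.logDetInf 1 = 0 := by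
  have := logDetInf_mul hJ 1 1
  rw [one_mul] at this
  linarith

theorem logDetInf_inv (c : relGL τ.ideal) : τ.logDetInf c⁻¹ = -τ.logDetInf c := by
  have := logDetInf_mul hJ c⁻¹ c
  rw [inv_mul_cancel, logDetInf_one hJ] at this
  linarith

/-- A mixed commutator is g·(k g⁻¹ k⁻¹), and conjugation by any k in GL_∞(A) preserves the value, so
the two factors cancel. The generators thus lie in the kernel, which is a subgroup. -/
theorem logDetInf_eq_zero_of_mem_commutator {c : relGL τ.ideal}
    (hc : (c : GLInf A) ∈ ⁅relGL τ.ideal, (⊤ : Subgroup (GLInf A))⁆) : τ.logDetInf c = 0 := by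
  let K : Subgroup (relGL τ.ideal) :=
    { carrier := {c | τ.logDetInf c = 0}
      one_mem' := logDetInf_one hJ
      mul_mem' := fun {c d} hc hd => by
        rw [mem_ofPred_eq] at hc hd ⊢
        rw [logDetInf_mul hJ, hc, hd, add_zero]
      inv_mem' := fun {c} hc => by
        rw [mem_ofPred_eq] at hc ⊢
        rw [logDetInf_inv hJ, hc, neg_zero] }
  have hle : ⁅relGL τ.ideal, (⊤ : Subgroup (GLInf A))⁆ ≤ K.map (relGL τ.ideal).subtype := by
    rw [Subgroup.commutator_le]
    intro g hg k _
    refine ⟨⟨g, hg⟩ * ⟨k * ((⟨g, hg⟩ : relGL τ.ideal)⁻¹ : relGL τ.ideal) * k⁻¹,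
      (relGL_normal τ.ideal).conj_mem _ (Subtype.prop _) k⟩, ?_, ?_⟩
    · change τ.logDetInf _ = 0
      rw [logDetInf_mul hJ, logDetInf_conj hJ, logDetInf_inv hJ, add_neg_cancel]
    · change g * (k * g⁻¹ * k⁻¹) = g * k * g⁻¹ * k⁻¹
      simp only [mul_assoc]
  obtain ⟨d, hd, hdc⟩ := hle hc
  rw [← Subtype.ext hdc]
  exact hd

theorem logDetInf_eq_of_mk_eq {c d : relGL τ.ideal}
    (h : K1alg.mk τ.ideal c = K1alg.mk τ.ideal d) : τ.logDetInf c = τ.logDetInf d := by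
  have h1 := logDetInf_eq_zero_of_mem_commutator hJ
    (Subgroup.mem_subgroupOf.1 (QuotientGroup.eq.1 h))
  rw [logDetInf_mul hJ, logDetInf_inv hJ] at h1
  linarith

-- The inverse is joined to 1 because the class attached to a path is that of the inverse of its
-- endpoint.
omit hJ in
theorem exists_smoothPath {n : ℕ} {g : relGLn τ.ideal n} (hg : τ.IsJoinedToOne g⁻¹) :
    ∃ σ : SmoothPath τ n, σ.theta = K1alg.mk τ.ideal (relGL.of τ.ideal g) := by
  obtain ⟨γ, hγ, h0, h1⟩ := hg
  refine ⟨⟨γ, h0, hγ⟩, ?_⟩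
  change K1alg.mk τ.ideal (relGL.of τ.ideal (γ 1)⁻¹) = _
  rw [h1, inv_inv]

theorem exists_theta_eq (c : K1alg τ.ideal) : ∃ (n : ℕ) (σ : SmoothPath τ n), σ.theta = c := by
  induction c using QuotientGroup.induction_on with
  | H c =>
    obtain ⟨n, g, rfl⟩ := exists_of_eq c
    exact ⟨n, exists_smoothPath (hJ n g⁻¹)⟩

theorem tildeTau_re_eq {n : ℕ} (σ : SmoothPath τ n) :
    σ.tildeTau.re = τ.logDetInf (relGL.of τ.ideal (σ.toFun 1)⁻¹) := by
  have e : relGL.of τ.ideal (σ.toFun 1)⁻¹ = (relGL.of τ.ideal (σ.toFun 1))⁻¹ := rfl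
  rw [σ.tildeTau_re, e, logDetInf_inv hJ, logDetInf_of hJ]

/-- The lift selected in the definition of `det` may have another matrix size, but both exponents
are values of `logDetInf` at elements of the same K₁ class. The fallback value 1 never occurs here,
as σ itself is a lift. -/
theorem det_theta {n : ℕ} (σ : SmoothPath τ n) : τ.det σ.theta = Real.exp σ.tildeTau.re := by
  have h : ∃ p : Σ n, SmoothPath τ n, p.2.theta = σ.theta := ⟨⟨n, σ⟩, rfl⟩
  rw [det, dif_pos h, tildeTau_re_eq hJ, tildeTau_re_eq hJ,
    logDetInf_eq_of_mk_eq hJ h.choose_spec]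

theorem det_mk (c : relGL τ.ideal) : τ.det (K1alg.mk τ.ideal c) = Real.exp (τ.logDetInf c) := by
  obtain ⟨n, g, rfl⟩ := exists_of_eq c
  obtain ⟨σ, hσ⟩ := exists_smoothPath (hJ n g⁻¹)
  rw [← hσ, det_theta hJ, tildeTau_re_eq hJ, logDetInf_eq_of_mk_eq hJ hσ]

end Connected

theorem functional_im_of_isSelfAdjoint {x : τ.TraceClass}
    (hx : IsSelfAdjoint (TraceClass.incl τ x)) : (τ.functional x).im = 0 := by
  have := τ.traceVal_star (TraceClass.incl τ x)
  rw [hx.star_eq] at this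
  exact Complex.conj_eq_iff_im.1 this.symm

end SemifiniteTrace

/-- `τ` is a normal, faithful, semi-finite trace on a von Neumann algebra `N ⊆ B(H)`.
The determinant of `K₁^alg(L¹_τ(N), N)` is well defined (every class has a lift to a smooth path,
and every lift computes the determinant), positive, multiplicative, invariant under conjugation by
`GL_∞(N)`, and has the stated values on exponentials. -/
theorem mainTheorem2 {H : Type*} [NormedAddCommGroup H] [InnerProductSpace ℂ H] [CompleteSpace H]
    (N : VonNeumannAlgebra H) (τ : SemifiniteTrace N) :
    (∀ c : K1alg τ.ideal, ∃ (n : ℕ) (σ : τ.SmoothPath n), σ.theta = c) ∧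
    (∀ (n : ℕ) (σ : τ.SmoothPath n), τ.det σ.theta = Real.exp σ.tildeTau.re) ∧
    (∀ c : K1alg τ.ideal, 0 < τ.det c) ∧
    (∀ g h : relGL τ.ideal,
      τ.det (K1alg.mk τ.ideal (g * h)) =
        τ.det (K1alg.mk τ.ideal g) * τ.det (K1alg.mk τ.ideal h)) ∧
    (∀ (g : relGL τ.ideal) (h : GLInf N),
      τ.det (K1alg.mk τ.ideal
        ⟨h * (g : GLInf N) * h⁻¹, (relGL_normal τ.ideal).conj_mem g g.2 h⟩) =
          τ.det (K1alg.mk τ.ideal g)) ∧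
    (∀ (n : ℕ) (x : Matrix (Fin n) (Fin n) τ.TraceClass),
      τ.det (K1alg.mk τ.ideal (relGL.of τ.ideal (τ.expGL x))) =
        Real.exp (τ.functional x.trace).re) ∧
    (∀ x : τ.TraceClass, IsSelfAdjoint (SemifiniteTrace.TraceClass.incl τ x) →
      (τ.det (K1alg.mk τ.ideal
        (relGL.of τ.ideal (τ.expGL (Matrix.of fun _ _ : Fin 1 => x)))) : ℂ) =
          Complex.exp (τ.functional x)) := by
  -- Signs in M_n(N) supply the connectedness on which all of the descent rests.
  have hJ : ∀ (n : ℕ) (g : relGLn τ.ideal n), τ.IsJoinedToOne g := fun n g =>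
    τ.isJoinedToOne_of_exists_sign (VonNeumannAlgebra.exists_sign N) g
  refine ⟨SemifiniteTrace.exists_theta_eq hJ, fun n σ => SemifiniteTrace.det_theta hJ σ,
    fun c => ?_, fun g h => ?_, fun g h => ?_, fun n x => ?_, fun x hx => ?_⟩
  · obtain ⟨n, σ, rfl⟩ := SemifiniteTrace.exists_theta_eq hJ c
    rw [SemifiniteTrace.det_theta hJ]
    exact Real.exp_pos _
  · rw [SemifiniteTrace.det_mk hJ, SemifiniteTrace.det_mk hJ, SemifiniteTrace.det_mk hJ,
      SemifiniteTrace.logDetInf_mul hJ, Real.exp_add]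
  · rw [SemifiniteTrace.det_mk hJ, SemifiniteTrace.det_mk hJ, SemifiniteTrace.logDetInf_conj hJ]
  · rw [SemifiniteTrace.det_mk hJ, SemifiniteTrace.logDetInf_of hJ, τ.logDet_expGL]
  · rw [SemifiniteTrace.det_mk hJ, SemifiniteTrace.logDetInf_of hJ, τ.logDet_expGL,
      Complex.ofReal_exp]
    congr 1
    have e : (Matrix.of fun _ _ : Fin 1 => x).trace = x := by simp [Matrix.trace]
    rw [e]
    -- On self-adjoint elements τ is real, so the real part in the exponent can be dropped.
    exact Complex.ext rfl (τ.functional_im_of_isSelfAdjoint hx).symm
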